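/- Let $E$ be a locally compact, second-countable Hausdorff space, let $D=D(\mathbb{R}_+,E)$ be the space of c\`adl\`ag paths in $E$, and let $X$ be a Feller Markov process on $E$ with infinite lifetime: its Markov transition semigroup maps $C_0(E)$ to itself and is strongly continuous on $C_0(E)$, and $\mathbb{P}^x$ is its law on $D$ when it starts at $x\in E$. Assume that $X$ satisfies the immediate-collision assumption: if $X'$ and $X''$ are independent copies of $X$, then for all $t_0>0$ and $x'\in E$, $$\lim_{x''\to x'}\mathbb{P}^{x',x''}\{X'_t=X''_t\text{ for some }t\in[0,t_0]\}=1 .$$ For $N\in\{1,2,\dots\}\cup\{\infty\}$ let $[N]=\{1,\dots,N\}$ if $N<\infty$ and $[N]=\{1,2,\dots\}$ if $N=\infty$. For $\mathbf{x}\in E^{N}$ let $\mathbb{P}^{\mathbf{x}}=\bigotimes_{i\in[N]}\mathbb{P}^{x_i}$ be the law on $D^N$ of a vector $\boldsymbol\xi=(\xi_i)_{i\in[N]}$ of independent copies of $X$ started at the points $x_i$. Define coalescing paths $\zeta_i$, $i\in[N]$, inductively by $\zeta_1=\xi_1$ and, for $i>1$, $$\tau_i=\inf\{t\ge 0:\xi_i(t)\in\{\zeta_1(t),\dots,\zeta_{i-1}(t)\}\}\quad(\inf\emptyset=\infty),$$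 $$J_i=\min\{j<i:\xi_i(\tau_i)=\zeta_j(\tau_i)\}\ \text{ if }\tau_i<\infty,$$ with $\zeta_i(t)=\xi_i(t)$ for $t<\tau_i$ and $\zeta_i(t)=\zeta_{J_i}(t)$ for $t\ge\tau_i$. Let $\Xi_t$ be the closure in $E$ of $\{\zeta_i(t):i\in[N]\}$, $t\ge 0$. Then $\Xi=(\Xi_t)_{t\ge0}$ takes values in the set $\mathcal{C}$ of nonempty closed subsets of $E$. Give $\mathcal{C}$ the Borel $\sigma$-algebra of the topology obtained by identifying each element with its closure in the one-point compactification $\bar E$ of $E$ and using the Hausdorff metric on the nonempty compact subsets of $\bar E$; if $E$ is compact, this is the Hausdorff metric topology on the nonempty compact subsets of $E$. The distribution of $\Xi$ is its law on $\mathcal{C}^{\mathbb{R}_+}$ with the product $\sigma$-algebra. If $\mathbf{x}',\mathbf{x}''\in E^{N}$ are such that the sets $\{x'_i:i\in[N]\}$ and $\{x''_i:i\in[N]\}$ have the same closure, then the process $\Xi$ has the same distribution under $\mathbb{P}^{\mathbf{x}'}$ and $\mathbb{P}^{\mathbf{x}''}$. Consequently the distribution of $\Xi$ depends only on the closed set $\Xi_0$: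 there is a map $Q$ from $\mathcal{C}$ to the measures on $\mathcal{C}^{\mathbb{R}_+}$ such that, for all $N$ and all $\mathbf{x}\in E^N$, we have $\Xi_0=\overline{\{x_i:i\in[N]\}}$ $\mathbb{P}^{\mathbf{x}}$-almost surely, and $\Xi$ has distribution $Q\big(\overline{\{x_i:i\in[N]\}}\big)$ under $\mathbb{P}^{\mathbf{x}}$. -/

import Mathlib

open MeasureTheory ProbabilityTheory Filter Topology
open scoped ENNReal NNReal ZeroAtInfty

/-- A path `ω : ℝ₊ → E` is càdlàg: it is right-continuous and has left limits in `E`. -/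
def IsCadlag {E : Type*} [TopologicalSpace E] (ω : ℝ≥0 → E) : Prop :=
  ∀ t : ℝ≥0, ContinuousWithinAt ω (Set.Ici t) t ∧ ∃ l : E, Tendsto ω (𝓝[<] t) (𝓝 l)

/-- The path space `D = D(ℝ₊, E)` of càdlàg paths. As a subtype of a product it carries the
σ-algebra generated by the evaluations `ω ↦ ω t`. -/
abbrev CadlagPath (E : Type*) [TopologicalSpace E] : Type _ :=
  {ω : ℝ≥0 → E // IsCadlag ω}

/-- The σ-algebra on `D` generated by the path up to time `s`. -/
abbrev pathPast (E : Type*) [TopologicalSpace E] [MeasurableSpace E] (s : ℝ≥0) :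
    MeasurableSpace (CadlagPath E) :=
  ⨆ u : ℝ≥0, ⨆ _ : u ≤ s,
    MeasurableSpace.comap (fun ω : CadlagPath E => ω.1 u) inferInstance

/-- A family of kernels on `E` is a (conservative) Feller semigroup: it is a semigroup of Markov
kernels whose operators `f ↦ ∫ f(y) p_t(·, dy)` map `C₀(E)` to itself and are strongly continuous
at time `0` on `C₀(E)`. -/
structure IsFellerSemigroup {E : Type*} [TopologicalSpace E] [MeasurableSpace E]
    (p : ℝ≥0 → Kernel E E) : Prop where
  markov : ∀ t : ℝ≥0, IsMarkovKernel (p t)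
  zero : p 0 = Kernel.id
  add : ∀ s t : ℝ≥0, p (s + t) = p t ∘ₖ p s
  maps : ∀ (t : ℝ≥0) (f : C₀(E, ℝ)), ∃ g : C₀(E, ℝ), ∀ x : E, g x = ∫ y, f y ∂(p t x)
  continuous : ∀ f : C₀(E, ℝ),
    TendstoUniformly (fun (t : ℝ≥0) (x : E) => ∫ y, f y ∂(p t x)) f (𝓝 0)

/-- A Feller process with state space `E` and infinite lifetime: a Feller semigroup `p` together
with, for each starting point `x`, the law `ℙ^x` on càdlàg path space of a Markov process with
transition semigroup `p` that starts at `x`. -/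
structure FellerProcess (E : Type*) [TopologicalSpace E] [MeasurableSpace E] where
  /-- the transition semigroup -/
  p : ℝ≥0 → Kernel E E
  feller : IsFellerSemigroup p
  /-- the law `ℙ^x` of the process started at `x` -/
  law : E → Measure (CadlagPath E)
  isProbabilityMeasure_law : ∀ x : E, IsProbabilityMeasure (law x)
  start : ∀ x : E, ∀ᵐ ω ∂(law x), ω.1 0 = x
  markov : ∀ (x : E) (s t : ℝ≥0) (A : Set (CadlagPath E)) (B : Set E),
    MeasurableSet[pathPast E s] A → MeasurableSet B →
      law x (A ∩ {ω | ω.1 (s + t) ∈ B}) = ∫⁻ ω in A, p t (ω.1 s) B ∂(law x)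

attribute [instance] FellerProcess.isProbabilityMeasure_law

/-- The immediate-collision assumption: if `X'` and `X''` are independent copies of `X`, then
`ℙ^{x',x''} {X'_t = X''_t for some t ∈ [0, t₀]} → 1` as `x'' → x'`, for all `t₀ > 0` and `x'`. -/
def FellerProcess.ImmediateHit {E : Type*} [TopologicalSpace E] [MeasurableSpace E]
    (X : FellerProcess E) : Prop :=
  ∀ t₀ : ℝ≥0, 0 < t₀ → ∀ x' : E,
    Tendsto
      (fun x'' : E => ((X.law x').prod (X.law x''))
        {ω | ∃ t : ℝ≥0, t ≤ t₀ ∧ ω.1.1 t = ω.2.1 t})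
      (𝓝[≠] x') (𝓝 1)

/-- The index set `[N]`: it is `{1, …, N}` for finite `N`, and the positive integers for
`N = ∞`. -/
abbrev IndexSet (N : ℕ∞) : Type :=
  {i : ℕ // 1 ≤ i ∧ (i : ℕ∞) ≤ N}

instance IndexSet.instNonempty (N : ℕ∞) [NeZero N] : Nonempty (IndexSet N) :=
  ⟨⟨1, le_rfl, by simpa using Order.one_le_iff_pos.2 (pos_iff_ne_zero.2 (NeZero.ne N))⟩⟩

/-- The law `ℙ^𝐱` on `D^N` of independent copies `ξ_i` of `X`, with `ξ_i` started at `x_i`. -/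
noncomputable def FellerProcess.vectorLaw {E : Type*} [TopologicalSpace E] [MeasurableSpace E]
    (X : FellerProcess E) {N : ℕ∞} (x : IndexSet N → E) :
    Measure (IndexSet N → CadlagPath E) :=
  Measure.infinitePi fun i => X.law (x i)

section Coalescing

variable {E : Type*} {N : ℕ∞}

/-- The collision time `τ = inf {t : ξ_i(t) ∈ {ζ_j(t) : j < i}}` (`∞` if there is no such `t`) of
the free path `ξi` of index `i` with the coalescing paths `ζ j` of smaller index. -/
noncomputable def collisionTime (i : IndexSet N) (ξi : ℝ≥0 → E)
    (ζ : ∀ j : IndexSet N, j < i → ℝ≥0 → E) : ℝ≥0∞ :=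
  ⨅ (t : ℝ≥0) (_ : ∃ (j : IndexSet N) (hj : j < i), ξi t = ζ j hj t), (t : ℝ≥0∞)

/-- The set of all `j < i` with `ξ_i(t) = ζ_j(t)`. -/
def collisionPartners (i : IndexSet N) (ξi : ℝ≥0 → E)
    (ζ : ∀ j : IndexSet N, j < i → ℝ≥0 → E) (t : ℝ≥0) : Set {j : IndexSet N // j < i} :=
  {j | ξi t = ζ j.1 j.2 t}

open Classical in
/-- The coalescing path of index `i`, given the free path `ξi` and the coalescing paths of smaller
index: it follows `ξi` before the collision time `τ`, and from `τ` on it follows `ζ_J`, where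
`J` is the least `j < i` with `ξ_i(τ) = ζ_j(τ)`. For càdlàg paths such a `j` exists whenever
`τ < ∞`, since the infimum is then attained, so the last alternative does not occur. -/
noncomputable def coalesceStep (i : IndexSet N) (ξi : ℝ≥0 → E)
    (ζ : ∀ j : IndexSet N, j < i → ℝ≥0 → E) (t : ℝ≥0) : E :=
  if (t : ℝ≥0∞) < collisionTime i ξi ζ then ξi t
  else if h : (collisionPartners i ξi ζ (collisionTime i ξi ζ).toNNReal).Nonempty then
    let J := (wellFounded_lt (α := {j : IndexSet N // j < i})).min
      (collisionPartners i ξi ζ (collisionTime i ξi ζ).toNNReal) h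
    ζ J.1 J.2 t
  else ξi t

/-- The collision rule `Λ`: the vector `ζ = Λ ξ` of coalescing paths that is built from the vector
`ξ` of free paths by induction on the index. -/
noncomputable def collisionRule (ξ : IndexSet N → ℝ≥0 → E) : IndexSet N → ℝ≥0 → E :=
  (wellFounded_lt (α := IndexSet N)).fix fun i ζ => coalesceStep i (ξ i) ζ

end Coalescing

/-- The nonempty closed subsets of `E`. -/
structure NonemptyClosed (E : Type*) [TopologicalSpace E] extends TopologicalSpace.Closeds E where
  nonempty' : carrier.Nonempty

/-- The closure in the one-point compactification of `E` of a nonempty closed subset of `E`. -/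
def NonemptyClosed.compactify {E : Type*} [TopologicalSpace E] (F : NonemptyClosed E) :
    TopologicalSpace.NonemptyCompacts (OnePoint E) :=
  ⟨⟨closure ((fun y : E => (y : OnePoint E)) '' F.carrier), isClosed_closure.isCompact⟩,
    (F.nonempty'.image _).closure⟩

/-- The topology on the nonempty closed subsets of `E`, identified with their closures in the
one-point compactification of `E`: it is induced by the Vietoris topology on nonempty compact sets,
which is the topology of the Hausdorff metric for any metric on the compactification. For compact
`E` it is the topology of the Hausdorff metric on the nonempty compact subsets of `E`. -/
instance NonemptyClosed.instTopologicalSpace {E : Type*} [TopologicalSpace E] :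
    TopologicalSpace (NonemptyClosed E) :=
  TopologicalSpace.induced NonemptyClosed.compactify inferInstance

instance NonemptyClosed.instMeasurableSpace {E : Type*} [TopologicalSpace E] :
    MeasurableSpace (NonemptyClosed E) :=
  borel (NonemptyClosed E)

/-- The closure in `E` of the point set `{x_i : i ∈ [N]}` of a vector. -/
def pointClosure {E : Type*} [TopologicalSpace E] {N : ℕ∞} [NeZero N] (x : IndexSet N → E) :
    NonemptyClosed E :=
  ⟨⟨closure (Set.range x), isClosed_closure⟩, (Set.range_nonempty x).closure⟩

/-- The set-valued coalescing process: `Ξ_t` is the closure of `{ζ_i(t) : i ∈ [N]}`, where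
`ζ = Λ ξ`. -/
noncomputable def setProcess {E : Type*} [TopologicalSpace E] {N : ℕ∞} [NeZero N]
    (ξ : IndexSet N → CadlagPath E) (t : ℝ≥0) : NonemptyClosed E :=
  pointClosure fun i => collisionRule (fun j => (ξ j).1) i t

/-! The law of Ξ is determined by the probabilities that Ξ_t avoids an open set U_t for all t in a
finite set K (`NonemptyClosed.measure_pi_ext`). A particle that has coalesced only follows a path
that is already present. So Ξ_t is the closure of the positions of the living particles in a system
where a particle is killed on hitting a living one of higher priority
(`setOf_collisionRule_eq_occupied`). In the lists below priority increases towards the tail, so a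
new head never affects the other particles.

The heart of the proof is that priorities may be permuted without changing the law of the occupied
sets (`FellerProcess.exists_measurePreserving_perm`). For two neighbours a, b in the priority order,
interchange their paths after the first time at which they meet as living particles. By the strong
Markov property this preserves the joint law (`FellerProcess.map_swapTails`), and path by path it
has the effect of interchanging the two priorities (`occupied_interchange`).

Now take finitely many particles l started from points of x' and l' from points of x'' on one
probability space, with all times of K positive. For each y in l' there is a start in x' so near
that its particle i meets y before the first time of K with probability at least 1 - ε; let l
contain these i. Give i the highest priority, so that it is never killed, and y the lowest. Outside
an event of probability ε, y is then dead at all times of K and leaves the occupied sets there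
unchanged. Hence P(l avoids) ≤ P(l' ++ l avoids) + |l'| ε ≤ P(l' avoids) + |l'| ε, where the last
step gives l' the higher priority, so that l only adds positions. Letting ε → 0 and exhausting both
vectors gives an inequality between the two systems, and symmetry gives equality. Time 0 is treated
apart: Ξ_0 is almost surely the closure of the starting points.

The technical cost is measurability, since meeting by time c concerns uncountably many times.
Quasi-left-continuity of the Feller process shows that almost surely two paths that come arbitrarily
close on a countable time grid up to c do meet by c (`FellerProcess.ae_meet_of_approach`). So
meeting events agree, off a null set, with events of the past. -/

/-! ### Particle systems with killing by priority -/

section Killing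

variable {E : Type*} {ι : Type*}

/-- The positions occupied at time `t` by the particles with labels in `l`, where a particle is
killed as soon as it hits a living particle that comes later in the list `l`. -/
def occupied (ξ : ι → ℝ≥0 → E) : List ι → ℝ≥0 → Set E
  | [] => fun _ => ∅
  | y :: l => fun t => occupied ξ l t ∪ {z | z = ξ y t ∧ ∀ s ≤ t, ξ y s ∉ occupied ξ l s}

/-- The path with label `y` meets the living particles with labels in `l` by time `t`. -/
def HitBy (ξ : ι → ℝ≥0 → E) (l : List ι) (y : ι) (t : ℝ≥0) : Prop :=
  ∃ s ≤ t, ξ y s ∈ occupied ξ l s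

theorem HitBy.mono {ξ : ι → ℝ≥0 → E} {l : List ι} {y : ι} {s t : ℝ≥0} (h : HitBy ξ l y s)
    (hst : s ≤ t) : HitBy ξ l y t :=
  let ⟨r, hr, h⟩ := h
  ⟨r, hr.trans hst, h⟩

theorem occupied_cons (ξ : ι → ℝ≥0 → E) (y : ι) (l : List ι) (t : ℝ≥0) :
    occupied ξ (y :: l) t = occupied ξ l t ∪ {z | z = ξ y t ∧ ¬ HitBy ξ l y t} := by
  simp [occupied, HitBy]

theorem occupied_cons_of_hitBy {ξ : ι → ℝ≥0 → E} {y : ι} {l : List ι} {t : ℝ≥0}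
    (h : HitBy ξ l y t) : occupied ξ (y :: l) t = occupied ξ l t := by
  simp [occupied_cons, h]

theorem occupied_cons_of_not_hitBy {ξ : ι → ℝ≥0 → E} {y : ι} {l : List ι} {t : ℝ≥0}
    (h : ¬ HitBy ξ l y t) : occupied ξ (y :: l) t = insert (ξ y t) (occupied ξ l t) := by
  rw [occupied_cons, Set.union_comm, Set.insert_eq]
  simp [h]

theorem occupied_subset_cons (ξ : ι → ℝ≥0 → E) (y : ι) (l : List ι) (t : ℝ≥0) :
    occupied ξ l t ⊆ occupied ξ (y :: l) t := by
  rw [occupied_cons]; exact Set.subset_union_left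

theorem occupied_subset_append (ξ : ι → ℝ≥0 → E) (l' l : List ι) (t : ℝ≥0) :
    occupied ξ l t ⊆ occupied ξ (l' ++ l) t := by
  induction l' with
  | nil => exact subset_rfl
  | cons y l' ih => exact ih.trans (occupied_subset_cons ..)

theorem occupied_subset_range (ξ : ι → ℝ≥0 → E) (l : List ι) (t : ℝ≥0) :
    occupied ξ l t ⊆ {z | ∃ i ∈ l, z = ξ i t} := by
  induction l with
  | nil => simp [occupied]
  | cons y l ih =>
    rw [occupied_cons]
    rintro z (hz | ⟨hz, -⟩)
    · obtain ⟨i, hi, h⟩ := ih hz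
      exact ⟨i, List.mem_cons_of_mem _ hi, h⟩
    · exact ⟨y, List.mem_cons_self, hz⟩

/-- At time `0` no position is lost by killing. -/
theorem occupied_zero (ξ : ι → ℝ≥0 → E) (l : List ι) :
    occupied ξ l 0 = {z | ∃ i ∈ l, z = ξ i 0} := by
  refine (occupied_subset_range ξ l 0).antisymm ?_
  induction l with
  | nil => simp
  | cons y l ih =>
    rintro z ⟨i, hi, rfl⟩
    rcases List.mem_cons.1 hi with rfl | hi
    · by_cases h : ξ i 0 ∈ occupied ξ l 0
      · exact occupied_subset_cons _ _ _ _ h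
      · refine Or.inr ⟨rfl, fun s hs => ?_⟩
        rwa [nonpos_iff_eq_zero.1 hs]
    · exact occupied_subset_cons _ _ _ _ (ih ⟨i, hi, rfl⟩)

theorem occupied_congr {ξ ξ' : ι → ℝ≥0 → E} {l : List ι} {t : ℝ≥0}
    (h : ∀ i ∈ l, ∀ s ≤ t, ξ i s = ξ' i s) : occupied ξ l t = occupied ξ' l t := by
  induction l generalizing t with
  | nil => rfl
  | cons y l ih =>
    have h1 : ∀ s ≤ t, occupied ξ l s = occupied ξ' l s := fun s hs =>
      ih fun i hi r hr => h i (List.mem_cons_of_mem _ hi) r (hr.trans hs)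
    have h2 : HitBy ξ l y t ↔ HitBy ξ' l y t := by
      refine exists_congr fun s => and_congr_right fun hs => ?_
      rw [h1 s hs, h y List.mem_cons_self s hs]
    rw [occupied_cons, occupied_cons, h1 t le_rfl, h y List.mem_cons_self t le_rfl, h2]

theorem occupied_map {κ : Type*} (ξ : ι → ℝ≥0 → E) (e : κ → ι) (l : List κ) (t : ℝ≥0) :
    occupied ξ (l.map e) t = occupied (fun k => ξ (e k)) l t := by
  induction l generalizing t with
  | nil => rfl
  | cons y l ih =>
    simp only [List.map_cons, occupied, ih]

/-- Adding a particle at the lowest priority depends on the others only through the set of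
occupied positions. -/
theorem occupied_cons_congr {κ : Type*} {ξ : ι → ℝ≥0 → E} {ξ' : κ → ℝ≥0 → E} {l : List ι}
    {l' : List κ} {y : ι} {y' : κ} (h : occupied ξ l = occupied ξ' l') (hy : ξ y = ξ' y') :
    occupied ξ (y :: l) = occupied ξ' (y' :: l') := by
  simp only [occupied, h, hy]

end Killing

/-! ### Right-continuity and first hitting times -/

section RightContinuous

variable {E : Type*} [TopologicalSpace E] {ι : Type*}

/-- If `p` failed at the infimum, it would fail on a whole interval to the right of it, and the
infimum would be larger. -/
theorem exists_isLeast_of_not_rightOpen {p : ℝ≥0 → Prop}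
    (hp : ∀ s, ¬ p s → ∀ᶠ r in 𝓝[≥] s, ¬ p r) (h : ∃ t, p t) : ∃ s, IsLeast {t | p t} s := by
  refine ⟨sInf {t | p t}, ?_, fun t ht => csInf_le' ht⟩
  by_contra hs
  have h1 := hp _ hs
  obtain ⟨u, hu, hu'⟩ := (mem_nhdsGE_iff_exists_Ico_subset).1 h1
  have : u ≤ sInf {t | p t} := by
    refine le_csInf h fun t ht => ?_
    by_contra! hlt
    exact hu' ⟨csInf_le' ht, hlt⟩ ht
  exact absurd hu (not_lt.2 this)

variable [T2Space E]

theorem eventually_ne_of_rightContinuous {f g : ℝ≥0 → E}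
    (hf : ∀ t, ContinuousWithinAt f (Set.Ici t) t) (hg : ∀ t, ContinuousWithinAt g (Set.Ici t) t)
    (s : ℝ≥0) (h : f s ≠ g s) : ∀ᶠ r in 𝓝[≥] s, f r ≠ g r :=
  (Tendsto.prodMk_nhds (hf s) (hg s)).eventually (isClosed_diagonal.isOpen_compl.mem_nhds h)

theorem eventually_not_exists_le {p : ℝ≥0 → Prop} (hp : ∀ s, ¬ p s → ∀ᶠ r in 𝓝[≥] s, ¬ p r)
    (s : ℝ≥0) (h : ¬ ∃ r ≤ s, p r) : ∀ᶠ t in 𝓝[≥] s, ¬ ∃ r ≤ t, p r := by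
  obtain ⟨u, hu, hu'⟩ := (mem_nhdsGE_iff_exists_Ico_subset).1 (hp s fun h' => h ⟨s, le_rfl, h'⟩)
  refine mem_of_superset (Ico_mem_nhdsGE hu) ?_
  rintro t ⟨-, ht⟩ ⟨r, hr, hpr⟩
  rcases le_total r s with hrs | hrs
  · exact h ⟨r, hrs, hpr⟩
  · exact hu' ⟨hrs, hr.trans_lt ht⟩ hpr

/-- Each position in the occupied set is missed either because the two paths differ, which persists
by right-continuity, or because its particle is dead, which persists since dead particles stay dead.
-/
theorem eventually_notMem_occupied {ξ : ι → ℝ≥0 → E}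
    (hξ : ∀ i t, ContinuousWithinAt (ξ i) (Set.Ici t) t) (l : List ι) (y : ι) (s : ℝ≥0)
    (h : ξ y s ∉ occupied ξ l s) : ∀ᶠ r in 𝓝[≥] s, ξ y r ∉ occupied ξ l r := by
  induction l generalizing y s with
  | nil => simp [occupied]
  | cons i l ih =>
    have hcons (r) : ξ y r ∉ occupied ξ (i :: l) r ↔
        ξ y r ∉ occupied ξ l r ∧ (ξ y r ≠ ξ i r ∨ HitBy ξ l i r) := by
      simp [occupied_cons, or_iff_not_imp_left]
    simp only [hcons] at h ⊢
    refine (ih y s h.1).and ?_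
    rcases h.2 with h | h
    · exact (eventually_ne_of_rightContinuous (hξ y) (hξ i) s h).mono fun _ => Or.inl
    · filter_upwards [self_mem_nhdsWithin] with r hr using Or.inr (h.mono hr)

theorem eventually_not_hitBy {ξ : ι → ℝ≥0 → E}
    (hξ : ∀ i t, ContinuousWithinAt (ξ i) (Set.Ici t) t) (l : List ι) (y : ι) (s : ℝ≥0)
    (h : ¬ HitBy ξ l y s) : ∀ᶠ r in 𝓝[≥] s, ¬ HitBy ξ l y r :=
  eventually_not_exists_le
    (fun s hs => eventually_notMem_occupied hξ l y s hs) s h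

end RightContinuous

/-! ### From coalescence to killing -/

section Prefix

variable {N : ℕ∞}

open Classical in
/-- The indices in `[N]` up to `n`, in decreasing order. -/
noncomputable def prefixList (N : ℕ∞) : ℕ → List (IndexSet N)
  | 0 => []
  | n + 1 => if h : ((n + 1 : ℕ) : ℕ∞) ≤ N then ⟨n + 1, by omega, h⟩ :: prefixList N n
      else prefixList N n

theorem mem_prefixList {n : ℕ} {i : IndexSet N} : i ∈ prefixList N n ↔ i.1 ≤ n := by
  induction n with
  | zero => have := i.2.1; simp [prefixList]; omega
  | succ n ih =>
    rw [prefixList]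
    split_ifs with h
    · rw [List.mem_cons, ih, Subtype.ext_iff]
      simp only; omega
    · rw [ih]
      refine ⟨fun h => by omega, fun h' => ?_⟩
      rcases h'.lt_or_eq with h' | h'
      · omega
      · exact absurd (h' ▸ i.2.2) h

theorem nodup_prefixList (n : ℕ) : (prefixList N n).Nodup := by
  induction n with
  | zero => simp [prefixList]
  | succ n ih =>
    rw [prefixList]
    split_ifs with h
    · refine List.nodup_cons.2 ⟨?_, ih⟩
      rw [mem_prefixList]; simp
    · exact ih

theorem occupied_prefixList_mono {E : Type*} (ξ : IndexSet N → ℝ≥0 → E) (t : ℝ≥0) :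
    Monotone fun n => occupied ξ (prefixList N n) t := by
  refine monotone_nat_of_le_succ fun n => ?_
  rw [prefixList]
  split_ifs with h
  · exact occupied_subset_cons ..
  · exact subset_rfl

theorem collisionRule_eq {E : Type*} (ξ : IndexSet N → ℝ≥0 → E) (i : IndexSet N) :
    collisionRule ξ i = coalesceStep i (ξ i) fun j _ => collisionRule ξ j := by
  rw [collisionRule, WellFounded.fix_eq]

variable {E : Type*} [TopologicalSpace E] [T2Space E]

/-- The coalescing particles with index at most `n` occupy the positions of the living particles
in the system with killing. -/
theorem setOf_collisionRule_eq_occupied {ξ : IndexSet N → ℝ≥0 → E}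
    (hξ : ∀ i t, ContinuousWithinAt (ξ i) (Set.Ici t) t) (n : ℕ) (t : ℝ≥0) :
    {z | ∃ j : IndexSet N, j.1 ≤ n ∧ z = collisionRule ξ j t} =
      occupied ξ (prefixList N n) t := by
  induction n generalizing t with
  | zero =>
    ext z
    simp only [Set.mem_ofPred_eq, prefixList, occupied, Set.mem_empty_iff_false, iff_false]
    rintro ⟨j, hj, -⟩
    have := j.2.1
    omega
  | succ n ih =>
    by_cases h : ((n + 1 : ℕ) : ℕ∞) ≤ N
    swap
    · rw [prefixList, dif_neg h, ← ih]
      ext z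
      refine exists_congr fun j => and_congr_left fun _ => ⟨fun hj => ?_, fun hj => by omega⟩
      rcases hj.lt_or_eq with hj | hj
      · omega
      · exact absurd (hj ▸ j.2.2) h
    set i : IndexSet N := ⟨n + 1, by omega, h⟩ with hi
    have hpl : prefixList N (n + 1) = i :: prefixList N n := by rw [prefixList, dif_pos h]
    have hmeet (s : ℝ≥0) : (∃ (j : IndexSet N) (_ : j < i), ξ i s = collisionRule ξ j s) ↔
        ξ i s ∈ occupied ξ (prefixList N n) s := by
      rw [← ih]
      refine exists_congr fun j => ?_
      rw [exists_prop]
      refine and_congr_left fun _ => ?_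
      rw [← Subtype.coe_lt_coe]
      exact Nat.lt_succ_iff
    set τ := collisionTime i (ξ i) fun j _ => collisionRule ξ j with hτ
    have hle {s : ℝ≥0} (hs : ξ i s ∈ occupied ξ (prefixList N n) s) : τ ≤ s :=
      iInf₂_le s ((hmeet s).2 hs)
    -- The infimum τ is attained, because missing the occupied set is a right-open condition. This
    -- also excludes the junk branch of `coalesceStep`.
    have hfirst {s : ℝ≥0} (hs : τ ≤ s) : ∃ r : ℝ≥0, τ = r ∧ r ≤ s ∧
        ξ i r ∈ occupied ξ (prefixList N n) r := by
      have hex : ∃ r, ξ i r ∈ occupied ξ (prefixList N n) r := by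
        by_contra! hno
        have : τ = ⊤ := iInf₂_eq_top.2 fun r hr => absurd ((hmeet r).1 hr) (hno r)
        simp [this] at hs
      obtain ⟨r, hr, hr'⟩ := exists_isLeast_of_not_rightOpen
        (fun s hs => eventually_notMem_occupied hξ (prefixList N n) i s hs) hex
      have : τ = r := le_antisymm (hle hr)
        (le_iInf₂ fun u hu => ENNReal.coe_le_coe.2 (hr' ((hmeet u).1 hu)))
      exact ⟨r, this, by rw [this] at hs; exact_mod_cast hs, hr⟩
    have hset : {z | ∃ j : IndexSet N, j.1 ≤ n + 1 ∧ z = collisionRule ξ j t} =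
        occupied ξ (prefixList N n) t ∪ {collisionRule ξ i t} := by
      rw [← ih]
      ext z
      constructor
      · rintro ⟨j, hj, rfl⟩
        rcases hj.lt_or_eq with hj | hj
        · exact Or.inl ⟨j, by omega, rfl⟩
        · exact Or.inr (by rw [Set.mem_singleton_iff, show j = i from Subtype.ext hj])
      · rintro (⟨j, hj, rfl⟩ | rfl)
        · exact ⟨j, by omega, rfl⟩
        · exact ⟨i, le_rfl, rfl⟩
    rw [hset, hpl]
    by_cases hhit : HitBy ξ (prefixList N n) i t
    · obtain ⟨s, hs, hmem⟩ := hhit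
      rw [occupied_cons_of_hitBy ⟨s, hs, hmem⟩, Set.union_eq_left, Set.singleton_subset_iff]
      obtain ⟨r, hr, hrt, hrmem⟩ := hfirst ((hle hmem).trans (ENNReal.coe_le_coe.2 hs))
      have hnot : ¬ (t : ℝ≥0∞) < τ := by
        rw [hr]; exact not_lt.2 (ENNReal.coe_le_coe.2 hrt)
      have hne : (collisionPartners i (ξ i) (fun j _ => collisionRule ξ j) τ.toNNReal).Nonempty := by
        obtain ⟨j, hj, hj'⟩ := (hmeet r).2 hrmem
        refine ⟨⟨j, hj⟩, ?_⟩
        rw [hr]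
        exact hj'
      rw [collisionRule_eq, coalesceStep, if_neg hnot, dif_pos hne, ← ih]
      refine ⟨_, ?_, rfl⟩
      have := ((wellFounded_lt (α := {j : IndexSet N // j < i})).min _ hne).2
      exact Nat.lt_succ_iff.1 (Subtype.coe_lt_coe.2 this)
    · rw [occupied_cons_of_not_hitBy hhit, Set.union_singleton]
      have : (t : ℝ≥0∞) < τ := by
        by_contra! hle'
        obtain ⟨r, -, hrt, hrmem⟩ := hfirst hle'
        exact hhit ⟨r, hrt, hrmem⟩
      rw [collisionRule_eq, coalesceStep, if_pos this]

end Prefix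

/-! ### The Borel σ-algebra on closed sets -/

section SigmaAlgebra

open TopologicalSpace

/-- At infinity the complements of the members of a compact exhaustion form a countable
neighbourhood base; elsewhere a countable base of `E` serves. Second countability is needed to
generate the Borel σ-algebra from a subbasis of the topology. -/
instance OnePoint.instSecondCountableTopology {E : Type*} [TopologicalSpace E]
    [LocallyCompactSpace E] [SecondCountableTopology E] [T2Space E] :
    SecondCountableTopology (OnePoint E) := by
  let K := CompactExhaustion.choice E
  let B : Set (Set (OnePoint E)) :=
    (fun U : Set E => ((↑) '' U : Set (OnePoint E))) '' countableBasis E ∪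
      Set.range fun n => ((↑) '' K n : Set (OnePoint E))ᶜ
  have hB : IsTopologicalBasis B := by
    refine isTopologicalBasis_of_isOpen_of_nhds ?_ ?_
    · rintro _ (⟨U, hU, rfl⟩ | ⟨n, rfl⟩)
      · exact OnePoint.isOpen_image_coe.2 (isOpen_of_mem_countableBasis hU)
      · exact OnePoint.isOpen_compl_image_coe.2 ⟨(K.isCompact n).isClosed, K.isCompact n⟩
    · intro a U ha hU
      induction a using OnePoint.rec with
      | infty =>
        obtain ⟨hK, -⟩ := (OnePoint.isOpen_iff_of_mem' ha).1 hU
        obtain ⟨n, hn⟩ := K.exists_superset_of_isCompact hK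
        refine ⟨_, Or.inr ⟨n, rfl⟩, by simp, ?_⟩
        intro z hz
        induction z using OnePoint.rec with
        | infty => exact ha
        | coe z =>
          by_contra hzU
          exact hz ⟨z, hn hzU, rfl⟩
      | coe x =>
        obtain ⟨V, hV, hxV, hVU⟩ := (isBasis_countableBasis E).exists_subset_of_mem_open
          (show x ∈ ((↑) : E → OnePoint E) ⁻¹' U from ha) (hU.preimage OnePoint.continuous_coe)
        exact ⟨_, Or.inl ⟨V, hV, rfl⟩, ⟨x, hxV, rfl⟩, Set.image_subset_iff.2 hVU⟩
  exact hB.secondCountableTopology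
    (((countable_countableBasis E).image _).union (Set.countable_range _))

variable {E : Type*} [TopologicalSpace E]

/-- The closed sets that avoid `U`. -/
def NonemptyClosed.avoid (U : Set E) : Set (NonemptyClosed E) :=
  {F | Disjoint F.carrier U}

theorem NonemptyClosed.avoid_union (U V : Set E) : avoid (U ∪ V) = avoid U ∩ avoid V := by
  ext F; exact Set.disjoint_union_right

/-- An open set misses a closure as soon as it misses the set itself, so only the trace of `V` on
`E` matters. -/
theorem NonemptyClosed.disjoint_compactify_iff (F : NonemptyClosed E) {V : Set (OnePoint E)}
    (hV : IsOpen V) :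
    Disjoint (F.compactify : Set (OnePoint E)) V ↔ F ∈ avoid (((↑) : E → OnePoint E) ⁻¹' V) := by
  change Disjoint (closure _) V ↔ Disjoint _ _
  rw [show Disjoint (closure ((fun y : E => (y : OnePoint E)) '' F.carrier)) V ↔
      Disjoint ((fun y : E => (y : OnePoint E)) '' F.carrier) V from
    ⟨fun h => h.mono_left subset_closure, fun h => h.closure_left hV⟩]
  simp only [Set.disjoint_left, Set.mem_image, forall_exists_index, and_imp,
    forall_apply_eq_imp_iff₂, Set.mem_preimage]

/-- The Borel σ-algebra on the nonempty closed sets is generated by the families of closed sets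
that avoid a given open set. -/
theorem NonemptyClosed.measurableSpace_eq_generateFrom [LocallyCompactSpace E]
    [SecondCountableTopology E] [T2Space E] :
    (NonemptyClosed.instMeasurableSpace : MeasurableSpace (NonemptyClosed E)) =
      MeasurableSpace.generateFrom {A | ∃ U : Set E, IsOpen U ∧ A = avoid U} := by
  have : SecondCountableTopology (NonemptyClosed E) :=
    Topology.IsInducing.secondCountableTopology (f := NonemptyClosed.compactify) ⟨rfl⟩
  apply le_antisymm
  · have htop : (NonemptyClosed.instTopologicalSpace : TopologicalSpace (NonemptyClosed E)) =
        generateFrom ((fun A => (fun F : NonemptyClosed E =>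
            (F.compactify : Set (OnePoint E))) ⁻¹' A) ''
          (Set.powerset '' {U : Set (OnePoint E) | IsOpen U} ∪
            (fun V => {s | (s ∩ V).Nonempty}) '' {V : Set (OnePoint E) | IsOpen V})) := by
      rw [← induced_generateFrom_eq]
      change induced _ (induced _ (TopologicalSpace.vietoris _)) = _
      rw [induced_compose]
      rfl
    change borel _ ≤ _
    rw [borel_eq_generateFrom_of_subbasis htop]
    refine MeasurableSpace.generateFrom_le ?_
    have hav {U : Set E} (hU : IsOpen U) : MeasurableSet[MeasurableSpace.generateFrom
        {A | ∃ U : Set E, IsOpen U ∧ A = avoid U}] (avoid U) :=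
      MeasurableSpace.measurableSet_generateFrom ⟨U, hU, rfl⟩
    rintro _ ⟨_, ⟨V, hV : IsOpen V, rfl⟩ | ⟨V, hV : IsOpen V, rfl⟩, rfl⟩
    -- A closed set lies in V iff it misses the compact set Vᶜ, iff it misses some finite union of
    -- basic sets that covers Vᶜ. There are only countably many such unions.
    · let b := countableBasis (OnePoint E)
      let S : Set (Set (Set (OnePoint E))) := {u | u.Finite ∧ u ⊆ b}
      have hS : S.Countable := Set.countable_ofPred_finite_subset (countable_countableBasis _)
      have : ((fun F : NonemptyClosed E => (F.compactify : Set (OnePoint E))) ⁻¹' V.powerset) =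
          ⋃ u ∈ {u ∈ S | Vᶜ ⊆ ⋃₀ u}, avoid (((↑) : E → OnePoint E) ⁻¹' ⋃₀ u) := by
        ext F
        simp only [Set.mem_preimage, Set.mem_powerset_iff, Set.mem_iUnion, exists_prop]
        have hop {u} (hu : u ∈ S) : IsOpen (⋃₀ u) :=
          isOpen_sUnion fun W hW => isOpen_of_mem_countableBasis (hu.2 hW)
        constructor
        · intro hF
          have hK : IsCompact Vᶜ := hV.isClosed_compl.isCompact
          have hC : IsOpen (F.compactify : Set (OnePoint E))ᶜ :=
            F.compactify.isCompact.isClosed.isOpen_compl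
          have hsub : Vᶜ ⊆ (F.compactify : Set (OnePoint E))ᶜ := Set.compl_subset_compl.2 hF
          obtain ⟨T, hTb, hTfin, hT⟩ := hK.elim_finite_subcover_image
            (b := {W ∈ b | W ⊆ (F.compactify : Set (OnePoint E))ᶜ}) (c := id)
            (fun W hW => isOpen_of_mem_countableBasis hW.1) (fun z hz => by
              obtain ⟨W, hW, hzW, hWC⟩ :=
                (isBasis_countableBasis (OnePoint E)).exists_subset_of_mem_open (hsub hz) hC
              exact Set.mem_biUnion (show W ∈ {W ∈ b | W ⊆ _} from ⟨hW, hWC⟩) hzW)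
          have hTS : T ∈ S := ⟨hTfin, fun W hW => (hTb hW).1⟩
          refine ⟨T, ⟨hTS, by simpa [Set.sUnion_eq_biUnion] using hT⟩, ?_⟩
          rw [← F.disjoint_compactify_iff (hop hTS)]
          refine Set.disjoint_left.2 fun z hz ⟨W, hW, hzW⟩ => (hTb hW).2 hzW hz
        · rintro ⟨u, ⟨hu, hVu⟩, hF⟩
          rw [← F.disjoint_compactify_iff (hop hu)] at hF
          intro z hz
          by_contra hzV
          exact Set.disjoint_left.1 hF hz (hVu hzV)
      refine (congrArg _ this).mpr (MeasurableSet.biUnion (hS.mono (Set.sep_subset _ _)) fun u hu => hav ?_)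
      exact (isOpen_sUnion fun W hW => isOpen_of_mem_countableBasis (hu.1.2 hW)).preimage
        OnePoint.continuous_coe
    · have : ((fun F : NonemptyClosed E => (F.compactify : Set (OnePoint E))) ⁻¹'
          {s | (s ∩ V).Nonempty}) = (avoid (((↑) : E → OnePoint E) ⁻¹' V))ᶜ := by
        ext F
        rw [Set.mem_compl_iff, ← F.disjoint_compactify_iff hV, Set.not_disjoint_iff_nonempty_inter]
        rfl
      exact (congrArg _ this).mpr (hav (hV.preimage OnePoint.continuous_coe)).compl
  · refine MeasurableSpace.generateFrom_le ?_
    rintro _ ⟨U, hU, rfl⟩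
    have : BorelSpace (NonemptyClosed E) := ⟨rfl⟩
    have hVo : IsOpen ((↑) '' U : Set (OnePoint E)) := OnePoint.isOpen_image_coe.2 hU
    have : avoid U = {F : NonemptyClosed E |
        ((F.compactify : Set (OnePoint E)) ∩ ((↑) '' U : Set (OnePoint E))).Nonempty}ᶜ := by
      ext F
      rw [Set.mem_compl_iff, Set.mem_ofPred_eq, ← Set.not_disjoint_iff_nonempty_inter, not_not,
        F.disjoint_compactify_iff hVo, Set.preimage_image_eq _ OnePoint.coe_injective]
    rw [this]
    refine (IsOpen.measurableSet ?_).compl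
    have h1 : Continuous fun F : NonemptyClosed E => F.compactify := continuous_induced_dom
    exact (NonemptyCompacts.isOpen_inter_nonempty_of_isOpen hVo).preimage h1

end SigmaAlgebra

/-! ### Conditional expectations and the Feller semigroup -/

section PullOut

/-- If `Y` and `Q` have the same integral over all sets of a sub-σ-algebra, then so have their
products with a bounded function that is measurable for the sub-σ-algebra. -/
theorem integral_mul_eq_of_setIntegral_eq {Ω : Type*} {m m0 : MeasurableSpace Ω} {μ : Measure Ω}
    [IsFiniteMeasure μ] (hm : m ≤ m0) {Y Q W : Ω → ℝ} (hY : Integrable Y μ) (hQ : Integrable Q μ)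
    (h : ∀ B, MeasurableSet[m] B → ∫ ω in B, Y ω ∂μ = ∫ ω in B, Q ω ∂μ)
    (hW : Measurable[m] W) {C : ℝ} (hC : ∀ ω, |W ω| ≤ C) :
    ∫ ω, W ω * Y ω ∂μ = ∫ ω, W ω * Q ω ∂μ := by
  have hWm : AEStronglyMeasurable W μ := (hW.mono hm le_rfl).aestronglyMeasurable
  have hWY : Integrable (fun ω => W ω * Y ω) μ := hY.bdd_mul hWm (ae_of_all _ hC)
  have hWQ : Integrable (fun ω => W ω * Q ω) μ := hQ.bdd_mul hWm (ae_of_all _ hC)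
  rw [← sub_eq_zero, ← integral_sub hWY hWQ]
  -- The hypothesis says that the conditional expectation of `Y - Q` vanishes; the bounded factor
  -- `W` is then pulled out.
  have h0 : (0 : Ω → ℝ) =ᵐ[μ] μ[Y - Q | m] := by
    refine ae_eq_condExp_of_forall_setIntegral_eq hm (hY.sub hQ)
      (fun _ _ _ => integrableOn_zero) (fun B hB _ => ?_) aestronglyMeasurable_zero
    simp only [Pi.sub_apply, Pi.zero_apply, integral_zero]
    rw [integral_sub hY.integrableOn hQ.integrableOn, h B hB, sub_self]
  have h1 := condExp_stronglyMeasurable_mul_of_bound hm hW.stronglyMeasurable (hY.sub hQ) C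
    (ae_of_all μ hC)
  calc ∫ ω, W ω * Y ω - W ω * Q ω ∂μ = ∫ ω, (W * (Y - Q)) ω ∂μ := by
        simp only [Pi.mul_apply, Pi.sub_apply, mul_sub]
    _ = ∫ ω, (μ[W * (Y - Q) | m]) ω ∂μ := (integral_condExp hm).symm
    _ = ∫ _, (0 : ℝ) ∂μ := by
        refine integral_congr_ae ?_
        filter_upwards [h0, h1] with ω h0 h1
        simp [h1, ← h0]
    _ = 0 := integral_zero _ _

end PullOut

section FellerFunctions

variable {E : Type*} [TopologicalSpace E]

/-- The functions on `E` that differ from a function in `C₀(E)` by a constant. -/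
def IsConstAddZeroAtInfty (f : E → ℝ) : Prop :=
  ∃ (c : ℝ) (f₀ : C₀(E, ℝ)), ∀ x, f x = c + f₀ x

namespace IsConstAddZeroAtInfty

theorem of_zeroAtInfty (f : C₀(E, ℝ)) : IsConstAddZeroAtInfty (f : E → ℝ) :=
  ⟨0, f, fun x => by simp⟩

theorem const (c : ℝ) : IsConstAddZeroAtInfty (fun _ : E => c) :=
  ⟨c, 0, fun x => by simp⟩

/-- Closure under products drives the backward recursion in `FellerProcess.exists_future`. Its start
is the constant 1, which need not lie in C₀; this is why constants are adjoined. -/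
theorem mul {f g : E → ℝ} (hf : IsConstAddZeroAtInfty f) (hg : IsConstAddZeroAtInfty g) :
    IsConstAddZeroAtInfty fun x => f x * g x := by
  obtain ⟨c, f₀, hf⟩ := hf
  obtain ⟨d, g₀, hg⟩ := hg
  refine ⟨c * d, c • g₀ + d • f₀ + f₀ * g₀, fun x => ?_⟩
  simp only [hf, hg, ZeroAtInftyContinuousMap.coe_add, ZeroAtInftyContinuousMap.coe_smul,
    ZeroAtInftyContinuousMap.coe_mul, Pi.add_apply, Pi.smul_apply, Pi.mul_apply, smul_eq_mul]
  ring

theorem continuous {f : E → ℝ} (hf : IsConstAddZeroAtInfty f) : Continuous f := by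
  obtain ⟨c, f₀, hf⟩ := hf
  rw [funext hf]
  exact continuous_const.add (map_continuous f₀)

theorem exists_bound {f : E → ℝ} (hf : IsConstAddZeroAtInfty f) : ∃ C, ∀ x, |f x| ≤ C := by
  obtain ⟨c, f₀, hf⟩ := hf
  refine ⟨|c| + ‖f₀.toBCF‖, fun x => ?_⟩
  rw [hf]
  exact (abs_add_le _ _).trans (add_le_add le_rfl (f₀.toBCF.norm_coe_le_norm x))

theorem measurable [MeasurableSpace E] [BorelSpace E] {f : E → ℝ}
    (hf : IsConstAddZeroAtInfty f) : Measurable f :=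
  hf.continuous.measurable

theorem integrable_comp [MeasurableSpace E] [BorelSpace E] {f : E → ℝ}
    (hf : IsConstAddZeroAtInfty f) {Ω : Type*} [MeasurableSpace Ω] {μ : Measure Ω}
    [IsFiniteMeasure μ] {Z : Ω → E} (hZ : Measurable Z) : Integrable (fun ω => f (Z ω)) μ := by
  obtain ⟨C, hC⟩ := hf.exists_bound
  exact Integrable.of_bound (hf.measurable.comp hZ).aestronglyMeasurable C
    (ae_of_all _ fun ω => hC _)

theorem integrable [MeasurableSpace E] [BorelSpace E] {f : E → ℝ}
    (hf : IsConstAddZeroAtInfty f) (μ : Measure E) [IsFiniteMeasure μ] : Integrable f μ :=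
  hf.integrable_comp measurable_id

end IsConstAddZeroAtInfty

end FellerFunctions

section Semigroup

variable {E : Type*} [TopologicalSpace E] [MeasurableSpace E]

/-- The operators of the transition semigroup. -/
noncomputable def FellerProcess.op (X : FellerProcess E) (t : ℝ≥0) (f : E → ℝ) (x : E) : ℝ :=
  ∫ y, f y ∂(X.p t x)

namespace FellerProcess

variable (X : FellerProcess E)

instance (t : ℝ≥0) : IsMarkovKernel (X.p t) := X.feller.markov t

theorem abs_op_le {f : E → ℝ} {C : ℝ} (hC : ∀ x, |f x| ≤ C) (t : ℝ≥0) (x : E) :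
    |X.op t f x| ≤ C := by
  simpa [op] using norm_integral_le_of_norm_le_const (μ := X.p t x) (f := f) (C := C) (ae_of_all _ hC)

variable [BorelSpace E]

theorem op_sub_const_add {f : E → ℝ} {c : ℝ} {f₀ : C₀(E, ℝ)} (hf : ∀ x, f x = c + f₀ x)
    (t : ℝ≥0) (x : E) : X.op t f x = c + ∫ y, f₀ y ∂(X.p t x) := by
  simp only [op, hf]
  rw [integral_add (integrable_const _)
    ((IsConstAddZeroAtInfty.of_zeroAtInfty f₀).integrable _)]
  simp

variable {f : E → ℝ} (hf : IsConstAddZeroAtInfty f)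
include hf

theorem isConstAddZeroAtInfty_op (t : ℝ≥0) : IsConstAddZeroAtInfty (X.op t f) := by
  obtain ⟨c, f₀, hf⟩ := hf
  obtain ⟨g, hg⟩ := X.feller.maps t f₀
  exact ⟨c, g, fun x => by rw [X.op_sub_const_add hf, hg]⟩

theorem op_add (s t : ℝ≥0) (x : E) : X.op (s + t) f x = X.op s (X.op t f) x := by
  rw [op, X.feller.add s t, Kernel.integral_comp (hf.integrable _)]
  rfl

theorem abs_op_sub_op_le {g : E → ℝ} (hg : IsConstAddZeroAtInfty g) {ε : ℝ}
    (h : ∀ x, |f x - g x| ≤ ε) (t : ℝ≥0) (x : E) : |X.op t f x - X.op t g x| ≤ ε := by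
  rw [op, op, ← integral_sub (hf.integrable _) (hg.integrable _)]
  simpa using norm_integral_le_of_norm_le_const (μ := X.p t x) (f := fun y => f y - g y) (C := ε)
    (ae_of_all _ h)

theorem tendstoUniformly_op_zero :
    TendstoUniformly (fun t => X.op t f) f (𝓝 0) := by
  obtain ⟨c, f₀, hf⟩ := hf
  have := X.feller.continuous f₀
  rw [Metric.tendstoUniformly_iff] at this ⊢
  intro ε hε
  filter_upwards [this ε hε] with t ht x
  rw [X.op_sub_const_add hf, hf, dist_add_left]
  exact ht x

/-- By the semigroup property the operators at t and u differ by the operator at min(t, u) applied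
to P_d f - f with d = |t - u|. Operators are contractions, so strong continuity at 0 suffices. -/
theorem tendstoUniformly_op (u : ℝ≥0) :
    TendstoUniformly (fun t => X.op t f) (X.op u f) (𝓝 u) := by
  have h0 := X.tendstoUniformly_op_zero hf
  rw [Metric.tendstoUniformly_iff] at h0 ⊢
  intro ε hε
  -- With truncated subtraction this sum is |t - u|, which covers both orders of t and u.
  have h1 : Tendsto (fun t : ℝ≥0 => (t - u) + (u - t)) (𝓝 u) (𝓝 0) := by
    have : Continuous fun t : ℝ≥0 => (t - u) + (u - t) := by fun_prop
    simpa using this.tendsto u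
  filter_upwards [h1.eventually (h0 (ε / 2) (half_pos hε))] with t ht x
  refine lt_of_le_of_lt ?_ (half_lt_self hε)
  rcases le_total t u with h | h
  · rw [tsub_eq_zero_of_le h, zero_add] at ht
    obtain ⟨d, rfl⟩ := exists_add_of_le h
    rw [add_tsub_cancel_left] at ht
    rw [X.op_add hf, dist_comm]
    refine X.abs_op_sub_op_le hf (X.isConstAddZeroAtInfty_op hf d) (fun y => ?_) t x
    exact (ht y).le
  · rw [tsub_eq_zero_of_le h, add_zero] at ht
    obtain ⟨d, rfl⟩ := exists_add_of_le h
    rw [add_tsub_cancel_left] at ht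
    rw [X.op_add hf]
    refine X.abs_op_sub_op_le hf (X.isConstAddZeroAtInfty_op hf d) (fun y => ?_) u x
    exact (ht y).le

theorem continuous_op : Continuous fun p : ℝ≥0 × E => X.op p.1 f p.2 := by
  rw [continuous_iff_continuousAt]
  rintro ⟨u, z⟩
  have h1 := Metric.tendstoUniformly_iff.1 (X.tendstoUniformly_op hf u)
  have h2 := (X.isConstAddZeroAtInfty_op hf u).continuous.tendsto z
  rw [ContinuousAt, Metric.tendsto_nhds]
  intro ε hε
  rw [nhds_prod_eq]
  filter_upwards [prod_mem_prod (h1 (ε / 2) (half_pos hε))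
    (Metric.tendsto_nhds.1 h2 (ε / 2) (half_pos hε))] with p hp
  refine (dist_triangle_left _ _ (X.op u f p.2)).trans_lt ?_
  have := hp.1 p.2
  have := hp.2
  simp only [Set.mem_ofPred_eq] at this
  linarith

end FellerProcess

end Semigroup

/-! ### The Markov property at several times -/

section SingleMarkov

variable {E : Type*} [TopologicalSpace E] [MeasurableSpace E]

theorem measurable_cadlagPath_eval (t : ℝ≥0) : Measurable fun ω : CadlagPath E => ω.1 t :=
  (measurable_pi_apply t).comp measurable_subtype_coe

theorem pathPast_le (s : ℝ≥0) :
    pathPast E s ≤ (inferInstance : MeasurableSpace (CadlagPath E)) :=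
  iSup₂_le fun u _ => (measurable_cadlagPath_eval u).comap_le

theorem measurable_pathPast_eval {s t : ℝ≥0} (h : s ≤ t) :
    Measurable[pathPast E t] fun ω : CadlagPath E => ω.1 s :=
  Measurable.mono (comap_measurable _)
    (le_iSup₂_of_le (f := fun (u : ℝ≥0) (_ : u ≤ t) =>
      MeasurableSpace.comap (fun ω : CadlagPath E => ω.1 u) inferInstance) s h le_rfl) le_rfl

theorem pathPast_mono {s t : ℝ≥0} (h : s ≤ t) : pathPast E s ≤ pathPast E t :=
  iSup₂_le fun _ hu => (measurable_pathPast_eval (hu.trans h)).comap_le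

variable [BorelSpace E] (X : FellerProcess E)

theorem FellerProcess.setIntegral_add (x : E) (s t : ℝ≥0) {f : E → ℝ}
    (hf : IsConstAddZeroAtInfty f) {B : Set (CadlagPath E)} (hB : MeasurableSet[pathPast E s] B) :
    ∫ ω in B, f (ω.1 (s + t)) ∂(X.law x) = ∫ ω in B, X.op t f (ω.1 s) ∂(X.law x) := by
  have hB' := pathPast_le s B hB
  set ν := ((X.law x).restrict B).map (fun ω => ω.1 s) with hν
  have hmap : ((X.law x).restrict B).map (fun ω => ω.1 (s + t)) =
      (X.p t ∘ₖ Kernel.const Unit ν) () := by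
    ext A hA
    rw [Measure.map_apply (measurable_cadlagPath_eval _) hA, Measure.restrict_apply
      (measurable_cadlagPath_eval _ hA), Kernel.comp_apply' _ _ _ hA, Kernel.const_apply, hν,
      lintegral_map (Kernel.measurable_coe _ hA) (measurable_cadlagPath_eval _),
      ← X.markov x s t B A hB hA, Set.inter_comm]
    rfl
  rw [← integral_map (φ := fun ω : CadlagPath E => ω.1 (s + t))
      (measurable_cadlagPath_eval _).aemeasurable hf.measurable.aestronglyMeasurable,
    hmap, Kernel.integral_comp (hf.integrable _), Kernel.const_apply, hν,
    integral_map (measurable_cadlagPath_eval _).aemeasurable]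
  · rfl
  · exact (X.isConstAddZeroAtInfty_op hf t).measurable.aestronglyMeasurable

/-- The law of the products of functions of the path at finitely many times after `q`, given the
path up to time `q`, is described by functions `V q` that are right-continuous in `q`. -/
theorem FellerProcess.exists_future (K : Finset ℝ≥0) {g : ℝ≥0 → E → ℝ}
    (hg : ∀ t, IsConstAddZeroAtInfty (g t)) :
    ∃ V : ℝ≥0 → E → ℝ, (∀ q, IsConstAddZeroAtInfty (V q)) ∧ (∃ C, ∀ q x, |V q x| ≤ C) ∧
      (∀ q y, Tendsto (fun p : ℝ≥0 × E => V p.1 p.2) (𝓝[≥] q ×ˢ 𝓝 y) (𝓝 (V q y))) ∧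
      ∀ (x : E) (q : ℝ≥0) (B : Set (CadlagPath E)), MeasurableSet[pathPast E q] B →
        ∫ ω in B, ∏ t ∈ K with q < t, g t (ω.1 t) ∂(X.law x) =
          ∫ ω in B, V q (ω.1 q) ∂(X.law x) := by
  induction K using Finset.induction_on_min with
  | empty =>
    exact ⟨fun _ _ => 1, fun _ => .const 1, ⟨1, by simp⟩, fun _ _ => tendsto_const_nhds,
      fun _ _ _ _ => by simp⟩
  | insert t₀ K ht₀ ih =>
    obtain ⟨V, hV, ⟨C, hC⟩, hVc, hVi⟩ := ih
    have hh : IsConstAddZeroAtInfty fun y => g t₀ y * V t₀ y := (hg t₀).mul (hV t₀)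
    obtain ⟨C', hC'⟩ := hh.exists_bound
    obtain ⟨C₀, hC₀⟩ := (hg t₀).exists_bound
    -- Backward recursion: t₀ lies below all of K. Seen from q < t₀, the semigroup runs up to t₀,
    -- where the factor at t₀ meets the old `V t₀`. For q ≥ t₀ that factor no longer belongs to the
    -- product. The strict inequality makes the switch right-continuous.
    refine ⟨fun q => if q < t₀ then X.op (t₀ - q) (fun y => g t₀ y * V t₀ y) else V q,
      fun q => ?_, ⟨max C' C, fun q x => ?_⟩, fun q y => ?_, fun x q B hB => ?_⟩
    · dsimp only
      split_ifs
      exacts [X.isConstAddZeroAtInfty_op hh _, hV q]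
    · dsimp only
      split_ifs
      exacts [(X.abs_op_le hC' _ _).trans (le_max_left _ _), (hC q x).trans (le_max_right _ _)]
    · by_cases hq : q < t₀
      · simp only [if_pos hq]
        have hcont : Continuous fun p : ℝ≥0 × E =>
            X.op (t₀ - p.1) (fun y => g t₀ y * V t₀ y) p.2 :=
          (X.continuous_op hh).comp ((continuous_const.sub continuous_fst).prodMk continuous_snd)
        have h1 := (hcont.tendsto (q, y)).mono_left
          ((prod_mono nhdsWithin_le_nhds le_rfl).trans_eq nhds_prod_eq.symm :
            𝓝[≥] q ×ˢ 𝓝 y ≤ 𝓝 (q, y))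
        refine h1.congr' ?_
        have h2 : ∀ᶠ s in 𝓝[≥] q, s < t₀ := nhdsWithin_le_nhds (Iio_mem_nhds hq)
        filter_upwards [h2.prod_inl (𝓝 y)] with p hp
        simp only [if_pos hp]
      · simp only [if_neg hq]
        refine (hVc q y).congr' ?_
        have h2 : ∀ᶠ s in 𝓝[≥] q, ¬ s < t₀ := by
          filter_upwards [self_mem_nhdsWithin] with s hs
          exact not_lt.2 ((not_lt.1 hq).trans hs)
        filter_upwards [h2.prod_inl (𝓝 y)] with p hp
        simp only [if_neg hp]
    · by_cases hq : q < t₀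
      · have hfil : (insert t₀ K).filter (q < ·) = insert t₀ K := by
          refine Finset.filter_true_of_mem fun t ht => ?_
          rcases Finset.mem_insert.1 ht with rfl | ht
          exacts [hq, hq.trans (ht₀ t ht)]
        have hfil' : K.filter (t₀ < ·) = K := Finset.filter_true_of_mem ht₀
        have hnot : t₀ ∉ K := fun h => (ht₀ t₀ h).false
        simp only [if_pos hq, hfil, Finset.prod_insert hnot]
        have hBt := pathPast_mono hq.le B hB
        have hBm := pathPast_le q B hB
        obtain ⟨d, rfl⟩ := exists_add_of_le hq.le
        rw [add_tsub_cancel_left, ← X.setIntegral_add x q d hh hB]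
        rw [← integral_indicator hBm, ← integral_indicator hBm]
        have hprod : Integrable (fun ω : CadlagPath E => ∏ t ∈ K, g t (ω.1 t)) (X.law x) := by
          refine Integrable.of_bound (C := ∏ t ∈ K, (hg t).exists_bound.choose) ?_
            (ae_of_all _ fun ω => ?_)
          · exact (Finset.measurable_fun_prod _ fun t _ =>
              (hg t).measurable.comp (measurable_cadlagPath_eval t)).aestronglyMeasurable
          · rw [Real.norm_eq_abs, Finset.abs_prod]
            exact Finset.prod_le_prod (fun _ _ => abs_nonneg _)
              fun t _ => (hg t).exists_bound.choose_spec _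
        -- Tower property: the factors after t₀ = q + d are replaced by `V t₀`, while the factor at
        -- t₀ and the event B belong to the past of t₀.
        have key := integral_mul_eq_of_setIntegral_eq (pathPast_le (q + d)) hprod
          ((hV (q + d)).integrable_comp (measurable_cadlagPath_eval (q + d)))
          (fun B' hB' => by rw [← hVi x (q + d) B' hB', hfil'])
          (W := B.indicator fun ω => g (q + d) (ω.1 (q + d)))
          (((hg (q + d)).measurable.comp (measurable_pathPast_eval le_rfl)).indicator hBt)
          (C := C₀) (fun ω => ?_)
        · refine Eq.trans ?_ (key.trans ?_)
          all_goals
            refine integral_congr_ae (ae_of_all _ fun ω => ?_)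
            by_cases hω : ω ∈ B <;> simp [hω]
        · by_cases hω : ω ∈ B
          · simpa [hω] using hC₀ _
          · simpa [hω] using (abs_nonneg _).trans (hC₀ (ω.1 0))
      · have hfil : (insert t₀ K).filter (q < ·) = K.filter (q < ·) := by
          rw [Finset.filter_insert, if_neg hq]
        simp only [if_neg hq, hfil]
        exact hVi x q B hB

end SingleMarkov

/-! ### Passage from fixed times to random times -/

section OptionalSampling

/-- The smallest point of the grid of mesh `1 / (n + 1)` that is larger than `r`. -/
noncomputable def gridSucc (n : ℕ) (r : ℝ≥0) : ℝ≥0 :=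
  ((⌊r * (n + 1)⌋₊ + 1 : ℕ) : ℝ≥0) / (n + 1)

theorem lt_gridSucc (n : ℕ) (r : ℝ≥0) : r < gridSucc n r := by
  rw [gridSucc, lt_div_iff₀ (by positivity)]
  exact_mod_cast Nat.lt_floor_add_one (r * (n + 1))

theorem gridSucc_le (n : ℕ) (r : ℝ≥0) : gridSucc n r ≤ r + 1 / (n + 1) := by
  rw [gridSucc, div_le_iff₀ (by positivity), add_mul, one_div,
    inv_mul_cancel₀ (by positivity)]
  push_cast
  gcongr
  exact Nat.floor_le (by positivity)

theorem tendsto_gridSucc (r : ℝ≥0) :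
    Tendsto (fun n => gridSucc n r) atTop (𝓝[≥] r) := by
  refine tendsto_nhdsWithin_of_tendsto_nhds_of_eventually_within _ ?_
    (Eventually.of_forall fun n => (lt_gridSucc n r).le)
  refine tendsto_of_tendsto_of_tendsto_of_le_of_le tendsto_const_nhds ?_
    (fun n => (lt_gridSucc n r).le) (fun n => gridSucc_le n r)
  have h : Tendsto (fun n : ℕ => r + 1 / ((n : ℝ≥0) + 1)) atTop (𝓝 (r + 0)) :=
    tendsto_const_nhds.add tendsto_one_div_add_atTop_nhds_zero_nat
  simpa using h

theorem gridSucc_eq_iff {n k : ℕ} {r : ℝ≥0} :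
    gridSucc n r = ((k + 1 : ℕ) : ℝ≥0) / (n + 1) ↔
      (k : ℝ≥0) / (n + 1) ≤ r ∧ r < ((k + 1 : ℕ) : ℝ≥0) / (n + 1) := by
  have h0 : (0 : ℝ≥0) < n + 1 := by positivity
  rw [gridSucc, div_left_inj' h0.ne', Nat.cast_inj, Nat.add_right_cancel_iff,
    Nat.floor_eq_iff (by positivity), div_le_iff₀ h0, lt_div_iff₀ h0]
  push_cast
  rfl

variable {Ω : Type*} [MeasurableSpace Ω] {μ : Measure Ω} [IsFiniteMeasure μ]

/-- On the cell k/(n+1) ≤ R < (k+1)/(n+1) the grid time is the right endpoint. It lies strictly to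
the right of R, so the events {R < q} suffice. They are only null-measurable, since swap times are
optional only up to null sets. -/
theorem tendsto_setIntegral_gridSucc {R : Ω → ℝ≥0∞}
    (hR : ∀ q : ℝ≥0, NullMeasurableSet {ω | R ω < q} μ) {Y : ℝ≥0 → Ω → ℝ} {C : ℝ}
    (hYm : ∀ q, AEStronglyMeasurable (Y q) μ) (hYC : ∀ q ω, |Y q ω| ≤ C)
    (hYc : ∀ ω q, ContinuousWithinAt (fun q => Y q ω) (Set.Ici q) q) :
    (∀ n : ℕ, ∫ ω in {ω | R ω < ⊤}, Y (gridSucc n (R ω).toNNReal) ω ∂μ =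
      ∑' k : ℕ, ∫ ω in {ω | R ω < ((((k + 1 : ℕ) : ℝ≥0) / (n + 1) : ℝ≥0) : ℝ≥0∞)} \
        {ω | R ω < (((k : ℝ≥0) / (n + 1) : ℝ≥0) : ℝ≥0∞)},
        Y (((k + 1 : ℕ) : ℝ≥0) / (n + 1)) ω ∂μ) ∧
    Tendsto (fun n : ℕ => ∫ ω in {ω | R ω < ⊤}, Y (gridSucc n (R ω).toNNReal) ω ∂μ) atTop
      (𝓝 (∫ ω in {ω | R ω < ⊤}, Y (R ω).toNNReal ω ∂μ)) := by
  set A : ℕ → ℕ → Set Ω := fun n k =>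
    {ω | R ω < ((((k + 1 : ℕ) : ℝ≥0) / (n + 1) : ℝ≥0) : ℝ≥0∞)} \
        {ω | R ω < (((k : ℝ≥0) / (n + 1) : ℝ≥0) : ℝ≥0∞)} with hA
  have hmem (n k : ℕ) (ω : Ω) : ω ∈ A n k ↔ R ω < ⊤ ∧
      gridSucc n (R ω).toNNReal = ((k + 1 : ℕ) : ℝ≥0) / (n + 1) := by
    rw [gridSucc_eq_iff]
    simp only [hA, Set.mem_sdiff, Set.mem_ofPred_eq, not_lt]
    constructor
    · rintro ⟨h1, h2⟩
      have h3 : R ω < ⊤ := h1.trans ENNReal.coe_lt_top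
      lift R ω to ℝ≥0 using h3.ne with r
      exact ⟨ENNReal.coe_lt_top, ENNReal.coe_le_coe.1 h2, ENNReal.coe_lt_coe.1 h1⟩
    · rintro ⟨h3, h1, h2⟩
      lift R ω to ℝ≥0 using h3.ne with r
      exact ⟨ENNReal.coe_lt_coe.2 h2, ENNReal.coe_le_coe.2 h1⟩
  have hAm (n k : ℕ) : NullMeasurableSet (A n k) μ := (hR _).diff (hR _)
  have hU (n : ℕ) : {ω | R ω < ⊤} = ⋃ k, A n k := by
    ext ω
    simp only [Set.mem_iUnion, hmem, Set.mem_ofPred_eq]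
    exact ⟨fun h => ⟨⌊(R ω).toNNReal * (n + 1)⌋₊, h, rfl⟩, fun ⟨_, h, _⟩ => h⟩
  have hdisj (n : ℕ) : Pairwise (Function.onFun (AEDisjoint μ) (A n)) := by
    intro k l hkl
    refine Disjoint.aedisjoint (Set.disjoint_left.2 fun ω h1 h2 => hkl ?_)
    have := ((hmem n k ω).1 h1).2.symm.trans ((hmem n l ω).1 h2).2
    rw [div_left_inj' (by positivity), Nat.cast_inj] at this
    omega
  have hcongr (n k : ℕ) : (fun ω => Y (gridSucc n (R ω).toNNReal) ω) =ᵐ[μ.restrict (A n k)]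
      fun ω => Y (((k + 1 : ℕ) : ℝ≥0) / (n + 1)) ω := by
    filter_upwards [ae_restrict_mem₀ (hAm n k)] with ω hω
    rw [((hmem n k ω).1 hω).2]
  have hmeas (n : ℕ) : AEStronglyMeasurable (fun ω => Y (gridSucc n (R ω).toNNReal) ω)
      (μ.restrict {ω | R ω < ⊤}) := by
    rw [hU n, aestronglyMeasurable_iUnion_iff]
    exact fun k => ((hYm _).restrict).congr (hcongr n k).symm
  refine ⟨fun n => ?_, ?_⟩
  · have hint : IntegrableOn (fun ω => Y (gridSucc n (R ω).toNNReal) ω) (⋃ k, A n k) μ := by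
      rw [← hU n]
      exact Integrable.of_bound (hmeas n) C (ae_of_all _ fun ω => hYC _ _)
    rw [hU n, integral_iUnion_ae (hAm n) (hdisj n) hint]
    exact tsum_congr fun k => integral_congr_ae (hcongr n k)
  · refine tendsto_integral_of_dominated_convergence (fun _ => C) hmeas (integrable_const _)
      (fun n => ae_of_all _ fun ω => hYC _ _) (ae_of_all _ fun ω => ?_)
    exact (hYc ω _).tendsto.comp (tendsto_gridSucc _)

/-- If two bounded right-continuous processes have the same integral at time `b` over each event
`a ≤ R < b`, then they have the same integral at the random time `R`. -/
theorem setIntegral_eq_at_random_time {R : Ω → ℝ≥0∞}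
    (hR : ∀ q : ℝ≥0, NullMeasurableSet {ω | R ω < q} μ) {Y Q : ℝ≥0 → Ω → ℝ} {C : ℝ}
    (hYm : ∀ q, AEStronglyMeasurable (Y q) μ) (hYC : ∀ q ω, |Y q ω| ≤ C)
    (hYc : ∀ ω q, ContinuousWithinAt (fun q => Y q ω) (Set.Ici q) q)
    (hQm : ∀ q, AEStronglyMeasurable (Q q) μ) (hQC : ∀ q ω, |Q q ω| ≤ C)
    (hQc : ∀ ω q, ContinuousWithinAt (fun q => Q q ω) (Set.Ici q) q)
    (h : ∀ a b : ℝ≥0, a ≤ b → ∫ ω in {ω | R ω < b} \ {ω | R ω < a}, Y b ω ∂μ =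
      ∫ ω in {ω | R ω < b} \ {ω | R ω < a}, Q b ω ∂μ) :
    ∫ ω in {ω | R ω < ⊤}, Y (R ω).toNNReal ω ∂μ =
      ∫ ω in {ω | R ω < ⊤}, Q (R ω).toNNReal ω ∂μ := by
  obtain ⟨h1, h2⟩ := tendsto_setIntegral_gridSucc hR hYm hYC hYc
  obtain ⟨h3, h4⟩ := tendsto_setIntegral_gridSucc hR hQm hQC hQc
  refine tendsto_nhds_unique h2 (h4.congr fun n => ?_)
  rw [h1, h3]
  refine tsum_congr fun k => (h _ _ ?_).symm
  gcongr
  simp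

end OptionalSampling

/-! ### Test functions and almost sure equality -/

section OpenApproximation

variable {E : Type*} [TopologicalSpace E] [LocallyCompactSpace E] [SecondCountableTopology E]
  [T2Space E]

/-- Exhaust U by compact sets and take Urysohn functions of compact support that are 1 on the n-th
set and 0 off U. -/
theorem IsOpen.exists_seq_tendsto_indicator {U : Set E} (hU : IsOpen U) :
    ∃ f : ℕ → E → ℝ, (∀ n, IsConstAddZeroAtInfty (f n)) ∧ (∀ n x, |f n x| ≤ 1) ∧
      ∀ x, Tendsto (fun n => f n x) atTop (𝓝 (U.indicator 1 x)) := by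
  have : LocallyCompactSpace U := hU.locallyCompactSpace
  let K := CompactExhaustion.choice U
  have hK (n : ℕ) : IsCompact ((↑) '' K n : Set E) := (K.isCompact n).image continuous_subtype_val
  have hd (n : ℕ) : Disjoint ((↑) '' K n : Set E) Uᶜ := by
    rw [Set.disjoint_compl_right_iff_subset]
    rintro _ ⟨x, -, rfl⟩
    exact x.2
  choose f hf1 hf0 hfc hfI using fun n =>
    exists_continuous_one_zero_of_isCompact (hK n) hU.isClosed_compl (hd n)
  refine ⟨fun n => f n, fun n => .of_zeroAtInfty ⟨f n, (hfc n).is_zero_at_infty⟩,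
    fun n x => abs_le.2 ⟨by linarith [(hfI n x).1], (hfI n x).2⟩, fun x => ?_⟩
  by_cases hx : x ∈ U
  · rw [Set.indicator_of_mem hx]
    have hm := K.mem_find ⟨x, hx⟩
    refine tendsto_const_nhds.congr' ?_
    filter_upwards [eventually_ge_atTop (K.find ⟨x, hx⟩)] with n hn
    exact (hf1 n ⟨⟨x, hx⟩, K.subset hn hm, rfl⟩).symm
  · rw [Set.indicator_of_notMem hx]
    exact tendsto_const_nhds.congr fun n => (hf0 n hx).symm

variable [MeasurableSpace E] [BorelSpace E]

/-- Two random points agree almost surely if their joint integrals do. -/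
theorem ae_eq_of_integral_mul_eq {Ω : Type*} [MeasurableSpace Ω] {μ : Measure Ω}
    [IsFiniteMeasure μ] {Y Z : Ω → E} (hY : Measurable Y) (hZ : Measurable Z)
    (h : ∀ f g : E → ℝ, IsConstAddZeroAtInfty f → IsConstAddZeroAtInfty g →
      ∫ ω, f (Y ω) * g (Z ω) ∂μ = ∫ ω, f (Y ω) * g (Y ω) ∂μ) : ∀ᵐ ω ∂μ, Y ω = Z ω := by
  -- Letting the test functions tend to the indicators of U and V turns the hypothesis into P(Y ∈ U,
  -- Z ∈ V) = P(Y ∈ U, Y ∈ V) = 0. Countably many pairs of disjoint basic sets separate all distinct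
  -- points.
  have key {U V : Set E} (hU : IsOpen U) (hV : IsOpen V) (hUV : Disjoint U V) :
      ∀ᵐ ω ∂μ, ¬ (Y ω ∈ U ∧ Z ω ∈ V) := by
    obtain ⟨f, hf, hf1, hfU⟩ := hU.exists_seq_tendsto_indicator
    obtain ⟨g, hg, hg1, hgV⟩ := hV.exists_seq_tendsto_indicator
    have lim {Z' : Ω → E} (hZ' : Measurable Z') :
        Tendsto (fun n => ∫ ω, f n (Y ω) * g n (Z' ω) ∂μ) atTop
          (𝓝 (∫ ω, U.indicator 1 (Y ω) * V.indicator 1 (Z' ω) ∂μ)) := by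
      refine tendsto_integral_of_dominated_convergence (fun _ => 1) (fun n => ?_)
        (integrable_const _) (fun n => ae_of_all _ fun ω => ?_) (ae_of_all _ fun ω => ?_)
      · exact (((hf n).measurable.comp hY).mul ((hg n).measurable.comp hZ')).aestronglyMeasurable
      · rw [Real.norm_eq_abs, abs_mul]
        exact mul_le_one₀ (hf1 _ _) (abs_nonneg _) (hg1 _ _)
      · exact (hfU _).mul (hgV _)
    have heq := tendsto_nhds_unique (lim hZ)
      ((lim hY).congr fun n => (h _ _ (hf n) (hg n)).symm)
    have h0 : ∀ ω, U.indicator (1 : E → ℝ) (Y ω) * V.indicator 1 (Y ω) = 0 := fun ω => by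
      by_cases h1 : Y ω ∈ U
      · rw [Set.indicator_of_notMem (s := V) (Set.disjoint_left.1 hUV h1), mul_zero]
      · rw [Set.indicator_of_notMem h1, zero_mul]
    simp only [h0, integral_zero] at heq
    have hnn : ∀ ω, 0 ≤ U.indicator (1 : E → ℝ) (Y ω) * V.indicator 1 (Z ω) := fun ω =>
      mul_nonneg (Set.indicator_nonneg (fun _ _ => zero_le_one) _)
        (Set.indicator_nonneg (fun _ _ => zero_le_one) _)
    have hint : Integrable (fun ω => U.indicator (1 : E → ℝ) (Y ω) * V.indicator 1 (Z ω)) μ := by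
      refine Integrable.of_bound (C := 1) (((measurable_one.indicator hU.measurableSet).comp hY).mul
        ((measurable_one.indicator hV.measurableSet).comp hZ)).aestronglyMeasurable
        (ae_of_all _ fun ω => ?_)
      by_cases h1 : Y ω ∈ U <;> by_cases h2 : Z ω ∈ V <;> simp [h1, h2]
    filter_upwards [(integral_eq_zero_iff_of_nonneg hnn hint).1 heq] with ω hω ⟨h1, h2⟩
    simp [h1, h2] at hω
  have hcount := TopologicalSpace.countable_countableBasis E
  have hall : ∀ᵐ ω ∂μ, ∀ U ∈ TopologicalSpace.countableBasis E,
      ∀ V ∈ TopologicalSpace.countableBasis E, Disjoint U V → ¬ (Y ω ∈ U ∧ Z ω ∈ V) := by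
    rw [ae_ball_iff hcount]
    intro U hU
    rw [ae_ball_iff hcount]
    intro V hV
    by_cases hd : Disjoint U V
    · filter_upwards [key (TopologicalSpace.isOpen_of_mem_countableBasis hU)
        (TopologicalSpace.isOpen_of_mem_countableBasis hV) hd] with ω hω _ using hω
    · exact ae_of_all _ fun _ h => absurd h hd
  filter_upwards [hall] with ω hω
  by_contra hne
  obtain ⟨u, v, hu, hv, hyu, hzv, huv⟩ := t2_separation hne
  obtain ⟨U, hU, hyU, hUu⟩ :=
    (TopologicalSpace.isBasis_countableBasis E).exists_subset_of_mem_open hyu hu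
  obtain ⟨V, hV, hzV, hVv⟩ :=
    (TopologicalSpace.isBasis_countableBasis E).exists_subset_of_mem_open hzv hv
  exact hω U hU V hV (huv.mono hUu hVv) ⟨hyU, hzV⟩

end OpenApproximation

/-! ### The Markov property among independent paths -/

section Independence

/-- Conditioning on independent information does not change a vanishing conditional
expectation. -/
theorem setIntegral_eq_zero_of_indep {Ω : Type*} {m₁ m₁' m₂ m0 : MeasurableSpace Ω}
    {μ : Measure Ω} [IsFiniteMeasure μ] (h₁ : m₁ ≤ m₁') (h₁' : m₁' ≤ m0) (h₂ : m₂ ≤ m0)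
    (hind : Indep m₁' m₂ μ) {f : Ω → ℝ} (hf : Measurable[m₁'] f) (hfi : Integrable f μ)
    (h : ∀ A, MeasurableSet[m₁] A → ∫ ω in A, f ω ∂μ = 0) (B : Set Ω)
    (hB : MeasurableSet[m₁ ⊔ m₂] B) : ∫ ω in B, f ω ∂μ = 0 := by
  have hle : m₁ ⊔ m₂ ≤ m0 := sup_le (h₁.trans h₁') h₂
  have hgen : m₁ ⊔ m₂ = MeasurableSpace.generateFrom
      {S | ∃ A A', MeasurableSet[m₁] A ∧ MeasurableSet[m₂] A' ∧ S = A ∩ A'} := by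
    apply le_antisymm
    · refine sup_le (fun A hA => ?_) (fun A hA => ?_)
      · exact MeasurableSpace.measurableSet_generateFrom ⟨A, Set.univ, hA, .univ, by simp⟩
      · exact MeasurableSpace.measurableSet_generateFrom ⟨Set.univ, A, .univ, hA, by simp⟩
    · refine MeasurableSpace.generateFrom_le ?_
      rintro _ ⟨A, A', hA, hA', rfl⟩
      exact MeasurableSet.inter (le_sup_left (a := m₁) A hA) (le_sup_right (b := m₂) A' hA')
  have hpi : IsPiSystem {S | ∃ A A', MeasurableSet[m₁] A ∧ MeasurableSet[m₂] A' ∧ S = A ∩ A'} := by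
    rintro _ ⟨A, A', hA, hA', rfl⟩ _ ⟨B, B', hB, hB', rfl⟩ -
    exact ⟨A ∩ B, A' ∩ B', hA.inter hB, hA'.inter hB', Set.inter_inter_inter_comm _ _ _ _⟩
  have huniv : ∫ ω, f ω ∂μ = 0 := by simpa using h Set.univ .univ
  induction B, hB using MeasurableSpace.induction_on_inter hgen hpi with
  | empty => simp
  | basic S hS =>
    obtain ⟨A, A', hA, hA', rfl⟩ := hS
    have hAm := h₁' _ (h₁ _ hA)
    have hint : Integrable (A.indicator f) μ := hfi.indicator hAm
    -- On the generating sets A ∩ A' the function f restricted to A is independent of A', so its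
    -- conditional expectation is the constant ∫_A f = 0.
    have hce := condExp_indep_eq h₁' h₂ (hf.indicator (h₁ _ hA)).stronglyMeasurable hind
    calc ∫ ω in A ∩ A', f ω ∂μ = ∫ ω in A', A.indicator f ω ∂μ := by
          rw [setIntegral_indicator hAm, Set.inter_comm]
      _ = ∫ ω in A', (μ[A.indicator f | m₂]) ω ∂μ := (setIntegral_condExp h₂ hint hA').symm
      _ = ∫ ω in A', (0 : ℝ) ∂μ := by
          refine integral_congr_ae (ae_restrict_of_ae ?_)
          filter_upwards [hce] with ω hω
          rw [hω, integral_indicator hAm, h A hA]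
      _ = 0 := integral_zero _ _
  | compl S hS ih =>
    have := integral_add_compl (hle _ hS) hfi
    rw [ih, huniv, zero_add] at this
    exact this
  | iUnion S hd hS ih =>
    rw [integral_iUnion (fun i => hle _ (hS i)) hd hfi.integrableOn]
    simp [ih]

variable {E : Type*} [TopologicalSpace E] [MeasurableSpace E] {ι : Type*}

/-- The law of independent copies of the process with given starting points. -/
noncomputable def FellerProcess.indepLaw (X : FellerProcess E) (x : ι → E) :
    Measure (ι → CadlagPath E) :=
  Measure.infinitePi fun i => X.law (x i)

instance (X : FellerProcess E) (x : ι → E) : IsProbabilityMeasure (X.indepLaw x) := by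
  unfold FellerProcess.indepLaw; infer_instance

variable (E) in
/-- The information carried by all paths up to time `q` and by the whole paths with labels not
in `S`. -/
abbrev pastOutside (S : Set ι) (q : ℝ≥0) : MeasurableSpace (ι → CadlagPath E) :=
  (⨆ i, MeasurableSpace.comap (fun ξ => ξ i) (pathPast E q)) ⊔
    ⨆ i ∈ Sᶜ, MeasurableSpace.comap (fun ξ => ξ i) inferInstance

theorem pastOutside_le (S : Set ι) (q : ℝ≥0) : pastOutside E S q ≤ MeasurableSpace.pi := by
  refine sup_le (iSup_le fun i => ?_) (iSup₂_le fun i _ => (measurable_pi_apply i).comap_le)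
  exact (MeasurableSpace.comap_mono (pathPast_le q)).trans (measurable_pi_apply i).comap_le

theorem pastOutside_anti {S T : Set ι} (h : S ⊆ T) (q : ℝ≥0) :
    pastOutside E T q ≤ pastOutside E S q :=
  sup_le_sup_left (biSup_mono fun _ hi hS => hi (h hS)) _

theorem pastOutside_mono (S : Set ι) {q r : ℝ≥0} (h : q ≤ r) :
    pastOutside E S q ≤ pastOutside E S r :=
  sup_le_sup_right (iSup_mono fun _ => MeasurableSpace.comap_mono (pathPast_mono h)) _

theorem measurable_pastOutside_eval (S : Set ι) {s q : ℝ≥0} (h : s ≤ q) (i : ι) :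
    Measurable[pastOutside E S q] fun ξ : ι → CadlagPath E => (ξ i).1 s := by
  have h1 : Measurable[MeasurableSpace.comap (fun ξ : ι → CadlagPath E => ξ i) (pathPast E q)]
      fun ξ : ι → CadlagPath E => (ξ i).1 s :=
    (measurable_pathPast_eval h).comp (comap_measurable _)
  exact h1.mono ((le_iSup (fun i => MeasurableSpace.comap
    (fun ξ : ι → CadlagPath E => ξ i) (pathPast E q)) i).trans le_sup_left) le_rfl

theorem measurable_pastOutside_of_notMem {S : Set ι} {i : ι} (hi : i ∉ S) (s q : ℝ≥0) :
    Measurable[pastOutside E S q] fun ξ : ι → CadlagPath E => (ξ i).1 s := by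
  have h1 : Measurable[MeasurableSpace.comap (fun ξ : ι → CadlagPath E => ξ i) inferInstance]
      fun ξ : ι → CadlagPath E => (ξ i).1 s :=
    (measurable_cadlagPath_eval s).comp (comap_measurable _)
  exact h1.mono ((le_iSup₂ (f := fun i (_ : i ∈ Sᶜ) => MeasurableSpace.comap
    (fun ξ : ι → CadlagPath E => ξ i) inferInstance) i hi).trans le_sup_right) le_rfl

theorem measurable_eval (i : ι) (s : ℝ≥0) :
    Measurable fun ξ : ι → CadlagPath E => (ξ i).1 s :=
  (measurable_cadlagPath_eval s).comp (measurable_pi_apply i)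

/-- The Markov property of one path, given its past and all other paths. -/
theorem FellerProcess.integral_mul_eq_of_pathPast (X : FellerProcess E) (x : ι → E) (i : ι)
    (q : ℝ≥0) {Y Q : CadlagPath E → ℝ} (hY : Measurable Y) (hQ : Measurable Q)
    (hYi : Integrable Y (X.law (x i))) (hQi : Integrable Q (X.law (x i)))
    (h : ∀ B, MeasurableSet[pathPast E q] B →
      ∫ ω in B, Y ω ∂(X.law (x i)) = ∫ ω in B, Q ω ∂(X.law (x i)))
    {W : (ι → CadlagPath E) → ℝ} (hW : Measurable[pastOutside E {i} q] W) {C : ℝ}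
    (hC : ∀ ξ, |W ξ| ≤ C) :
    ∫ ξ, W ξ * Y (ξ i) ∂(X.indepLaw x) = ∫ ξ, W ξ * Q (ξ i) ∂(X.indepLaw x) := by
  have hmp : MeasurePreserving (fun ξ : ι → CadlagPath E => ξ i) (X.indepLaw x) (X.law (x i)) :=
    measurePreserving_eval_infinitePi _ i
  have hYi' : Integrable (fun ξ => Y (ξ i)) (X.indepLaw x) := hmp.integrable_comp_of_integrable hYi
  have hQi' : Integrable (fun ξ => Q (ξ i)) (X.indepLaw x) := hmp.integrable_comp_of_integrable hQi
  refine integral_mul_eq_of_setIntegral_eq (pastOutside_le _ _) hYi' hQi' (fun B hB => ?_) hW hC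
  rw [← sub_eq_zero, ← integral_sub hYi'.integrableOn hQi'.integrableOn]
  have hind : Indep (MeasurableSpace.comap (fun ξ : ι → CadlagPath E => ξ i) inferInstance)
      (⨆ j ∈ ({i}ᶜ : Set ι), MeasurableSpace.comap (fun ξ : ι → CadlagPath E => ξ j) inferInstance)
      (X.indepLaw x) := by
    have h1 : iIndepFun (fun (j : ι) (ξ : ι → CadlagPath E) => ξ j) (X.indepLaw x) :=
      iIndepFun_infinitePi (X := fun _ ω => ω) fun _ => measurable_id
    have h2 := indep_iSup_of_disjoint (fun j => (measurable_pi_apply j).comap_le) h1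
      (disjoint_compl_right (a := ({i} : Set ι)))
    simpa using h2
  refine setIntegral_eq_zero_of_indep
    (m₁ := MeasurableSpace.comap (fun ξ : ι → CadlagPath E => ξ i) (pathPast E q))
    (MeasurableSpace.comap_mono (pathPast_le q)) (measurable_pi_apply i).comap_le
    (iSup₂_le fun j _ => (measurable_pi_apply j).comap_le) hind
    ((hY.sub hQ).comp (comap_measurable _)) (hYi'.sub hQi') ?_ B ?_
  · rintro _ ⟨A, hA, rfl⟩
    have hA' := pathPast_le q A hA
    rw [show (∫ ω in (fun ξ : ι → CadlagPath E => ξ i) ⁻¹' A,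
        ((Y - Q) ∘ fun ξ : ι → CadlagPath E => ξ i) ω ∂(X.indepLaw x)) =
        ∫ ω in A, (Y - Q) ω ∂(X.law (x i)) by
      rw [← hmp.map_eq, setIntegral_map hA' (hY.sub hQ).aestronglyMeasurable
        hmp.measurable.aemeasurable]
      rfl]
    simp only [Pi.sub_apply]
    rw [integral_sub hYi.integrableOn hQi.integrableOn, h A hA, sub_self]
  -- The past of a path other than i is absorbed by the whole path, so only the past of path i
  -- remains beside the independent information.
  · refine (sup_le (iSup_le fun j => ?_) le_sup_right : pastOutside E {i} q ≤ _) B hB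
    by_cases hj : j = i
    · subst hj; exact le_sup_left
    · exact (MeasurableSpace.comap_mono (pathPast_le q)).trans
        ((le_iSup₂ (f := fun j (_ : j ∈ ({i}ᶜ : Set ι)) => MeasurableSpace.comap
          (fun ξ : ι → CadlagPath E => ξ j) inferInstance) j hj).trans le_sup_right)

end Independence

/-! ### Quasi-left-continuity -/

section PathLimits

variable {E : Type*} [TopologicalSpace E]

theorem IsCadlag.rightContinuous {ω : ℝ≥0 → E} (h : IsCadlag ω) (t : ℝ≥0) :
    ContinuousWithinAt ω (Set.Ici t) t :=
  (h t).1

/-- The sequence either reaches L and stays there, or remains strictly below L, where the left limit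
applies. -/
theorem IsCadlag.exists_tendsto_of_monotone {ω : ℝ≥0 → E} (hω : IsCadlag ω) {r : ℕ → ℝ≥0}
    (hr : Monotone r) {L : ℝ≥0} (hL : Tendsto r atTop (𝓝 L)) :
    ∃ y, Tendsto (fun n => ω (r n)) atTop (𝓝 y) := by
  have hle := hr.ge_of_tendsto hL
  by_cases h : ∃ n, r n = L
  · obtain ⟨n, hn⟩ := h
    refine ⟨ω L, tendsto_const_nhds.congr' ?_⟩
    filter_upwards [eventually_ge_atTop n] with m hm
    rw [le_antisymm (hle m) (hn ▸ hr hm)]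
  · push Not at h
    obtain ⟨y, hy⟩ := (hω L).2
    exact ⟨y, hy.comp (tendsto_nhdsWithin_iff.2
      ⟨hL, Eventually.of_forall fun n => lt_of_le_of_ne (hle n) (h n)⟩)⟩

/-- For fixed k the times `r n + h k` eventually lie in (L, L + h k], so `y k` is a limit of values
slightly to the right of L. -/
theorem tendsto_of_tendsto_shift [RegularSpace E] {ω : ℝ≥0 → E} {r : ℕ → ℝ≥0} {L : ℝ≥0}
    (hω : ContinuousWithinAt ω (Set.Ici L) L) (hr : Monotone r) (hL : Tendsto r atTop (𝓝 L))
    {h : ℕ → ℝ≥0} (hpos : ∀ k, 0 < h k) (h0 : Tendsto h atTop (𝓝 0)) {y : ℕ → E}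
    (hy : ∀ k, Tendsto (fun n => ω (r n + h k)) atTop (𝓝 (y k))) :
    Tendsto y atTop (𝓝 (ω L)) := by
  have hle := hr.ge_of_tendsto hL
  refine (closed_nhds_basis (ω L)).tendsto_right_iff.2 fun C ⟨hC, hCc⟩ => ?_
  obtain ⟨u, hu, huC⟩ := (mem_nhdsGE_iff_exists_Ico_subset).1 (hω hC)
  obtain ⟨d, rfl⟩ := exists_add_of_le (le_of_lt (Set.mem_Ioi.1 hu))
  have hd : 0 < d := by
    by_contra hd
    simp [nonpos_iff_eq_zero.1 (not_lt.1 hd)] at hu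
  filter_upwards [h0.eventually (Iio_mem_nhds hd)] with k hk
  refine hCc.mem_of_tendsto (hy k) ?_
  have h1 : ∀ᶠ n in atTop, L < r n + h k :=
    (hL.add_const (h k)).eventually (lt_mem_nhds (lt_add_of_pos_right L (hpos k)))
  filter_upwards [h1] with n hn
  exact huC ⟨hn.le, add_lt_add_of_le_of_lt (hle n) hk⟩

/-- The value at R is the limit of the values at the grid times following R, and each of these times
takes countably many values. -/
theorem measurable_at_random_time [MeasurableSpace E] [BorelSpace E]
    [TopologicalSpace.PseudoMetrizableSpace E] {Ω : Type*} [MeasurableSpace Ω] {R : Ω → ℝ≥0}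
    (hR : Measurable R) {Z : ℝ≥0 → Ω → E} (hZ : ∀ t, Measurable (Z t))
    (hZc : ∀ ω t, ContinuousWithinAt (fun t => Z t ω) (Set.Ici t) t) :
    Measurable fun ω => Z (R ω) ω := by
  refine measurable_of_tendsto_metrizable (f := fun n ω => Z (gridSucc n (R ω)) ω) (fun n => ?_)
    (tendsto_pi_nhds.2 fun ω => (hZc ω (R ω)).tendsto.comp (tendsto_gridSucc (R ω)))
  obtain ⟨φ, hφ⟩ : ∃ φ : ℕ → ℝ≥0, ∀ r, gridSucc n r = φ ⌊r * (n + 1)⌋₊ :=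
    ⟨fun k => ((k + 1 : ℕ) : ℝ≥0) / (n + 1), fun _ => rfl⟩
  simp only [hφ]
  have h1 : Measurable fun p : Ω × ℕ => Z (φ p.2) p.1 :=
    measurable_from_prod_countable_left fun k => hZ (φ k)
  have h2 : Measurable fun ω => (ω, ⌊R ω * (n + 1)⌋₊) :=
    measurable_id.prodMk (Nat.measurable_floor.comp (hR.mul_const _))
  exact h1.comp h2

end PathLimits

section QuasiLeftContinuity

variable {E : Type*} [TopologicalSpace E] [LocallyCompactSpace E] [SecondCountableTopology E]
  [T2Space E] [MeasurableSpace E] [BorelSpace E] {ι : Type*}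

-- Strong Markov property of one path with lag h, obtained from the Markov property at fixed times
-- through `setIntegral_eq_at_random_time`. With `Set.univ` in `pastOutside`, no path is known
-- beyond time q.
omit [LocallyCompactSpace E] [SecondCountableTopology E] [T2Space E] in
theorem FellerProcess.integral_shift_eq (X : FellerProcess E) (x : ι → E) (i : ι)
    {R : (ι → CadlagPath E) → ℝ≥0}
    (hR : ∀ q, MeasurableSet[pastOutside E Set.univ q] {ξ | R ξ < q}) (h : ℝ≥0) {f g : E → ℝ}
    (hf : IsConstAddZeroAtInfty f) (hg : IsConstAddZeroAtInfty g) :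
    ∫ ξ, f ((ξ i).1 (R ξ)) * g ((ξ i).1 (R ξ + h)) ∂(X.indepLaw x) =
      ∫ ξ, f ((ξ i).1 (R ξ)) * X.op h g ((ξ i).1 (R ξ)) ∂(X.indepLaw x) := by
  obtain ⟨Cf, hCf⟩ := hf.exists_bound
  obtain ⟨Cg, hCg⟩ := hg.exists_bound
  have hop := X.isConstAddZeroAtInfty_op hg h
  have hCo := X.abs_op_le hCg h
  have hset (q : ℝ≥0) : {ξ : ι → CadlagPath E | (R ξ : ℝ≥0∞) < q} = {ξ | R ξ < q} := by
    ext; simp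
  have hm {k : E → ℝ} (hk : IsConstAddZeroAtInfty k) (t : ℝ≥0) :
      Measurable fun ξ : ι → CadlagPath E => k ((ξ i).1 t) :=
    hk.measurable.comp (measurable_eval i t)
  have hc {k : E → ℝ} (hk : IsConstAddZeroAtInfty k) (ξ : ι → CadlagPath E) (t : ℝ≥0) :
      ContinuousWithinAt (fun t => k ((ξ i).1 t)) (Set.Ici t) t :=
    hk.continuous.continuousAt.comp_continuousWithinAt ((ξ i).2.rightContinuous t)
  have hcs (ξ : ι → CadlagPath E) (t : ℝ≥0) :
      ContinuousWithinAt (fun t => g ((ξ i).1 (t + h))) (Set.Ici t) t := by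
    refine (hc hg ξ (t + h)).comp (f := fun t => t + h) (by fun_prop) ?_
    intro s hs
    exact add_le_add_left (Set.mem_Ici.1 hs) h
  have hb {u v : ℝ} (hu : |u| ≤ Cf) (hv : |v| ≤ Cg) : |u * v| ≤ Cf * Cg := by
    rw [abs_mul]
    exact mul_le_mul hu hv (abs_nonneg _) ((abs_nonneg _).trans hu)
  have := setIntegral_eq_at_random_time (μ := X.indepLaw x) (R := fun ξ => (R ξ : ℝ≥0∞))
    (Y := fun q ξ => f ((ξ i).1 q) * g ((ξ i).1 (q + h)))
    (Q := fun q ξ => f ((ξ i).1 q) * X.op h g ((ξ i).1 q)) (C := Cf * Cg)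
    (fun q => by rw [hset]; exact (pastOutside_le _ _ _ (hR q)).nullMeasurableSet)
    (fun q => ((hm hf q).mul (hm hg (q + h))).aestronglyMeasurable)
    (fun q ξ => hb (hCf _) (hCg _)) (fun ξ q => (hc hf ξ q).mul (hcs ξ q))
    (fun q => ((hm hf q).mul (hm hop q)).aestronglyMeasurable)
    (fun q ξ => hb (hCf _) (hCo _)) (fun ξ q => (hc hf ξ q).mul (hc hop ξ q))
    (fun a b hab => ?_)
  · simpa using this
  · rw [hset, hset]
    have hA : MeasurableSet[pastOutside E Set.univ b]
        ({ξ : ι → CadlagPath E | R ξ < b} \ {ξ | R ξ < a}) :=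
      (hR b).diff (pastOutside_mono _ hab _ (hR a))
    have hA' := pastOutside_le _ _ _ hA
    rw [← integral_indicator hA', ← integral_indicator hA']
    have key := X.integral_mul_eq_of_pathPast x i b
      (Y := fun ω => g (ω.1 (b + h))) (Q := fun ω => X.op h g (ω.1 b))
      (hg.measurable.comp (measurable_cadlagPath_eval _))
      (hop.measurable.comp (measurable_cadlagPath_eval _))
      (hg.integrable_comp (measurable_cadlagPath_eval _))
      (hop.integrable_comp (measurable_cadlagPath_eval _))
      (fun B hB => X.setIntegral_add (x i) b h hg hB)
      (W := ({ξ : ι → CadlagPath E | R ξ < b} \ {ξ | R ξ < a}).indicator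
        fun ξ => f ((ξ i).1 b)) ?_ (C := Cf) (fun ξ => ?_)
    · refine Eq.trans ?_ (key.trans ?_)
      all_goals
        refine integral_congr_ae (ae_of_all _ fun ξ => ?_)
        dsimp only
        rw [Set.indicator_mul_left]
    · exact (hf.measurable.comp (measurable_pastOutside_eval _ le_rfl i)).indicator
        (pastOutside_anti (Set.subset_univ _) _ _ hA)
    · rw [Set.indicator_apply]
      split_ifs
      · exact hCf _
      · simpa using (abs_nonneg _).trans (hCf ((ξ i).1 0))

/-- Quasi-left-continuity: along an increasing bounded sequence of optional times, each path
converges almost surely to its value at the limit of the sequence. -/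
theorem FellerProcess.ae_tendsto_of_optional (X : FellerProcess E) (x : ι → E) (i : ι)
    {R : ℕ → (ι → CadlagPath E) → ℝ≥0} {L : (ι → CadlagPath E) → ℝ≥0}
    (hR : ∀ n q, MeasurableSet[pastOutside E Set.univ q] {ξ | R n ξ < q})
    (hmono : ∀ ξ, Monotone fun n => R n ξ)
    (hL : ∀ ξ, Tendsto (fun n => R n ξ) atTop (𝓝 (L ξ))) :
    ∀ᵐ ξ ∂(X.indepLaw x), Tendsto (fun n => (ξ i).1 (R n ξ)) atTop (𝓝 ((ξ i).1 (L ξ))) := by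
  have hRm (n : ℕ) : Measurable (R n) :=
    measurable_of_Iio fun q => pastOutside_le _ _ _ (hR n q)
  have hLm : Measurable L := measurable_of_tendsto_metrizable hRm (tendsto_pi_nhds.2 hL)
  have hshift (h : ℝ≥0) (ξ : ι → CadlagPath E) :
      ∃ y, Tendsto (fun n => (ξ i).1 (R n ξ + h)) atTop (𝓝 y) :=
    (ξ i).2.exists_tendsto_of_monotone (fun _ _ hmn => add_le_add_left (hmono ξ hmn) h)
      ((hL ξ).add_const h)
  choose y hy using hshift
  have hXm (n : ℕ) (h : ℝ≥0) : Measurable fun ξ : ι → CadlagPath E => (ξ i).1 (R n ξ + h) :=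
    measurable_at_random_time (Z := fun t (ξ : ι → CadlagPath E) => (ξ i).1 t)
      ((hRm n).add_const h) (measurable_eval i) (fun ξ => (ξ i).2.rightContinuous)
  have hXLm : Measurable fun ξ : ι → CadlagPath E => (ξ i).1 (L ξ) :=
    measurable_at_random_time (Z := fun t (ξ : ι → CadlagPath E) => (ξ i).1 t)
      hLm (measurable_eval i) (fun ξ => (ξ i).2.rightContinuous)
  have hym (h : ℝ≥0) : Measurable (y h) :=
    measurable_of_tendsto_metrizable (fun n => hXm n h) (tendsto_pi_nhds.2 (hy h))
  have hh0 : Tendsto (fun k : ℕ => (1 : ℝ≥0) / ((k : ℝ≥0) + 1)) atTop (𝓝 0) :=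
    tendsto_one_div_add_atTop_nhds_zero_nat
  have hlim (ξ : ι → CadlagPath E) :
      Tendsto (fun k : ℕ => y (1 / ((k : ℝ≥0) + 1)) ξ) atTop (𝓝 ((ξ i).1 (L ξ))) :=
    tendsto_of_tendsto_shift ((ξ i).2.rightContinuous _) (hmono ξ) (hL ξ)
      (fun k => by positivity) hh0 fun k => hy _ ξ
  -- The strong Markov property at R n gives, as n → ∞, E f(y 0) g(y h) = E f(y 0) P_h g(y 0). As h
  -- → 0, y h tends to the value at L and P_h g tends to g, so `ae_eq_of_integral_mul_eq` identifies
  -- y 0 with the value at L.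
  have hae : ∀ᵐ ξ ∂(X.indepLaw x), y 0 ξ = (ξ i).1 (L ξ) := by
    refine ae_eq_of_integral_mul_eq (hym 0) hXLm fun f g hf hg => ?_
    obtain ⟨Cf, hCf⟩ := hf.exists_bound
    obtain ⟨Cg, hCg⟩ := hg.exists_bound
    have hb {u v : ℝ} (hu : |u| ≤ Cf) (hv : |v| ≤ Cg) : ‖u * v‖ ≤ Cf * Cg := by
      rw [Real.norm_eq_abs, abs_mul]
      exact mul_le_mul hu hv (abs_nonneg _) ((abs_nonneg _).trans hu)
    have step (h : ℝ≥0) : ∫ ξ, f (y 0 ξ) * g (y h ξ) ∂(X.indepLaw x) =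
        ∫ ξ, f (y 0 ξ) * X.op h g (y 0 ξ) ∂(X.indepLaw x) := by
      have hop := X.isConstAddZeroAtInfty_op hg h
      have l1 : Tendsto (fun n => ∫ ξ, f ((ξ i).1 (R n ξ + 0)) * g ((ξ i).1 (R n ξ + h))
          ∂(X.indepLaw x)) atTop (𝓝 (∫ ξ, f (y 0 ξ) * g (y h ξ) ∂(X.indepLaw x))) := by
        refine tendsto_integral_of_dominated_convergence (fun _ => Cf * Cg) (fun n => ?_)
          (integrable_const _) (fun n => ae_of_all _ fun ξ => hb (hCf _) (hCg _))
          (ae_of_all _ fun ξ => ?_)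
        · exact ((hf.measurable.comp (hXm n 0)).mul
            (hg.measurable.comp (hXm n h))).aestronglyMeasurable
        · exact ((hf.continuous.tendsto _).comp (hy 0 ξ)).mul
            ((hg.continuous.tendsto _).comp (hy h ξ))
      have l2 : Tendsto (fun n => ∫ ξ, f ((ξ i).1 (R n ξ + 0)) * X.op h g ((ξ i).1 (R n ξ + 0))
          ∂(X.indepLaw x)) atTop (𝓝 (∫ ξ, f (y 0 ξ) * X.op h g (y 0 ξ) ∂(X.indepLaw x))) := by
        refine tendsto_integral_of_dominated_convergence (fun _ => Cf * Cg) (fun n => ?_)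
          (integrable_const _) (fun n => ae_of_all _ fun ξ => hb (hCf _) (X.abs_op_le hCg _ _))
          (ae_of_all _ fun ξ => ?_)
        · exact ((hf.measurable.comp (hXm n 0)).mul
            (hop.measurable.comp (hXm n 0))).aestronglyMeasurable
        · exact ((hf.continuous.tendsto _).comp (hy 0 ξ)).mul
            ((hop.continuous.tendsto _).comp (hy 0 ξ))
      refine tendsto_nhds_unique l1 (l2.congr fun n => ?_)
      simp only [add_zero]
      exact (X.integral_shift_eq x i (hR n) h hf hg).symm
    have l1 : Tendsto (fun k : ℕ => ∫ ξ, f (y 0 ξ) * g (y (1 / ((k : ℝ≥0) + 1)) ξ)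
        ∂(X.indepLaw x)) atTop (𝓝 (∫ ξ, f (y 0 ξ) * g ((ξ i).1 (L ξ)) ∂(X.indepLaw x))) := by
      refine tendsto_integral_of_dominated_convergence (fun _ => Cf * Cg) (fun n => ?_)
        (integrable_const _) (fun n => ae_of_all _ fun ξ => hb (hCf _) (hCg _))
        (ae_of_all _ fun ξ => ?_)
      · exact ((hf.measurable.comp (hym 0)).mul
          (hg.measurable.comp (hym _))).aestronglyMeasurable
      · exact tendsto_const_nhds.mul ((hg.continuous.tendsto _).comp (hlim ξ))
    have l2 : Tendsto (fun k : ℕ => ∫ ξ, f (y 0 ξ) * X.op (1 / ((k : ℝ≥0) + 1)) g (y 0 ξ)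
        ∂(X.indepLaw x)) atTop (𝓝 (∫ ξ, f (y 0 ξ) * g (y 0 ξ) ∂(X.indepLaw x))) := by
      refine tendsto_integral_of_dominated_convergence (fun _ => Cf * Cg) (fun n => ?_)
        (integrable_const _) (fun n => ae_of_all _ fun ξ => hb (hCf _) (X.abs_op_le hCg _ _))
        (ae_of_all _ fun ξ => ?_)
      · exact ((hf.measurable.comp (hym 0)).mul
          ((X.isConstAddZeroAtInfty_op hg _).measurable.comp (hym 0))).aestronglyMeasurable
      · refine tendsto_const_nhds.mul ?_
        exact ((X.tendstoUniformly_op_zero hg).tendsto_at (y 0 ξ)).comp hh0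
    exact tendsto_nhds_unique l1 (l2.congr fun k => (step _).symm)
  filter_upwards [hae] with ξ hξ
  rw [← hξ]
  simpa using hy 0 ξ

end QuasiLeftContinuity

/-! ### Measurability of collisions -/

section TimeGrid

/-- A countable set of times up to `t` that contains `t` and is dense. -/
def timeGrid (t : ℝ≥0) : Set ℝ≥0 :=
  {q | q ≤ t ∧ (q = t ∨ q ∈ Set.range (TopologicalSpace.denseSeq ℝ≥0))}

theorem countable_timeGrid (t : ℝ≥0) : (timeGrid t).Countable := by
  refine ((Set.countable_singleton t).union
    (Set.countable_range (TopologicalSpace.denseSeq ℝ≥0))).mono ?_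
  rintro q ⟨-, h⟩
  exact h

theorem exists_denseSeq_of_rightOpen {p : ℝ≥0 → Prop} {s t : ℝ≥0} (hst : s < t)
    (hp : ∀ᶠ r in 𝓝[≥] s, p r) :
    ∃ n, s < TopologicalSpace.denseSeq ℝ≥0 n ∧ TopologicalSpace.denseSeq ℝ≥0 n < t ∧
      p (TopologicalSpace.denseSeq ℝ≥0 n) := by
  obtain ⟨u, hu, hup⟩ := (mem_nhdsGE_iff_exists_Ico_subset).1 hp
  obtain ⟨n, h1, h2⟩ := (TopologicalSpace.denseRange_denseSeq ℝ≥0).exists_mem_open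
    (isOpen_Ioo (a := s) (b := min u t)) (Set.nonempty_Ioo.2 (lt_min hu hst))
  exact ⟨n, h1, h2.trans_le (min_le_right _ _), hup ⟨h1.le, h2.trans_le (min_le_left _ _)⟩⟩

/-- A dense time just after s serves when s < t. For s = t there is no room to the right, which is
why the grid contains t itself. -/
theorem exists_timeGrid_of_rightOpen {p : ℝ≥0 → Prop} {s t : ℝ≥0} (hst : s ≤ t)
    (hp : ∀ᶠ r in 𝓝[≥] s, p r) : ∃ q ∈ timeGrid t, s ≤ q ∧ p q := by
  rcases hst.lt_or_eq with h | rfl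
  · obtain ⟨n, h1, h2, h3⟩ := exists_denseSeq_of_rightOpen h hp
    exact ⟨_, ⟨h2.le, Or.inr ⟨n, rfl⟩⟩, h1.le, h3⟩
  · exact ⟨s, ⟨le_rfl, Or.inl rfl⟩, le_rfl, hp.self_of_nhdsWithin Set.self_mem_Ici⟩

end TimeGrid

section Collision

theorem measurableSet_dist_lt {Ω E : Type*} {m : MeasurableSpace Ω} [PseudoMetricSpace E]
    [SecondCountableTopology E] [MeasurableSpace E] [OpensMeasurableSpace E] {f g : Ω → E}
    (hf : Measurable f) (hg : Measurable g) (ε : ℝ) :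
    MeasurableSet {ω | dist (f ω) (g ω) < ε} :=
  measurableSet_lt (hf.dist hg) measurable_const

variable {E : Type*} [TopologicalSpace E] [LocallyCompactSpace E] [SecondCountableTopology E]
  [T2Space E]

/-- The paths `a` and `b` come arbitrarily close to one another on the time grid up to `c`. -/
def Approach (a b : ℝ≥0 → E) (c : ℝ≥0) : Prop :=
  letI := TopologicalSpace.metrizableSpaceMetric E
  ∀ n : ℕ, ∃ q ∈ timeGrid c, dist (a q) (b q) < 1 / ((n : ℝ) + 1)

theorem approach_of_meet {a b : ℝ≥0 → E} (ha : ∀ t, ContinuousWithinAt a (Set.Ici t) t)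
    (hb : ∀ t, ContinuousWithinAt b (Set.Ici t) t) {c : ℝ≥0} (h : ∃ s ≤ c, a s = b s) :
    Approach a b c := by
  let _ := TopologicalSpace.metrizableSpaceMetric E
  obtain ⟨s, hs, hab⟩ := h
  intro n
  have hd : ∀ᶠ r in 𝓝[≥] s, dist (a r) (b r) < 1 / ((n : ℝ) + 1) := by
    have h1 : Tendsto (fun r => dist (a r) (b r)) (𝓝[≥] s) (𝓝 (dist (a s) (b s))) :=
      (ha s).dist (hb s)
    rw [hab, dist_self] at h1
    exact h1.eventually (gt_mem_nhds (by positivity))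
  obtain ⟨q, hq, -, h⟩ := exists_timeGrid_of_rightOpen hs hd
  exact ⟨q, hq, h⟩

variable {ι : Type*}

/-- The vectors of paths for which any two paths that come arbitrarily close by some time have met
by then. -/
def regularVectors (E ι : Type*) [TopologicalSpace E] [LocallyCompactSpace E]
    [SecondCountableTopology E] [T2Space E] : Set (ι → CadlagPath E) :=
  {ξ | ∀ i j c, Approach (ξ i).1 (ξ j).1 c → ∃ s ≤ c, (ξ i).1 s = (ξ j).1 s}

variable [MeasurableSpace E] [BorelSpace E]

theorem measurableSet_approach (i j : ι) (c : ℝ≥0) :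
    MeasurableSet[pastOutside E Set.univ c]
      {ξ : ι → CadlagPath E | Approach (ξ i).1 (ξ j).1 c} := by
  let _ := TopologicalSpace.metrizableSpaceMetric E
  have : {ξ : ι → CadlagPath E | Approach (ξ i).1 (ξ j).1 c} =
      ⋂ n : ℕ, ⋃ q ∈ timeGrid c, {ξ | dist ((ξ i).1 q) ((ξ j).1 q) < 1 / ((n : ℝ) + 1)} := by
    ext ξ; simp [Approach]
  rw [this]
  refine MeasurableSet.iInter fun n => MeasurableSet.biUnion (countable_timeGrid c) fun q hq => ?_
  exact measurableSet_dist_lt (measurable_pastOutside_eval _ hq.1 i)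
    (measurable_pastOutside_eval _ hq.1 j) _

/-- The first times at which the paths are within 1/(n+1) increase to some L ≤ c. By
quasi-left-continuity both paths converge along them to their values at L, so these values coincide.
Without it the paths might approach only in their left limits. -/
theorem FellerProcess.ae_meet_of_approach (X : FellerProcess E) (x : ι → E) (i j : ι) (c : ℝ≥0) :
    ∀ᵐ ξ ∂(X.indepLaw x), Approach (ξ i).1 (ξ j).1 c → ∃ s ≤ c, (ξ i).1 s = (ξ j).1 s := by
  let _ := TopologicalSpace.metrizableSpaceMetric E
  -- The alternative `c ≤ t` caps the hitting times at c, so that they are finite and their limit is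
  -- at most c.
  let S (n : ℕ) (ξ : ι → CadlagPath E) : Set ℝ≥0 :=
    {t | dist ((ξ i).1 t) ((ξ j).1 t) < 1 / ((n : ℝ) + 1) ∨ c ≤ t}
  have hS (n ξ) : (S n ξ).Nonempty := ⟨c, Or.inr le_rfl⟩
  have hSc (n ξ) : c ∈ S n ξ := Or.inr le_rfl
  let R (n : ℕ) (ξ : ι → CadlagPath E) : ℝ≥0 := sInf (S n ξ)
  have hdc (ξ : ι → CadlagPath E) (t : ℝ≥0) :
      ContinuousWithinAt (fun t => dist ((ξ i).1 t) ((ξ j).1 t)) (Set.Ici t) t :=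
    ((ξ i).2.rightContinuous t).dist ((ξ j).2.rightContinuous t)
  have hmono (ξ) : Monotone fun n => R n ξ := by
    intro m n hmn
    refine csInf_le_csInf' (hS n ξ) fun t ht => ht.imp (fun h => h.trans_le ?_) id
    gcongr
  have hRc (n ξ) : R n ξ ≤ c := csInf_le' (hSc n ξ)
  have hL (ξ) : Tendsto (fun n => R n ξ) atTop (𝓝 (⨆ n, R n ξ)) :=
    tendsto_atTop_ciSup (hmono ξ) ⟨c, by rintro _ ⟨n, rfl⟩; exact hRc n ξ⟩
  have hR (n : ℕ) (q : ℝ≥0) : MeasurableSet[pastOutside E Set.univ q] {ξ | R n ξ < q} := by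
    -- By right-continuity, closeness at a time before q is still seen at a dense time before q.
    have : {ξ | R n ξ < q} = {_ξ | c < q} ∪ ⋃ k ∈ {k | TopologicalSpace.denseSeq ℝ≥0 k < q},
        {ξ | dist ((ξ i).1 (TopologicalSpace.denseSeq ℝ≥0 k))
          ((ξ j).1 (TopologicalSpace.denseSeq ℝ≥0 k)) < 1 / ((n : ℝ) + 1)} := by
      ext ξ
      simp only [Set.mem_ofPred_eq, Set.mem_union, Set.mem_iUnion, exists_prop]
      constructor
      · intro h
        obtain ⟨t, ht, htq⟩ := (csInf_lt_iff (OrderBot.bddBelow _) (hS n ξ)).1 h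
        rcases ht with ht | ht
        · obtain ⟨k, -, h2, h3⟩ := exists_denseSeq_of_rightOpen htq
            ((hdc ξ t).eventually (gt_mem_nhds ht))
          exact Or.inr ⟨k, h2, h3⟩
        · exact Or.inl (ht.trans_lt htq)
      · rintro (h | ⟨k, hk, h⟩)
        · exact (hRc n ξ).trans_lt h
        · exact (csInf_le' (show _ ∈ S n ξ from Or.inl h)).trans_lt hk
    rw [this]
    refine MeasurableSet.union (MeasurableSet.const _)
      (MeasurableSet.biUnion (Set.to_countable _) fun k hk => ?_)
    exact measurableSet_dist_lt (measurable_pastOutside_eval _ (le_of_lt hk) i)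
      (measurable_pastOutside_eval _ (le_of_lt hk) j) _
  filter_upwards [X.ae_tendsto_of_optional x i hR hmono hL,
    X.ae_tendsto_of_optional x j hR hmono hL] with ξ hi hj happ
  refine ⟨_, ciSup_le fun n => hRc n ξ, ?_⟩
  -- If the distance at R n were too large, it would be so on some [R n, u). That interval contains
  -- a point t of S n. Either t is a time of closeness, or c ≤ t and then the grid time q ≤ c given
  -- by the approach lies in it as well.
  have hle (n : ℕ) : dist ((ξ i).1 (R n ξ)) ((ξ j).1 (R n ξ)) ≤ 1 / ((n : ℝ) + 1) := by
    by_contra! hlt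
    obtain ⟨u, hu, hu'⟩ := (mem_nhdsGE_iff_exists_Ico_subset).1
      ((hdc ξ (R n ξ)).eventually (lt_mem_nhds hlt))
    obtain ⟨t, ht, htu⟩ := (csInf_lt_iff (OrderBot.bddBelow _) (hS n ξ)).1
      (show sInf (S n ξ) < u from hu)
    obtain ⟨q, hq, hqd⟩ := happ n
    have hRq : R n ξ ≤ q := csInf_le' (Or.inl hqd)
    rcases ht with ht | ht
    · exact lt_asymm ht (hu' ⟨csInf_le' (Or.inl ht), htu⟩)
    · exact lt_asymm hqd (hu' ⟨hRq, (hq.1.trans ht).trans_lt htu⟩)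
  have h0 := le_of_tendsto_of_tendsto' (hi.dist hj) tendsto_one_div_add_atTop_nhds_zero_nat hle
  exact dist_le_zero.1 h0

/-- One null set serves all times: not having met by c is right-open in c, so a failure at c would
show at a dense time slightly later. -/
theorem FellerProcess.regularVectors_mem_ae [Countable ι] (X : FellerProcess E) (x : ι → E) :
    regularVectors E ι ∈ ae (X.indepLaw x) := by
  have h : ∀ᵐ ξ ∂(X.indepLaw x), ∀ i j, ∀ n : ℕ,
      Approach (ξ i).1 (ξ j).1 (TopologicalSpace.denseSeq ℝ≥0 n) →
        ∃ s ≤ TopologicalSpace.denseSeq ℝ≥0 n, (ξ i).1 s = (ξ j).1 s := by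
    simp only [ae_all_iff]
    exact fun i j n => X.ae_meet_of_approach x i j _
  filter_upwards [h] with ξ hξ i j c happ
  by_contra hno
  have hopen := eventually_not_exists_le (p := fun s => (ξ i).1 s = (ξ j).1 s)
    (eventually_ne_of_rightContinuous (ξ i).2.rightContinuous (ξ j).2.rightContinuous) c hno
  obtain ⟨n, h1, -, h2⟩ := exists_denseSeq_of_rightOpen (lt_add_one c) hopen
  let _ := TopologicalSpace.metrizableSpaceMetric E
  refine h2 (hξ i j n fun k => ?_)
  obtain ⟨q, hq, hd⟩ := happ k
  -- The grid up to c contains c, which need not lie on the later grid; the closeness is moved to a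
  -- nearby point that does.
  obtain ⟨r, hr, -, h3⟩ := exists_timeGrid_of_rightOpen (hq.1.trans h1.le)
    (((ξ i).2.rightContinuous q).dist ((ξ j).2.rightContinuous q) |>.eventually (gt_mem_nhds hd))
  exact ⟨r, hr, h3⟩

/-- The events that agree, on the regular vectors of paths, with an event known at time `q`. -/
abbrev regularPast (E ι : Type*) [TopologicalSpace E] [LocallyCompactSpace E]
    [SecondCountableTopology E] [T2Space E] [MeasurableSpace E] (q : ℝ≥0) :
    MeasurableSpace (ι → CadlagPath E) :=
  eventuallyMeasurableSpace (pastOutside E Set.univ q) (𝓟 (regularVectors E ι))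

omit [BorelSpace E] in
theorem regularPast_mono {q r : ℝ≥0} (h : q ≤ r) : regularPast E ι q ≤ regularPast E ι r := by
  rintro A ⟨B, hB, hAB⟩
  exact ⟨B, pastOutside_mono _ h _ hB, hAB⟩

theorem measurableSet_meet (i j : ι) (c : ℝ≥0) : MeasurableSet[regularPast E ι c]
    {ξ : ι → CadlagPath E | ∃ s ≤ c, (ξ i).1 s = (ξ j).1 s} := by
  refine ⟨_, measurableSet_approach i j c, ?_⟩
  refine eventually_principal.2 fun ξ hξ => ?_
  exact propext ⟨approach_of_meet (ξ i).2.rightContinuous (ξ j).2.rightContinuous, hξ i j c⟩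

/-- The meeting must take place while i is alive. Being alive is right-open, so it is enough that
for some grid time q, y has met i by q and i is still alive at q. -/
theorem measurableSet_hitBy (l : List ι) (y : ι) (t : ℝ≥0) : MeasurableSet[regularPast E ι t]
    {ξ : ι → CadlagPath E | HitBy (fun i => (ξ i).1) l y t} := by
  induction l generalizing y t with
  | nil => simp [HitBy, occupied]
  | cons i l ih =>
    have : {ξ : ι → CadlagPath E | HitBy (fun i => (ξ i).1) (i :: l) y t} =
        {ξ | HitBy (fun i => (ξ i).1) l y t} ∪ ⋃ q ∈ timeGrid t,
          {ξ | ∃ s ≤ q, (ξ y).1 s = (ξ i).1 s} ∩ {ξ | HitBy (fun i => (ξ i).1) l i q}ᶜ := by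
      ext ξ
      simp only [Set.mem_union, Set.mem_iUnion, Set.mem_inter_iff, Set.mem_compl_iff,
        Set.mem_ofPred_eq, exists_prop]
      constructor
      · rintro ⟨s, hs, h⟩
        rw [occupied_cons] at h
        rcases h with h | ⟨h1, h2⟩
        · exact Or.inl ⟨s, hs, h⟩
        · obtain ⟨q, hq, hsq, h3⟩ := exists_timeGrid_of_rightOpen hs
            (eventually_not_hitBy (fun i => (ξ i).2.rightContinuous) l i s h2)
          exact Or.inr ⟨q, hq, ⟨s, hsq, h1⟩, h3⟩
      · rintro (⟨s, hs, h⟩ | ⟨q, hq, ⟨s, hsq, h1⟩, h2⟩)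
        · exact ⟨s, hs, occupied_subset_cons _ _ _ _ h⟩
        · refine ⟨s, hsq.trans hq.1, ?_⟩
          rw [occupied_cons]
          exact Or.inr ⟨h1, fun h => h2 (h.mono hsq)⟩
    rw [this]
    refine (ih y t).union (MeasurableSet.biUnion (countable_timeGrid t) fun q hq => ?_)
    exact (regularPast_mono hq.1 _ (measurableSet_meet y i q)).inter
      (regularPast_mono hq.1 _ (ih i q)).compl

theorem measurableSet_disjoint_occupied (l : List ι) (t : ℝ≥0) {U : Set E} (hU : MeasurableSet U) :
    MeasurableSet[regularPast E ι t]
      {ξ : ι → CadlagPath E | Disjoint (occupied (fun i => (ξ i).1) l t) U} := by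
  induction l with
  | nil => simp [occupied]
  | cons y l ih =>
    have : {ξ : ι → CadlagPath E | Disjoint (occupied (fun i => (ξ i).1) (y :: l) t) U} =
        {ξ | Disjoint (occupied (fun i => (ξ i).1) l t) U} ∩
          ({ξ | (ξ y).1 t ∈ U} \ {ξ | HitBy (fun i => (ξ i).1) l y t})ᶜ := by
      ext ξ
      rw [Set.mem_ofPred_eq, occupied_cons, Set.disjoint_union_left]
      refine and_congr_right fun _ => ?_
      rw [Set.disjoint_left]
      simp only [Set.mem_ofPred_eq, Set.mem_compl_iff, Set.mem_sdiff, not_and, not_not]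
      exact ⟨fun h h1 => by_contra fun h2 => h ⟨rfl, h2⟩ h1,
        by rintro h z ⟨rfl, h1⟩ h2; exact h1 (h h2)⟩
    rw [this]
    refine ih.inter (MeasurableSet.diff ?_ (measurableSet_hitBy l y t)).compl
    exact le_eventuallyMeasurableSpace _ (measurable_pastOutside_eval Set.univ le_rfl y hU)

theorem FellerProcess.nullMeasurableSet_of_regularPast [Countable ι] (X : FellerProcess E)
    (x : ι → E) {q : ℝ≥0} {A : Set (ι → CadlagPath E)} (hA : MeasurableSet[regularPast E ι q] A) :
    NullMeasurableSet A (X.indepLaw x) := by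
  obtain ⟨B, hB, hAB⟩ := hA
  exact ⟨B, pastOutside_le _ _ _ hB, hAB.filter_mono (le_principal_iff.2
    (X.regularVectors_mem_ae x))⟩

end Collision

/-! ### Interchanging the tails of two paths -/

section Splice

variable {E : Type*} [TopologicalSpace E]

open Classical in
/-- The path that follows `a` before the time `r` and `b` from the time `r` on. -/
noncomputable def splice (r : ℝ≥0∞) (a b : ℝ≥0 → E) (t : ℝ≥0) : E :=
  if r ≤ t then b t else a t

theorem IsCadlag.splice {a b : ℝ≥0 → E} (ha : IsCadlag a) (hb : IsCadlag b) (r : ℝ≥0∞) :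
    IsCadlag (splice r a b) := by
  intro t
  constructor
  · by_cases h : r ≤ t
    · refine ((hb t).1.congr_of_eventuallyEq ?_ (if_pos h))
      filter_upwards [self_mem_nhdsWithin] with s hs
      exact if_pos (h.trans (ENNReal.coe_le_coe.2 hs))
    · refine ((ha t).1.congr_of_eventuallyEq ?_ (if_neg h))
      have h1 : ∀ᶠ s : ℝ≥0 in 𝓝[≥] t, (s : ℝ≥0∞) < r :=
        nhdsWithin_le_nhds ((ENNReal.continuous_coe.tendsto t).eventually
          (gt_mem_nhds (not_le.1 h)))
      filter_upwards [h1] with s hs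
      exact if_neg (not_le.2 hs)
  · by_cases h : r < t
    · obtain ⟨y, hy⟩ := (hb t).2
      refine ⟨y, hy.congr' ?_⟩
      have h1 : ∀ᶠ s : ℝ≥0 in 𝓝[<] t, r < s :=
        nhdsWithin_le_nhds ((ENNReal.continuous_coe.tendsto t).eventually (lt_mem_nhds h))
      filter_upwards [h1] with s hs
      exact (if_pos hs.le).symm
    · obtain ⟨y, hy⟩ := (ha t).2
      refine ⟨y, hy.congr' ?_⟩
      filter_upwards [self_mem_nhdsWithin] with s hs
      exact (if_neg (not_le.2 ((ENNReal.coe_lt_coe.2 hs).trans_le (not_lt.1 h)))).symm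

omit [TopologicalSpace E] in
theorem splice_of_le {r : ℝ≥0∞} {a b : ℝ≥0 → E} {t : ℝ≥0} (h : r ≤ t) : splice r a b t = b t :=
  if_pos h

omit [TopologicalSpace E] in
theorem splice_of_lt {r : ℝ≥0∞} {a b : ℝ≥0 → E} {t : ℝ≥0} (h : t < r) : splice r a b t = a t :=
  if_neg (not_le.2 h)

variable {ι : Type*}

open Classical in
/-- Interchange the paths with labels `a` and `b` from the time `r` on. -/
noncomputable def swapTails (a b : ι) (r : ℝ≥0∞) (ξ : ι → CadlagPath E) (i : ι) : CadlagPath E :=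
  if i = a then ⟨splice r (ξ a).1 (ξ b).1, (ξ a).2.splice (ξ b).2 r⟩
  else if i = b then ⟨splice r (ξ b).1 (ξ a).1, (ξ b).2.splice (ξ a).2 r⟩
  else ξ i

theorem swapTails_left (a b : ι) (r : ℝ≥0∞) (ξ : ι → CadlagPath E) :
    (swapTails a b r ξ a).1 = splice r (ξ a).1 (ξ b).1 := by
  simp [swapTails]

theorem swapTails_right {a b : ι} (hab : a ≠ b) (r : ℝ≥0∞) (ξ : ι → CadlagPath E) :
    (swapTails a b r ξ b).1 = splice r (ξ b).1 (ξ a).1 := by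
  simp [swapTails, hab.symm]

theorem swapTails_of_ne {a b i : ι} (ha : i ≠ a) (hb : i ≠ b) (r : ℝ≥0∞)
    (ξ : ι → CadlagPath E) : swapTails a b r ξ i = ξ i := by
  simp [swapTails, ha, hb]

theorem swapTails_top (a b : ι) (ξ : ι → CadlagPath E) : swapTails a b ⊤ ξ = ξ := by
  funext i
  by_cases ha : i = a
  · subst ha
    refine Subtype.ext ?_
    rw [swapTails_left]
    funext t
    exact splice_of_lt ENNReal.coe_lt_top
  · by_cases hb : i = b
    · subst hb
      refine Subtype.ext ?_
      rw [swapTails_right (Ne.symm ha)]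
      funext t
      exact splice_of_lt ENNReal.coe_lt_top
    · exact swapTails_of_ne ha hb _ _

theorem measurable_swapTails [MeasurableSpace E] (a b : ι) {R : (ι → CadlagPath E) → ℝ≥0∞}
    (hR : Measurable R) : Measurable fun ξ => swapTails a b (R ξ) ξ := by
  have hsp (c d : ι) (t : ℝ≥0) : Measurable fun ξ : ι → CadlagPath E =>
      splice (R ξ) (ξ c).1 (ξ d).1 t :=
    Measurable.ite (measurableSet_le hR measurable_const) (measurable_eval d t)
      (measurable_eval c t)
  refine measurable_pi_lambda _ fun i => ?_
  suffices h : ∀ t, Measurable fun ξ => (swapTails a b (R ξ) ξ i).1 t from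
    measurable_comap_iff.2 (measurable_pi_lambda _ h)
  intro t
  by_cases ha : i = a
  · subst ha
    simpa only [swapTails_left] using hsp i b t
  · by_cases hb : i = b
    · subst hb
      simpa only [swapTails_right (Ne.symm ha)] using hsp i a t
    · simpa only [swapTails_of_ne ha hb] using measurable_eval i t

end Splice

section StepFunctions

theorem eventually_lt_iff_of_finset (K : Finset ℝ≥0) (q : ℝ≥0) :
    ∀ᶠ s in 𝓝[≥] q, ∀ t ∈ K, s < t ↔ q < t := by
  rw [Filter.eventually_all_finset]
  intro t _
  by_cases h : q < t
  · filter_upwards [nhdsWithin_le_nhds (Iio_mem_nhds h)] with s hs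
    exact iff_of_true hs h
  · filter_upwards [self_mem_nhdsWithin] with s hs
    exact iff_of_false (not_lt.2 ((not_lt.1 h).trans hs)) h

theorem continuousWithinAt_prod_filter_lt (K : Finset ℝ≥0) (u : ℝ≥0 → ℝ) (q : ℝ≥0) :
    ContinuousWithinAt (fun q => ∏ t ∈ K with q < t, u t) (Set.Ici q) q := by
  refine tendsto_const_nhds.congr' ?_
  filter_upwards [eventually_lt_iff_of_finset K q] with s hs
  exact Finset.prod_congr (Finset.filter_congr fun t ht => (hs t ht).symm) fun _ _ => rfl

theorem continuousWithinAt_prod_filter_not_lt (K : Finset ℝ≥0) (u : ℝ≥0 → ℝ) (q : ℝ≥0) :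
    ContinuousWithinAt (fun q => ∏ t ∈ K with ¬ q < t, u t) (Set.Ici q) q := by
  refine tendsto_const_nhds.congr' ?_
  filter_upwards [eventually_lt_iff_of_finset K q] with s hs
  exact Finset.prod_congr (Finset.filter_congr fun t ht => not_congr (hs t ht).symm) fun _ _ => rfl

theorem exists_prod_bound {E : Type*} [TopologicalSpace E] (K : Finset ℝ≥0) {g : ℝ≥0 → E → ℝ}
    (hg : ∀ t, IsConstAddZeroAtInfty (g t)) :
    ∃ C, 0 ≤ C ∧ ∀ S ⊆ K, ∀ ω : ℝ≥0 → E, |∏ t ∈ S, g t (ω t)| ≤ C := by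
  choose c hc using fun t => (hg t).exists_bound
  have h1 (t) : 1 ≤ max 1 (c t) := le_max_left _ _
  -- The bound has to work for products over every subset of K, hence factors of at least 1.
  refine ⟨∏ t ∈ K, max 1 (c t), Finset.prod_nonneg fun t _ => zero_le_one.trans (h1 t),
    fun S hS ω => ?_⟩
  have : ∏ t ∈ S, g t (ω t) = ∏ t ∈ K, if t ∈ S then g t (ω t) else 1 := by
    rw [← Finset.prod_subset hS fun t _ ht => if_neg ht]
    exact Finset.prod_congr rfl fun t ht => (if_pos ht).symm
  rw [this, Finset.abs_prod]
  refine Finset.prod_le_prod (fun _ _ => abs_nonneg _) fun t _ => ?_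
  split_ifs
  · exact (hc t (ω t)).trans (le_max_right 1 _)
  · simp

end StepFunctions

/-! ### Strong Markov property and invariance under the interchange -/

section Swap

variable {E : Type*} [TopologicalSpace E] [MeasurableSpace E]

/-- The functions `V q` describe the conditional expectation, given the path up to time `q`, of the
product of the functions `g t` of the path at the times `t ∈ K` after `q`. -/
structure FellerProcess.IsFuture (X : FellerProcess E) (K : Finset ℝ≥0) (g V : ℝ≥0 → E → ℝ) :
    Prop where
  isConstAddZeroAtInfty : ∀ q, IsConstAddZeroAtInfty (V q)
  bound : ∃ C, ∀ q x, |V q x| ≤ C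
  tendsto : ∀ q y, Tendsto (fun p : ℝ≥0 × E => V p.1 p.2) (𝓝[≥] q ×ˢ 𝓝 y) (𝓝 (V q y))
  setIntegral : ∀ (x : E) (q : ℝ≥0) (B : Set (CadlagPath E)), MeasurableSet[pathPast E q] B →
        ∫ ω in B, ∏ t ∈ K with q < t, g t (ω.1 t) ∂(X.law x) =
          ∫ ω in B, V q (ω.1 q) ∂(X.law x)

variable [BorelSpace E] {ι : Type*}

/-- The strong Markov property for two paths at a time `R` that is optional up to null sets. -/
theorem FellerProcess.setIntegral_future (X : FellerProcess E) (x : ι → E) {c d : ι}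
    (hcd : c ≠ d) {R : (ι → CadlagPath E) → ℝ≥0∞}
    (hR : ∀ q : ℝ≥0, ∃ A, MeasurableSet[pastOutside E Set.univ q] A ∧
      {ξ | R ξ < q} =ᵐ[X.indepLaw x] A)
    {K : Finset ℝ≥0} {g₁ g₂ V₁ V₂ : ℝ≥0 → E → ℝ} (hg₁ : ∀ t, IsConstAddZeroAtInfty (g₁ t))
    (hg₂ : ∀ t, IsConstAddZeroAtInfty (g₂ t)) (hV₁ : X.IsFuture K g₁ V₁)
    (hV₂ : X.IsFuture K g₂ V₂) {W : ℝ≥0 → (ι → CadlagPath E) → ℝ}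
    (hW : ∀ q, Measurable[pastOutside E {c, d} q] (W q)) {C : ℝ} (hC : ∀ q ξ, |W q ξ| ≤ C)
    (hWc : ∀ ξ q, ContinuousWithinAt (fun q => W q ξ) (Set.Ici q) q) :
    ∫ ξ in {ξ | R ξ < ⊤}, W (R ξ).toNNReal ξ *
        ((∏ t ∈ K with (R ξ).toNNReal < t, g₁ t ((ξ c).1 t)) *
          ∏ t ∈ K with (R ξ).toNNReal < t, g₂ t ((ξ d).1 t)) ∂(X.indepLaw x) =
      ∫ ξ in {ξ | R ξ < ⊤}, W (R ξ).toNNReal ξ *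
        (V₁ (R ξ).toNNReal ((ξ c).1 (R ξ).toNNReal) *
          V₂ (R ξ).toNNReal ((ξ d).1 (R ξ).toNNReal)) ∂(X.indepLaw x) := by
  obtain ⟨C₁, hC₁0, hC₁⟩ := exists_prod_bound K hg₁
  obtain ⟨C₂, hC₂0, hC₂⟩ := exists_prod_bound K hg₂
  obtain ⟨D₁, hD₁⟩ := hV₁.bound
  obtain ⟨D₂, hD₂⟩ := hV₂.bound
  set M₁ := max C₁ D₁
  set M₂ := max C₂ D₂
  have hF₁ (q : ℝ≥0) (ω : ℝ≥0 → E) : |∏ t ∈ K with q < t, g₁ t (ω t)| ≤ M₁ :=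
    (hC₁ _ (Finset.filter_subset _ _) ω).trans (le_max_left _ _)
  have hF₂ (q : ℝ≥0) (ω : ℝ≥0 → E) : |∏ t ∈ K with q < t, g₂ t (ω t)| ≤ M₂ :=
    (hC₂ _ (Finset.filter_subset _ _) ω).trans (le_max_left _ _)
  have hM₁ (q : ℝ≥0) (z : E) : |V₁ q z| ≤ M₁ := (hD₁ q z).trans (le_max_right _ _)
  have hM₂ (q : ℝ≥0) (z : E) : |V₂ q z| ≤ M₂ := (hD₂ q z).trans (le_max_right _ _)
  have hM₁0 : 0 ≤ M₁ := hC₁0.trans (le_max_left _ _)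
  have hM₂0 : 0 ≤ M₂ := hC₂0.trans (le_max_left _ _)
  have hb {w u v : ℝ} (hw : |w| ≤ C) (hu : |u| ≤ M₁) (hv : |v| ≤ M₂) :
      |w * (u * v)| ≤ C * (M₁ * M₂) := by
    rw [abs_mul, abs_mul]
    have hC0 := (abs_nonneg _).trans hw
    gcongr
  have hprodm {m : MeasurableSpace (ι → CadlagPath E)} {g : ℝ≥0 → E → ℝ}
      (hg : ∀ t, IsConstAddZeroAtInfty (g t)) (i : ι) (q : ℝ≥0)
      (hm : ∀ t, Measurable[m] fun ξ : ι → CadlagPath E => (ξ i).1 t) :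
      Measurable[m] fun ξ : ι → CadlagPath E => ∏ t ∈ K with q < t, g t ((ξ i).1 t) :=
    Finset.measurable_fun_prod _ fun t _ => (hg t).measurable.comp (hm t)
  have hVc {g V : ℝ≥0 → E → ℝ} (hV : X.IsFuture K g V) (ξ : ι → CadlagPath E) (i : ι) (q : ℝ≥0) :
      ContinuousWithinAt (fun q => V q ((ξ i).1 q)) (Set.Ici q) q :=
    (hV.tendsto q _).comp (tendsto_id.prodMk ((ξ i).2.rightContinuous q))
  have hWm (q : ℝ≥0) : Measurable (W q) := (hW q).mono (pastOutside_le _ _) le_rfl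
  refine setIntegral_eq_at_random_time (C := C * (M₁ * M₂))
    (Y := fun q ξ => W q ξ * ((∏ t ∈ K with q < t, g₁ t ((ξ c).1 t)) *
          ∏ t ∈ K with q < t, g₂ t ((ξ d).1 t)))
    (Q := fun q ξ => W q ξ * (V₁ q ((ξ c).1 q) * V₂ q ((ξ d).1 q)))
    (fun q => ?_) (fun q => ?_) (fun q ξ => hb (hC _ _) (hF₁ _ _) (hF₂ _ _)) (fun ξ q => ?_)
    (fun q => ?_) (fun q ξ => hb (hC _ _) (hM₁ _ _) (hM₂ _ _)) (fun ξ q => ?_)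
    (fun a b hab => ?_)
  · obtain ⟨A, hA, hRA⟩ := hR q
    exact ⟨A, pastOutside_le _ _ _ hA, hRA⟩
  · exact ((hWm q).mul ((hprodm hg₁ c q (measurable_eval c)).mul
      (hprodm hg₂ d q (measurable_eval d)))).aestronglyMeasurable
  · exact (hWc ξ q).mul ((continuousWithinAt_prod_filter_lt _ _ _).mul
      (continuousWithinAt_prod_filter_lt _ _ _))
  · exact ((hWm q).mul (((hV₁.isConstAddZeroAtInfty q).measurable.comp (measurable_eval c q)).mul
      ((hV₂.isConstAddZeroAtInfty q).measurable.comp (measurable_eval d q)))).aestronglyMeasurable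
  · exact (hWc ξ q).mul ((hVc hV₁ ξ c q).mul (hVc hV₂ ξ d q))
  · obtain ⟨A, hA, hRA⟩ := hR a
    obtain ⟨B, hB, hRB⟩ := hR b
    have hS : MeasurableSet[pastOutside E Set.univ b] (B \ A) :=
      hB.diff (pastOutside_mono _ hab _ hA)
    have hS' := pastOutside_le _ _ _ hS
    have hanti (T : Set ι) : pastOutside E Set.univ b ≤ pastOutside E T b :=
      pastOutside_anti (Set.subset_univ _) b
    have hind {m : MeasurableSpace (ι → CadlagPath E)}
        (hm : pastOutside E Set.univ b ≤ m) :
        Measurable[m] ((B \ A).indicator (1 : (ι → CadlagPath E) → ℝ)) :=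
      Measurable.indicator (m := m) measurable_const (hm _ hS)
    have hind1 (ξ) : |(B \ A).indicator (1 : (ι → CadlagPath E) → ℝ) ξ| ≤ 1 := by
      by_cases h : ξ ∈ B \ A <;> simp [h]
    rw [setIntegral_congr_set (hRB.diff hRA), setIntegral_congr_set (hRB.diff hRA),
      ← integral_indicator hS', ← integral_indicator hS']
    have hint₁ {g : ℝ≥0 → E → ℝ} (hg : ∀ t, IsConstAddZeroAtInfty (g t)) (y : E) :
        Measurable (fun ω : CadlagPath E => ∏ t ∈ K with b < t, g t (ω.1 t)) ∧
        Integrable (fun ω : CadlagPath E => ∏ t ∈ K with b < t, g t (ω.1 t)) (X.law y) := by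
      obtain ⟨C', -, hC'⟩ := exists_prod_bound K hg
      have hm : Measurable (fun ω : CadlagPath E => ∏ t ∈ K with b < t, g t (ω.1 t)) :=
        Finset.measurable_fun_prod _ fun t _ =>
          (hg t).measurable.comp (measurable_cadlagPath_eval t)
      exact ⟨hm, Integrable.of_bound hm.aestronglyMeasurable C'
        (ae_of_all _ fun ω => hC' _ (Finset.filter_subset _ _) ω.1)⟩
    have hint₂ {g V : ℝ≥0 → E → ℝ} (hV : X.IsFuture K g V) (y : E) :
        Measurable (fun ω : CadlagPath E => V b (ω.1 b)) ∧
        Integrable (fun ω : CadlagPath E => V b (ω.1 b)) (X.law y) :=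
      ⟨(hV.isConstAddZeroAtInfty b).measurable.comp (measurable_cadlagPath_eval b),
        (hV.isConstAddZeroAtInfty b).integrable_comp (measurable_cadlagPath_eval b)⟩
    -- The future of path c is integrated out first, with the whole of path d treated as known.
    have k₁ := X.integral_mul_eq_of_pathPast x c b (hint₁ hg₁ (x c)).1 (hint₂ hV₁ (x c)).1
      (hint₁ hg₁ (x c)).2 (hint₂ hV₁ (x c)).2 (fun B' hB' => hV₁.setIntegral _ b B' hB')
      (W := fun ξ => (B \ A).indicator 1 ξ * (W b ξ * ∏ t ∈ K with b < t, g₂ t ((ξ d).1 t)))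
      ((hind (hanti _)).mul (((hW b).mono (pastOutside_anti (by simp) b) le_rfl).mul
        (hprodm hg₂ d b fun t => measurable_pastOutside_of_notMem (by simpa using hcd.symm) t b)))
      (C := 1 * (C * M₂)) (fun ξ => by
        rw [abs_mul, abs_mul]
        have hC0 := (abs_nonneg _).trans (hC b ξ)
        exact mul_le_mul (hind1 ξ) (mul_le_mul (hC b ξ) (hF₂ b _) (abs_nonneg _) hC0)
          (by positivity) zero_le_one)
    -- Path c now enters only through its value at time b, so the future of path d can be integrated
    -- out in turn.
    have k₂ := X.integral_mul_eq_of_pathPast x d b (hint₁ hg₂ (x d)).1 (hint₂ hV₂ (x d)).1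
      (hint₁ hg₂ (x d)).2 (hint₂ hV₂ (x d)).2 (fun B' hB' => hV₂.setIntegral _ b B' hB')
      (W := fun ξ => (B \ A).indicator 1 ξ * (W b ξ * V₁ b ((ξ c).1 b)))
      ((hind (hanti _)).mul (((hW b).mono (pastOutside_anti (by simp) b) le_rfl).mul
        ((hV₁.isConstAddZeroAtInfty b).measurable.comp (measurable_pastOutside_eval _ le_rfl c))))
      (C := 1 * (C * M₁)) (fun ξ => by
        rw [abs_mul, abs_mul]
        have hC0 := (abs_nonneg _).trans (hC b ξ)
        exact mul_le_mul (hind1 ξ) (mul_le_mul (hC b ξ) (hM₁ b _) (abs_nonneg _) hC0)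
          (by positivity) zero_le_one)
    have hmul (F : (ι → CadlagPath E) → ℝ) (ξ) :
        (B \ A).indicator F ξ = (B \ A).indicator 1 ξ * F ξ := by
      by_cases h : ξ ∈ B \ A <;> simp [h]
    refine (integral_congr_ae (ae_of_all _ fun ξ => ?_)).trans (k₁.trans
      ((integral_congr_ae (ae_of_all _ fun ξ => ?_)).trans
        (k₂.trans (integral_congr_ae (ae_of_all _ fun ξ => ?_)))))
    · exact (hmul _ ξ).trans (by ring)
    · ring
    · refine Eq.trans ?_ (hmul _ ξ).symm
      ring

end Swap

section SwapLaw

variable {E : Type*} [TopologicalSpace E] [LocallyCompactSpace E] [SecondCountableTopology E]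
  [T2Space E] [MeasurableSpace E] [BorelSpace E] {ι : Type*}

open Classical in
/-- The law of a family of càdlàg paths is determined by the integrals of finite products of
functions of the values of the paths. -/
theorem measure_ext_of_integral_prod {μ ν : Measure (ι → CadlagPath E)} [IsProbabilityMeasure μ]
    [IsProbabilityMeasure ν] (I₀ : Finset ι)
    (h : ∀ (I : Finset ι) (K : Finset ℝ≥0) (g : ι → ℝ≥0 → E → ℝ), I₀ ⊆ I →
      (∀ i t, IsConstAddZeroAtInfty (g i t)) →
      ∫ ξ, ∏ i ∈ I, ∏ t ∈ K, g i t ((ξ i).1 t) ∂μ = ∫ ξ, ∏ i ∈ I, ∏ t ∈ K, g i t ((ξ i).1 t) ∂ν) :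
    μ = ν := by
  let C : Set (Set (ι → CadlagPath E)) := {A | ∃ (I : Finset ι) (K : Finset ℝ≥0)
    (U : ι → ℝ≥0 → Set E), I₀ ⊆ I ∧ (∀ i t, IsOpen (U i t)) ∧
      A = {ξ | ∀ i ∈ I, ∀ t ∈ K, (ξ i).1 t ∈ U i t}}
  have hCm : ∀ A ∈ C, MeasurableSet A := by
    rintro A ⟨I, K, U, -, hU, rfl⟩
    simp only [Set.ofPred_forall]
    exact Finset.measurableSet_biInter _ fun i _ => Finset.measurableSet_biInter _ fun t _ =>
      measurable_eval i t (hU i t).measurableSet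
  have hgen : (inferInstance : MeasurableSpace (ι → CadlagPath E)) =
      MeasurableSpace.generateFrom C := by
    refine le_antisymm ?_ (MeasurableSpace.generateFrom_le hCm)
    suffices hid : Measurable[MeasurableSpace.generateFrom C] (id : (ι → CadlagPath E) → _) by
      intro A hA
      exact hid hA
    suffices hev : ∀ i t, Measurable[MeasurableSpace.generateFrom C]
        fun ξ : ι → CadlagPath E => (ξ i).1 t by
      refine (@measurable_pi_iff _ _ _ (MeasurableSpace.generateFrom C) _ _).2 fun i =>
        (@measurable_comap_iff _ _ _ (MeasurableSpace.generateFrom C) _ _ _).2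
          ((@measurable_pi_iff _ _ _ (MeasurableSpace.generateFrom C) _ _).2 fun t => ?_)
      exact hev i t
    intro i t
    refine @measurable_of_isOpen _ _ _ _ _ (MeasurableSpace.generateFrom C) _ fun U hU => ?_
    refine MeasurableSpace.measurableSet_generateFrom
        -- Labels other than i carry the whole space, so requiring I₀ ⊆ I costs nothing.
        ⟨insert i I₀, {t}, fun j _ => if j = i then U else Set.univ, Finset.subset_insert _ _,
          fun j _ => ?_, ?_⟩
    · dsimp only
      split_ifs
      exacts [hU, isOpen_univ]
    · ext ξ
      constructor
      · intro hξ j _ s hs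
        dsimp only
        split_ifs with hj
        · subst hj
          rw [Finset.mem_singleton.1 hs]
          exact hξ
        · trivial
      · intro hξ
        simpa using hξ i (Finset.mem_insert_self _ _) t (Finset.mem_singleton_self t)
  have hpi : IsPiSystem C := by
    rintro _ ⟨I, K, U, hI, hU, rfl⟩ _ ⟨I', K', U', hI', hU', rfl⟩ -
    refine ⟨I ∪ I', K ∪ K', fun i t => (if i ∈ I ∧ t ∈ K then U i t else Set.univ) ∩
      (if i ∈ I' ∧ t ∈ K' then U' i t else Set.univ), hI.trans Finset.subset_union_left,
      fun i t => IsOpen.inter ?_ ?_, ?_⟩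
    · split_ifs
      exacts [hU i t, isOpen_univ]
    · split_ifs
      exacts [hU' i t, isOpen_univ]
    · ext ξ
      constructor
      · rintro ⟨h1, h2⟩ i _ t _
        refine ⟨?_, ?_⟩
        · split_ifs with hit
          exacts [h1 i hit.1 t hit.2, trivial]
        · split_ifs with hit
          exacts [h2 i hit.1 t hit.2, trivial]
      · intro h0
        refine ⟨fun i hi t ht => ?_, fun i hi t ht => ?_⟩
        · simpa [hi, ht] using (h0 i (Finset.mem_union_left _ hi) t (Finset.mem_union_left _ ht)).1
        · simpa [hi, ht] using
            (h0 i (Finset.mem_union_right _ hi) t (Finset.mem_union_right _ ht)).2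
  refine ext_of_generate_finite C hgen hpi ?_ (by simp)
  rintro A ⟨I, K, U, hI, hU, rfl⟩
  choose f hf hf1 hft using fun i t => (hU i t).exists_seq_tendsto_indicator
  have key (ρ : Measure (ι → CadlagPath E)) [IsProbabilityMeasure ρ] :
      Tendsto (fun n => ∫ ξ, ∏ i ∈ I, ∏ t ∈ K, f i t n ((ξ i).1 t) ∂ρ) atTop
        (𝓝 (ρ.real {ξ | ∀ i ∈ I, ∀ t ∈ K, (ξ i).1 t ∈ U i t})) := by
    rw [← integral_indicator_one (hCm _ ⟨I, K, U, hI, hU, rfl⟩)]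
    refine tendsto_integral_of_dominated_convergence (fun _ => 1) (fun n => ?_)
      (integrable_const _) (fun n => ae_of_all _ fun ξ => ?_) (ae_of_all _ fun ξ => ?_)
    · exact (Finset.measurable_fun_prod _ fun i _ => Finset.measurable_fun_prod _ fun t _ =>
        (hf i t n).measurable.comp (measurable_eval i t)).aestronglyMeasurable
    · rw [Real.norm_eq_abs, Finset.abs_prod]
      refine Finset.prod_le_one (fun _ _ => abs_nonneg _) fun i _ => ?_
      rw [Finset.abs_prod]
      exact Finset.prod_le_one (fun _ _ => abs_nonneg _) fun t _ => hf1 i t n _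
    · have : Set.indicator {ξ : ι → CadlagPath E | ∀ i ∈ I, ∀ t ∈ K, (ξ i).1 t ∈ U i t}
          (1 : (ι → CadlagPath E) → ℝ) ξ =
          ∏ i ∈ I, ∏ t ∈ K, (U i t).indicator (1 : E → ℝ) ((ξ i).1 t) := by
        by_cases hξ : ∀ i ∈ I, ∀ t ∈ K, (ξ i).1 t ∈ U i t
        · rw [Set.indicator_of_mem (by exact hξ)]
          exact (Finset.prod_eq_one fun i hi => Finset.prod_eq_one fun t ht => by
            simp [hξ i hi t ht]).symm
        · rw [Set.indicator_of_notMem (by exact hξ)]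
          push Not at hξ
          obtain ⟨i, hi, t, ht, hit⟩ := hξ
          exact (Finset.prod_eq_zero hi (Finset.prod_eq_zero ht (by simp [hit]))).symm
      rw [this]
      exact tendsto_finsetProd _ fun i _ => tendsto_finsetProd _ fun t _ => hft i t _
  have := tendsto_nhds_unique (key μ) ((key ν).congr fun n => (h I K _ hI fun i t => hf i t n).symm)
  exact (measureReal_eq_measureReal_iff).1 this

open Classical in
/-- Interchanging two paths after an optional time at which they meet does not change the law. -/
theorem FellerProcess.map_swapTails (X : FellerProcess E) (x : ι → E) {a b : ι} (hab : a ≠ b)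
    {R : (ι → CadlagPath E) → ℝ≥0∞} (hRm : Measurable R)
    (hR : ∀ q : ℝ≥0, ∃ A, MeasurableSet[pastOutside E Set.univ q] A ∧
      {ξ | R ξ < q} =ᵐ[X.indepLaw x] A)
    (hmeet : ∀ᵐ ξ ∂(X.indepLaw x), R ξ < ⊤ →
      (ξ a).1 (R ξ).toNNReal = (ξ b).1 (R ξ).toNNReal) :
    Measure.map (fun ξ => swapTails a b (R ξ) ξ) (X.indepLaw x) = X.indepLaw x := by
  have hΦ := measurable_swapTails a b hRm
  have : IsProbabilityMeasure (Measure.map (fun ξ => swapTails a b (R ξ) ξ) (X.indepLaw x)) :=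
    Measure.isProbabilityMeasure_map hΦ.aemeasurable
  refine measure_ext_of_integral_prod {a, b} fun I K g hI hg => ?_
  have ha : a ∈ I := hI (by simp)
  have hb : b ∈ I.erase a := Finset.mem_erase.2 ⟨hab.symm, hI (by simp)⟩
  choose D hD0 hD using fun i => exists_prod_bound K (hg i)
  have hFm : Measurable fun ξ : ι → CadlagPath E => ∏ i ∈ I, ∏ t ∈ K, g i t ((ξ i).1 t) :=
    Finset.measurable_fun_prod _ fun i _ => Finset.measurable_fun_prod _ fun t _ =>
        (hg i t).measurable.comp (measurable_eval i t)
  have hFi (Ψ : (ι → CadlagPath E) → ι → CadlagPath E) (hΨ : Measurable Ψ) :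
      Integrable (fun ξ => ∏ i ∈ I, ∏ t ∈ K, g i t ((Ψ ξ i).1 t)) (X.indepLaw x) := by
    refine Integrable.of_bound (hFm.comp hΨ).aestronglyMeasurable (∏ i ∈ I, D i)
      (ae_of_all _ fun ξ => ?_)
    rw [Real.norm_eq_abs, Finset.abs_prod]
    exact Finset.prod_le_prod (fun _ _ => abs_nonneg _) fun i _ => hD i K subset_rfl _
  rw [integral_map hΦ.aemeasurable hFm.aestronglyMeasurable]
  have hS : MeasurableSet {ξ | R ξ < ⊤} := measurableSet_lt hRm measurable_const
  have hFi' : Integrable (fun ξ : ι → CadlagPath E => ∏ i ∈ I, ∏ t ∈ K, g i t ((ξ i).1 t))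
      (X.indepLaw x) := hFi _ measurable_id
  rw [← integral_add_compl hS (hFi _ hΦ), ← integral_add_compl hS hFi']
  congr 1
  swap
  · refine setIntegral_congr_fun hS.compl fun ξ hξ => ?_
    have : R ξ = ⊤ := by simpa using hξ
    simp only [this, swapTails_top]
  obtain ⟨V₁, h₁⟩ := X.exists_future K (hg a)
  obtain ⟨V₂, h₂⟩ := X.exists_future K (hg b)
  have hV₁ : X.IsFuture K (g a) V₁ := ⟨h₁.1, h₁.2.1, h₁.2.2.1, h₁.2.2.2⟩
  have hV₂ : X.IsFuture K (g b) V₂ := ⟨h₂.1, h₂.2.1, h₂.2.2.1, h₂.2.2.2⟩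
  -- The part that the interchange at time q leaves alone: all other paths in full, and the paths a
  -- and b at times up to q.
  let W : ℝ≥0 → (ι → CadlagPath E) → ℝ := fun q ξ =>
    (∏ i ∈ (I.erase a).erase b, ∏ t ∈ K, g i t ((ξ i).1 t)) *
      ((∏ t ∈ K with ¬ q < t, g a t ((ξ a).1 t)) * ∏ t ∈ K with ¬ q < t, g b t ((ξ b).1 t))
  have hWm (q : ℝ≥0) : Measurable[pastOutside E {a, b} q] (W q) := by
    refine Measurable.mul ?_ (Measurable.mul ?_ ?_)
    · refine Finset.measurable_fun_prod _ fun i hi => Finset.measurable_fun_prod _ fun t _ =>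
        (hg i t).measurable.comp (measurable_pastOutside_of_notMem ?_ t q)
      simp only [Finset.mem_erase] at hi
      simp [hi.1, hi.2.1]
    · exact Finset.measurable_fun_prod _ fun t ht => (hg a t).measurable.comp
        (measurable_pastOutside_eval _ (not_lt.1 (Finset.mem_filter.1 ht).2) a)
    · exact Finset.measurable_fun_prod _ fun t ht => (hg b t).measurable.comp
        (measurable_pastOutside_eval _ (not_lt.1 (Finset.mem_filter.1 ht).2) b)
  have hWb (q : ℝ≥0) (ξ) : |W q ξ| ≤ (∏ i ∈ (I.erase a).erase b, D i) * (D a * D b) := by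
    rw [abs_mul, abs_mul, Finset.abs_prod]
    refine mul_le_mul (Finset.prod_le_prod (fun _ _ => abs_nonneg _) fun i _ =>
      hD i _ subset_rfl _) (mul_le_mul (hD a _ (Finset.filter_subset _ _) _)
        (hD b _ (Finset.filter_subset _ _) _) (abs_nonneg _) (hD0 a)) (by positivity)
        (Finset.prod_nonneg fun i _ => hD0 i)
  have hWc (ξ q) : ContinuousWithinAt (fun q => W q ξ) (Set.Ici q) q :=
    continuousWithinAt_const.mul ((continuousWithinAt_prod_filter_not_lt _ _ _).mul
      (continuousWithinAt_prod_filter_not_lt _ _ _))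
  have e₁ := X.setIntegral_future x hab hR (hg a) (hg b) hV₁ hV₂ hWm hWb hWc
  have e₂ := X.setIntegral_future x hab.symm hR (hg a) (hg b) hV₁ hV₂
    (fun q => by rw [Set.pair_comm]; exact hWm q) hWb hWc
  have hsplit (u : ι → ℝ) : ∏ i ∈ I, u i = (∏ i ∈ (I.erase a).erase b, u i) * (u a * u b) := by
    rw [← Finset.mul_prod_erase I u ha, ← Finset.mul_prod_erase _ u hb]
    ring
  have hsplit' (q : ℝ≥0) (u : ℝ≥0 → ℝ) :
      ∏ t ∈ K, u t = (∏ t ∈ K with ¬ q < t, u t) * ∏ t ∈ K with q < t, u t := by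
    rw [mul_comm, Finset.prod_filter_mul_prod_filter_not]
  have hleft : ∫ ξ in {ξ | R ξ < ⊤}, ∏ i ∈ I, ∏ t ∈ K, g i t ((swapTails a b (R ξ) ξ i).1 t)
      ∂(X.indepLaw x) = ∫ ξ in {ξ | R ξ < ⊤}, W (R ξ).toNNReal ξ *
        ((∏ t ∈ K with (R ξ).toNNReal < t, g a t ((ξ b).1 t)) *
          ∏ t ∈ K with (R ξ).toNNReal < t, g b t ((ξ a).1 t)) ∂(X.indepLaw x) := by
    refine setIntegral_congr_ae hS (hmeet.mono fun ξ hξ hr => ?_)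
    specialize hξ hr
    have hcoe : R ξ = (R ξ).toNNReal := (ENNReal.coe_toNNReal hr.ne).symm
    generalize (R ξ).toNNReal = q at hξ hcoe
    have hspl (c d : ι) (hcd : (ξ c).1 q = (ξ d).1 q) (u : ℝ≥0 → E → ℝ) :
        ∏ t ∈ K, u t (splice (R ξ) (ξ c).1 (ξ d).1 t) =
          (∏ t ∈ K with ¬ q < t, u t ((ξ c).1 t)) * ∏ t ∈ K with q < t, u t ((ξ d).1 t) := by
      rw [hsplit' q]
      congr 1
      · refine Finset.prod_congr rfl fun t ht => ?_
        rcases (not_lt.1 (Finset.mem_filter.1 ht).2).lt_or_eq with h1 | h1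
        · rw [hcoe, splice_of_lt (ENNReal.coe_lt_coe.2 h1)]
        -- At t = q the spliced path already follows the other path; the two values agree because
        -- the paths meet there.
        · rw [hcoe, h1, splice_of_le le_rfl, hcd]
      · refine Finset.prod_congr rfl fun t ht => ?_
        rw [hcoe, splice_of_le (ENNReal.coe_le_coe.2 (Finset.mem_filter.1 ht).2.le)]
    rw [hsplit, swapTails_left, swapTails_right hab, hspl a b hξ, hspl b a hξ.symm]
    rw [Finset.prod_congr rfl fun i hi => by
      rw [swapTails_of_ne (Finset.mem_erase.1 (Finset.mem_erase.1 hi).2).1 (Finset.mem_erase.1 hi).1]]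
    ring
  have hright : ∫ ξ in {ξ | R ξ < ⊤}, ∏ i ∈ I, ∏ t ∈ K, g i t ((ξ i).1 t)
      ∂(X.indepLaw x) = ∫ ξ in {ξ | R ξ < ⊤}, W (R ξ).toNNReal ξ *
        ((∏ t ∈ K with (R ξ).toNNReal < t, g a t ((ξ a).1 t)) *
          ∏ t ∈ K with (R ξ).toNNReal < t, g b t ((ξ b).1 t)) ∂(X.indepLaw x) := by
    refine setIntegral_congr_fun hS fun ξ _ => ?_
    rw [hsplit, hsplit' (R ξ).toNNReal (fun t => g a t ((ξ a).1 t)),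
      hsplit' (R ξ).toNNReal (fun t => g b t ((ξ b).1 t))]
    ring
  -- After taking conditional expectations the two sides differ only in which of the two paths is
  -- evaluated at R, and there the paths coincide.
  refine hleft.trans (e₂.trans (Eq.trans ?_ (e₁.symm.trans hright.symm)))
  refine setIntegral_congr_ae hS (hmeet.mono fun ξ hξ hr => ?_)
  rw [hξ hr]

end SwapLaw

/-! ### Interchanging neighbouring priorities -/

section Interchange

variable {E : Type*} {ι : Type*}

/-- The paths `a` and `b` are at the same position at time `t`, and none of the two has been hit by
the particles with labels in `l`. -/
def MeetAlive (ξ : ι → ℝ≥0 → E) (l : List ι) (a b : ι) (t : ℝ≥0) : Prop :=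
  ξ a t = ξ b t ∧ ¬ HitBy ξ l a t ∧ ¬ HitBy ξ l b t

theorem meetAlive_comm (ξ : ι → ℝ≥0 → E) (l : List ι) (a b : ι) (t : ℝ≥0) :
    MeetAlive ξ l a b t ↔ MeetAlive ξ l b a t :=
  ⟨fun h => ⟨h.1.symm, h.2.2, h.2.1⟩, fun h => ⟨h.1.symm, h.2.2, h.2.1⟩⟩

/-- If b is not hit by l, it can be hit only by a, at a time when both have escaped l. This event is
symmetric in a and b, which makes the interchange possible. -/
theorem hitBy_cons_iff (ξ : ι → ℝ≥0 → E) (l : List ι) (a b : ι) (t : ℝ≥0) :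
    HitBy ξ (a :: l) b t ↔ HitBy ξ l b t ∨ ∃ s ≤ t, MeetAlive ξ l a b s := by
  constructor
  · rintro ⟨s, hs, h⟩
    by_cases hB : HitBy ξ l b t
    · exact Or.inl hB
    · rw [occupied_cons] at h
      rcases h with h | ⟨h, hA⟩
      · exact Or.inl ⟨s, hs, h⟩
      · exact Or.inr ⟨s, hs, h.symm, hA, fun h' => hB (h'.mono hs)⟩
  · rintro (⟨s, hs, h⟩ | ⟨s, hs, h, hA, -⟩)
    · exact ⟨s, hs, occupied_subset_cons _ _ _ _ h⟩
    · exact ⟨s, hs, by rw [occupied_cons]; exact Or.inr ⟨h.symm, hA⟩⟩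

theorem occupied_cons_cons (ξ : ι → ℝ≥0 → E) (l : List ι) (a b : ι) (t : ℝ≥0) :
    occupied ξ (b :: a :: l) t = occupied ξ l t ∪ {z | z = ξ a t ∧ ¬ HitBy ξ l a t} ∪
      {z | z = ξ b t ∧ ¬ HitBy ξ l b t ∧ ¬ ∃ s ≤ t, MeetAlive ξ l a b s} := by
  rw [occupied_cons, occupied_cons]
  simp only [hitBy_cons_iff, not_or]

/-- If the paths `a` and `b` are interchanged after their first meeting as living particles, then
their priorities may be interchanged as well. -/
theorem occupied_interchange {ξ ξ' : ι → ℝ≥0 → E} {l : List ι} {a b : ι} {r : ℝ≥0}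
    (hl : ∀ i ∈ l, ξ' i = ξ i) (hr : IsLeast {t | MeetAlive ξ l a b t} r)
    (ha : ∀ t < r, ξ' a t = ξ a t) (hb : ∀ t < r, ξ' b t = ξ b t)
    (ha' : ∀ t, r ≤ t → ξ' a t = ξ b t) (hb' : ∀ t, r ≤ t → ξ' b t = ξ a t) (t : ℝ≥0) :
    occupied ξ' (a :: b :: l) t = occupied ξ (b :: a :: l) t := by
  have hS (t) : occupied ξ' l t = occupied ξ l t :=
    occupied_congr fun i hi s _ => congrFun (hl i hi) s
  obtain ⟨hmeet, hAr, hBr⟩ := hr.1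
  have hbefore {c : ι} (hc : ∀ t < r, ξ' c t = ξ c t) {t} (ht : t < r) :
      HitBy ξ' l c t ↔ HitBy ξ l c t := by
    refine exists_congr fun s => and_congr_right fun hs => ?_
    rw [hS, hc s (hs.trans_lt ht)]
  -- Neither path is hit by l up to r, so every hit occurs after r, where the new path c is the old
  -- path d.
  have hafter {c d : ι} (hc : ∀ t < r, ξ' c t = ξ c t) (hd : ∀ t, r ≤ t → ξ' c t = ξ d t)
      (hcr : ¬ HitBy ξ l c r) (hdr : ¬ HitBy ξ l d r) (t : ℝ≥0) :
      HitBy ξ' l c t ↔ HitBy ξ' l c t ∧ HitBy ξ l d t ∨ HitBy ξ l d t ∧ r ≤ t := by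
    constructor
    · rintro ⟨s, hs, h⟩
      rw [hS] at h
      rcases lt_or_ge s r with hsr | hsr
      · exact absurd ⟨s, hsr.le, hc s hsr ▸ h⟩ hcr
      · exact Or.inr ⟨⟨s, hs, hd s hsr ▸ h⟩, hsr.trans hs⟩
    · rintro (h | ⟨⟨s, hs, h⟩, -⟩)
      · exact h.1
      · rcases le_total s r with hsr | hsr
        · exact absurd ⟨s, hsr, h⟩ hdr
        · exact ⟨s, hs, by rw [hS, hd s hsr]; exact h⟩
  have hafter' {c d : ι} (hc : ∀ t < r, ξ' c t = ξ c t) (hd : ∀ t, r ≤ t → ξ' c t = ξ d t)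
      (hcr : ¬ HitBy ξ l c r) (hdr : ¬ HitBy ξ l d r) {t : ℝ≥0} (ht : r ≤ t) :
      HitBy ξ' l c t ↔ HitBy ξ l d t := by
    have := hafter hc hd hcr hdr t
    tauto
  rw [occupied_cons_cons, occupied_cons_cons, hS]
  rcases lt_or_ge t r with ht | ht
  -- Before r nothing has been interchanged and the two particles have not yet acted on each other,
  -- so their order is irrelevant.
  · have h1 : ¬ ∃ s ≤ t, MeetAlive ξ l a b s := by
      rintro ⟨s, hs, h⟩
      exact (hr.2 h).not_gt (hs.trans_lt ht)
    have h2 : ¬ ∃ s ≤ t, MeetAlive ξ' l b a s := by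
      rintro ⟨s, hs, h⟩
      have hsr := hs.trans_lt ht
      rw [MeetAlive, hbefore ha hsr, hbefore hb hsr, ha s hsr, hb s hsr] at h
      exact h1 ⟨s, hs, h.1.symm, h.2.2, h.2.1⟩
    rw [hbefore ha ht, hbefore hb ht, ha t ht, hb t ht]
    simp only [h1, h2, not_false_eq_true, and_true]
    exact Set.union_right_comm _ _ _
  -- From r on, only the particle of higher priority can survive: a in the old system, b in the new
  -- one. The new path b is the old path a.
  · have h1 : ∃ s ≤ t, MeetAlive ξ l a b s := ⟨r, ht, hr.1⟩
    have h2 : ∃ s ≤ t, MeetAlive ξ' l b a s := by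
      refine ⟨r, ht, ?_⟩
      rw [MeetAlive, hafter' ha ha' hAr hBr le_rfl, hafter' hb hb' hBr hAr le_rfl, ha' r le_rfl,
        hb' r le_rfl]
      exact ⟨hmeet, hAr, hBr⟩
    rw [hafter' ha ha' hAr hBr ht, hafter' hb hb' hBr hAr ht, ha' t ht, hb' t ht]
    simp [h1, h2]

theorem occupied_cons_cons_comm {ξ : ι → ℝ≥0 → E} {l : List ι} {a b : ι}
    (h : ∀ t, ¬ MeetAlive ξ l a b t) (t : ℝ≥0) :
    occupied ξ (a :: b :: l) t = occupied ξ (b :: a :: l) t := by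
  rw [occupied_cons_cons, occupied_cons_cons]
  simp only [meetAlive_comm ξ l b a, h, and_false, exists_false, not_false_eq_true, and_true]
  exact Set.union_right_comm _ _ _

/-- The first time at which the paths `a` and `b` meet as living particles. -/
noncomputable def swapTime (l : List ι) (a b : ι) (ξ : ι → ℝ≥0 → E) : ℝ≥0∞ :=
  ⨅ (t : ℝ≥0) (_ : MeetAlive ξ l a b t), (t : ℝ≥0∞)

variable [TopologicalSpace E] [T2Space E]

theorem isLeast_swapTime {l : List ι} {a b : ι} {ξ : ι → ℝ≥0 → E}
    (hξ : ∀ i t, ContinuousWithinAt (ξ i) (Set.Ici t) t) (h : swapTime l a b ξ < ⊤) :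
    IsLeast {t | MeetAlive ξ l a b t} (swapTime l a b ξ).toNNReal := by
  obtain ⟨r, hr⟩ := exists_isLeast_of_not_rightOpen (p := MeetAlive ξ l a b) (fun s hs => by
    rw [MeetAlive, not_and_or, not_and_or, not_not, not_not] at hs
    rcases hs with hs | hs | hs
    · exact (eventually_ne_of_rightContinuous (hξ a) (hξ b) s hs).mono fun r hr h => hr h.1
    · filter_upwards [self_mem_nhdsWithin] with r hr h using h.2.1 (hs.mono hr)
    · filter_upwards [self_mem_nhdsWithin] with r hr h using h.2.2 (hs.mono hr)) (by
    by_contra hno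
    exact h.ne (iInf₂_eq_top.2 fun t ht => absurd ⟨t, ht⟩ hno))
  have : swapTime l a b ξ = r := le_antisymm (iInf₂_le r hr.1)
    (le_iInf₂ fun t ht => ENNReal.coe_le_coe.2 (hr.2 ht))
  rw [this]
  exact hr

theorem occupied_swapTails {l : List ι} {a b : ι} (hab : a ≠ b) (ha : a ∉ l) (hb : b ∉ l)
    (ξ : ι → CadlagPath E) (t : ℝ≥0) :
    occupied (fun i => (swapTails a b (swapTime l a b fun i => (ξ i).1) ξ i).1) (a :: b :: l) t =
      occupied (fun i => (ξ i).1) (b :: a :: l) t := by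
  by_cases h : swapTime l a b (fun i => (ξ i).1) < ⊤
  · have hr := isLeast_swapTime (fun i => (ξ i).2.rightContinuous) h
    have hcoe := (ENNReal.coe_toNNReal h.ne).symm
    generalize (swapTime l a b fun i => (ξ i).1).toNNReal = r at hr hcoe
    rw [hcoe]
    refine occupied_interchange (fun i hi => ?_) hr (fun t ht => ?_) (fun t ht => ?_)
      (fun t ht => ?_) (fun t ht => ?_) t
    · rw [swapTails_of_ne (ne_of_mem_of_not_mem hi ha) (ne_of_mem_of_not_mem hi hb)]
    · rw [swapTails_left, splice_of_lt (ENNReal.coe_lt_coe.2 ht)]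
    · rw [swapTails_right hab, splice_of_lt (ENNReal.coe_lt_coe.2 ht)]
    · rw [swapTails_left, splice_of_le (ENNReal.coe_le_coe.2 ht)]
    · rw [swapTails_right hab, splice_of_le (ENNReal.coe_le_coe.2 ht)]
  · have h' := not_lt_top_iff.1 h
    rw [h', swapTails_top]
    refine occupied_cons_cons_comm (fun t ht => ?_) t
    exact ENNReal.coe_ne_top ((iInf₂_eq_top.1 h') t ht)

end Interchange

/-! ### Exchangeability of priorities -/

section Permutation

variable {E : Type*} [TopologicalSpace E] [LocallyCompactSpace E] [SecondCountableTopology E]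
  [T2Space E] [MeasurableSpace E] [BorelSpace E] {ι : Type*}

/-- A meeting of living particles before q is recognised at a dense time before q: by then they have
met, and neither has been hit by l. -/
theorem measurableSet_swapTime_lt (l : List ι) (a b : ι) (q : ℝ≥0) :
    MeasurableSet[regularPast E ι q]
      {ξ : ι → CadlagPath E | swapTime l a b (fun i => (ξ i).1) < q} := by
  have : {ξ : ι → CadlagPath E | swapTime l a b (fun i => (ξ i).1) < q} =
      ⋃ n ∈ {n | TopologicalSpace.denseSeq ℝ≥0 n < q},
        {ξ | ∃ s ≤ TopologicalSpace.denseSeq ℝ≥0 n, (ξ a).1 s = (ξ b).1 s} ∩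
          ({ξ | HitBy (fun i => (ξ i).1) l a (TopologicalSpace.denseSeq ℝ≥0 n)}ᶜ ∩
            {ξ | HitBy (fun i => (ξ i).1) l b (TopologicalSpace.denseSeq ℝ≥0 n)}ᶜ) := by
    ext ξ
    simp only [Set.mem_ofPred_eq, Set.mem_iUnion, Set.mem_inter_iff, Set.mem_compl_iff,
      exists_prop, swapTime, iInf_lt_iff, ENNReal.coe_lt_coe]
    constructor
    · rintro ⟨s, ⟨h, hA, hB⟩, hs⟩
      have hξ (i) := (ξ i).2.rightContinuous
      obtain ⟨n, h1, h2, h3⟩ := exists_denseSeq_of_rightOpen hs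
        ((eventually_not_hitBy hξ l a s hA).and (eventually_not_hitBy hξ l b s hB))
      exact ⟨n, h2, ⟨s, h1.le, h⟩, h3⟩
    · rintro ⟨n, hn, ⟨s, hs, h⟩, hA, hB⟩
      exact ⟨s, ⟨h, fun h' => hA (h'.mono hs), fun h' => hB (h'.mono hs)⟩, hs.trans_lt hn⟩
  rw [this]
  refine MeasurableSet.biUnion (Set.to_countable _) fun n hn => ?_
  have hn' : TopologicalSpace.denseSeq ℝ≥0 n ≤ q := le_of_lt hn
  exact (regularPast_mono hn' _ (measurableSet_meet a b _)).inter
    ((regularPast_mono hn' _ (measurableSet_hitBy l a _)).compl.inter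
      (regularPast_mono hn' _ (measurableSet_hitBy l b _)).compl)

variable [Countable ι] (X : FellerProcess E) (x : ι → E)

theorem FellerProcess.aemeasurable_swapTime (l : List ι) (a b : ι) :
    AEMeasurable (fun ξ : ι → CadlagPath E => swapTime l a b fun i => (ξ i).1)
      (X.indepLaw x) := by
  refine NullMeasurable.aemeasurable ?_
  refine measurable_of_Iio fun c => ?_
  have hfin (q : ℝ≥0) := X.nullMeasurableSet_of_regularPast x (measurableSet_swapTime_lt l a b q)
  induction c with
  | coe q => exact hfin q
  | top =>
    have : (fun ξ : ι → CadlagPath E => swapTime l a b fun i => (ξ i).1) ⁻¹' Set.Iio ⊤ =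
        ⋃ n : ℕ, {ξ | swapTime l a b (fun i => (ξ i).1) < ((n : ℝ≥0) : ℝ≥0∞)} := by
      ext ξ
      simp only [Set.mem_preimage, Set.mem_Iio, Set.mem_iUnion, Set.mem_ofPred_eq]
      refine ⟨fun h => ?_, fun ⟨n, hn⟩ => hn.trans ENNReal.coe_lt_top⟩
      obtain ⟨n, hn⟩ := ENNReal.exists_nat_gt h.ne
      exact ⟨n, by simpa using hn⟩
    exact (NullMeasurableSet.iUnion fun n : ℕ => hfin n).congr (Eq.eventuallyEq this.symm)

/-- The interchange is made at a measurable version of the swap time, so that it is a measurable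
map; the statement on occupied sets then holds almost surely. -/
theorem FellerProcess.exists_measurePreserving_swap {l : List ι} {a b : ι} (hab : a ≠ b)
    (ha : a ∉ l) (hb : b ∉ l) :
    ∃ Φ : (ι → CadlagPath E) → ι → CadlagPath E,
      MeasurePreserving Φ (X.indepLaw x) (X.indepLaw x) ∧
      (∀ ξ, ∀ i ∉ b :: a :: l, Φ ξ i = ξ i) ∧
      ∀ᵐ ξ ∂(X.indepLaw x), ∀ t, occupied (fun i => (Φ ξ i).1) (a :: b :: l) t =
        occupied (fun i => (ξ i).1) (b :: a :: l) t := by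
  have hR := X.aemeasurable_swapTime x l a b
  refine ⟨fun ξ => swapTails a b (hR.mk _ ξ) ξ, ⟨measurable_swapTails a b hR.measurable_mk,
    X.map_swapTails x hab hR.measurable_mk (fun q => ?_) ?_⟩, fun ξ i hi => ?_, ?_⟩
  · obtain ⟨A, hA, hRA⟩ := measurableSet_swapTime_lt (E := E) l a b q
    refine ⟨A, hA, EventuallyEq.trans ?_ (hRA.filter_mono (le_principal_iff.2
      (X.regularVectors_mem_ae x)))⟩
    filter_upwards [hR.ae_eq_mk] with ξ hξ
    exact congrArg (· < (q : ℝ≥0∞)) hξ.symm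
  · filter_upwards [hR.ae_eq_mk] with ξ hξ hlt
    rw [← hξ] at hlt ⊢
    exact (isLeast_swapTime (fun i => (ξ i).2.rightContinuous) hlt).1.1
  · simp only [List.mem_cons, not_or] at hi
    exact swapTails_of_ne hi.2.1 hi.1 _ _
  · filter_upwards [hR.ae_eq_mk] with ξ hξ t
    rw [← hξ]
    exact occupied_swapTails hab ha hb ξ t

/-- The priorities may be permuted at the cost of a rearrangement of the paths that preserves
their law. -/
theorem FellerProcess.exists_measurePreserving_perm {l l' : List ι} (h : l.Perm l')
    (hl : l.Nodup) :
    ∃ Φ : (ι → CadlagPath E) → ι → CadlagPath E,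
      MeasurePreserving Φ (X.indepLaw x) (X.indepLaw x) ∧ (∀ ξ, ∀ i ∉ l, Φ ξ i = ξ i) ∧
      ∀ᵐ ξ ∂(X.indepLaw x), ∀ t, occupied (fun i => (Φ ξ i).1) l' t =
        occupied (fun i => (ξ i).1) l t := by
  induction h with
  | nil => exact ⟨id, .id _, fun _ _ _ => rfl, ae_of_all _ fun _ _ => rfl⟩
  -- The head has the lowest priority and its path is not moved, since the rearrangement fixes all
  -- labels outside the tail.
  | cons y h ih =>
    obtain ⟨hy, hl⟩ := List.nodup_cons.1 hl
    obtain ⟨Φ, h1, h2, h3⟩ := ih hl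
    refine ⟨Φ, h1, fun ξ i hi => h2 ξ i fun h => hi (List.mem_cons_of_mem _ h), ?_⟩
    filter_upwards [h3] with ξ hξ t
    exact congrFun (occupied_cons_congr (funext hξ) (congrArg Subtype.val (h2 ξ y hy))) t
  | swap a b l =>
    simp only [List.nodup_cons, List.mem_cons, not_or] at hl
    exact X.exists_measurePreserving_swap x (Ne.symm hl.1.1) hl.2.1 hl.1.2
  | trans h₁ h₂ ih₁ ih₂ =>
    obtain ⟨Φ, h1, h2, h3⟩ := ih₁ hl
    obtain ⟨Ψ, k1, k2, k3⟩ := ih₂ (h₁.nodup_iff.1 hl)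
    refine ⟨Ψ ∘ Φ, k1.comp h1, fun ξ i hi => ?_, ?_⟩
    · rw [Function.comp_apply, k2 _ i fun h => hi (h₁.mem_iff.2 h), h2 ξ i hi]
    · filter_upwards [h3, h1.quasiMeasurePreserving.ae k3] with ξ hξ hξ' t
      exact (hξ' t).trans (hξ t)

end Permutation

/-! ### Comparing two starting configurations -/

section Comparison

variable {E : Type*} [TopologicalSpace E] {ι : Type*}

/-- The vectors of paths for which the living particles with labels in `l` avoid the set `U t` at
each time `t ∈ K`. -/
def avoiding (K : Finset ℝ≥0) (U : ℝ≥0 → Set E) (l : List ι) : Set (ι → CadlagPath E) :=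
  {ξ | ∀ t ∈ K, Disjoint (occupied (fun i => (ξ i).1) l t) (U t)}

theorem avoiding_append_subset (K : Finset ℝ≥0) (U : ℝ≥0 → Set E) (l' l : List ι) :
    avoiding K U (l' ++ l) ⊆ avoiding K U l :=
  fun _ h t ht => (h t ht).mono_left (occupied_subset_append _ _ _ _)

variable [LocallyCompactSpace E] [SecondCountableTopology E] [T2Space E] [MeasurableSpace E]
  [BorelSpace E]

section

variable [Countable ι] (X : FellerProcess E) (x : ι → E)

theorem FellerProcess.nullMeasurableSet_avoiding (K : Finset ℝ≥0) {U : ℝ≥0 → Set E}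
    (hU : ∀ t, IsOpen (U t)) (l : List ι) :
    NullMeasurableSet (avoiding K U l) (X.indepLaw x) := by
  simp only [avoiding, Set.ofPred_forall]
  exact .biInter K.countable_toSet fun t _ => X.nullMeasurableSet_of_regularPast x
    (measurableSet_disjoint_occupied l t (hU t).measurableSet)

theorem FellerProcess.measure_avoiding_perm (K : Finset ℝ≥0) {U : ℝ≥0 → Set E}
    (hU : ∀ t, IsOpen (U t)) {l l' : List ι} (h : l.Perm l') (hl : l.Nodup) :
    X.indepLaw x (avoiding K U l) = X.indepLaw x (avoiding K U l') := by
  obtain ⟨Φ, h1, -, h3⟩ := X.exists_measurePreserving_perm x h hl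
  rw [← h1.measure_preimage (X.nullMeasurableSet_avoiding x K hU l')]
  refine measure_congr ?_
  filter_upwards [h3] with ξ hξ
  refine propext (forall₂_congr fun t _ => ?_)
  rw [← hξ t]

/-- Adding a particle at the lowest priority matters only if it fails to meet one of the other
paths early on. -/
theorem FellerProcess.measure_avoiding_le_cons (K : Finset ℝ≥0) {U : ℝ≥0 → Set E}
    (hU : ∀ t, IsOpen (U t)) {t₀ : ℝ≥0} (ht₀ : ∀ t ∈ K, t₀ ≤ t) {l : List ι} {i y : ι}
    (hi : i ∈ l) (hl : (y :: l).Nodup) :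
    X.indepLaw x (avoiding K U l) ≤ X.indepLaw x (avoiding K U (y :: l)) +
      X.indepLaw x {ξ | ∃ s ≤ t₀, (ξ y).1 s = (ξ i).1 s}ᶜ := by
  classical
  -- Last in the list, i has the highest priority and is never killed, so any meeting with its path
  -- kills y.
  have hp : l.Perm (l.erase i ++ [i]) :=
    (List.perm_cons_erase hi).trans (List.perm_append_singleton i _).symm
  rw [X.measure_avoiding_perm x K hU hp (List.nodup_cons.1 hl).2,
    X.measure_avoiding_perm x K hU (hp.cons y) hl]
  refine (measure_mono fun ξ hξ => ?_).trans (measure_union_le _ _)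
  by_cases h : ∃ s ≤ t₀, (ξ y).1 s = (ξ i).1 s
  · refine Or.inl fun t ht => ?_
    obtain ⟨s, hs, hmeet⟩ := h
    rw [occupied_cons_of_hitBy ⟨s, hs.trans (ht₀ t ht), occupied_subset_append _ _ _ _ ?_⟩]
    · exact hξ t ht
    · simpa [occupied] using hmeet
  · exact Or.inr h

theorem FellerProcess.measure_avoiding_le_append (K : Finset ℝ≥0) {U : ℝ≥0 → Set E}
    (hU : ∀ t, IsOpen (U t)) {t₀ : ℝ≥0} (ht₀ : ∀ t ∈ K, t₀ ≤ t) {ε : ℝ≥0∞} {l l' : List ι}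
    (hl : (l' ++ l).Nodup)
    (h : ∀ y ∈ l', ∃ i ∈ l, X.indepLaw x {ξ | ∃ s ≤ t₀, (ξ y).1 s = (ξ i).1 s}ᶜ ≤ ε) :
    X.indepLaw x (avoiding K U l) ≤ X.indepLaw x (avoiding K U (l' ++ l)) + l'.length * ε := by
  induction l' with
  | nil => simp
  | cons y l' ih =>
    obtain ⟨i, hi, hε⟩ := h y List.mem_cons_self
    calc _ ≤ X.indepLaw x (avoiding K U (l' ++ l)) + l'.length * ε :=
          ih (List.nodup_cons.1 hl).2 fun z hz => h z (List.mem_cons_of_mem _ hz)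
      _ ≤ (X.indepLaw x (avoiding K U (y :: (l' ++ l))) + ε) + l'.length * ε := by
          gcongr
          exact (X.measure_avoiding_le_cons x K hU ht₀ (List.mem_append_right _ hi) hl).trans
            (by gcongr)
      _ = _ := by
          rw [List.cons_append, List.length_cons]
          push_cast
          ring

theorem FellerProcess.measure_avoiding_le (K : Finset ℝ≥0) {U : ℝ≥0 → Set E}
    (hU : ∀ t, IsOpen (U t)) {t₀ : ℝ≥0} (ht₀ : ∀ t ∈ K, t₀ ≤ t) {ε : ℝ≥0∞} {l l' : List ι}
    (hl : (l' ++ l).Nodup)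
    (h : ∀ y ∈ l', ∃ i ∈ l, X.indepLaw x {ξ | ∃ s ≤ t₀, (ξ y).1 s = (ξ i).1 s}ᶜ ≤ ε) :
    X.indepLaw x (avoiding K U l) ≤ X.indepLaw x (avoiding K U l') + l'.length * ε := by
  refine (X.measure_avoiding_le_append x K hU ht₀ hl h).trans ?_
  -- With l' moved to the tail, the particles of l have lower priority and can only add occupied
  -- positions.
  rw [X.measure_avoiding_perm x K hU List.perm_append_comm hl]
  gcongr
  exact avoiding_append_subset _ _ _ _

end

section

variable (X : FellerProcess E) (x : ι → E)

omit [LocallyCompactSpace E] [SecondCountableTopology E] [T2Space E] [BorelSpace E] in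
theorem FellerProcess.ae_start [Countable ι] :
    ∀ᵐ ξ ∂(X.indepLaw x), ∀ i, (ξ i).1 0 = x i := by
  rw [ae_all_iff]
  exact fun i => (measurePreserving_eval_infinitePi (fun i => X.law (x i)) i).quasiMeasurePreserving.ae
    (X.start (x i))

omit [LocallyCompactSpace E] [SecondCountableTopology E] [T2Space E] [BorelSpace E] in
theorem FellerProcess.measurePreserving_comp {κ : Type*} {e : κ → ι} (he : e.Injective) :
    MeasurePreserving (fun (ξ : ι → CadlagPath E) k => ξ (e k)) (X.indepLaw x)
      (X.indepLaw fun k => x (e k)) :=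
  ⟨by fun_prop, Measure.map_infinitePi_infinitePi_of_inj he⟩

theorem FellerProcess.measure_avoiding_map {κ : Type*} [Countable κ] {e : κ → ι}
    (he : e.Injective) (K : Finset ℝ≥0) {U : ℝ≥0 → Set E} (hU : ∀ t, IsOpen (U t)) (l : List κ) :
    X.indepLaw x (avoiding K U (l.map e)) = X.indepLaw (fun k => x (e k)) (avoiding K U l) := by
  rw [← (X.measurePreserving_comp x he).measure_preimage
    (X.nullMeasurableSet_avoiding _ K hU _)]
  simp only [avoiding, occupied_map]
  rfl

/-- The probability that two independent paths meet is at least the outer measure of the meeting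
event under the product of their laws. -/
theorem FellerProcess.prod_law_meet_le [Countable ι] {i j : ι} (hij : i ≠ j) (c : ℝ≥0) :
    ((X.law (x i)).prod (X.law (x j))) {ω | ∃ t ≤ c, ω.1.1 t = ω.2.1 t} ≤
      X.indepLaw x {ξ | ∃ s ≤ c, (ξ i).1 s = (ξ j).1 s} := by
  let A : Set (CadlagPath E × CadlagPath E) := {ω | Approach ω.1.1 ω.2.1 c}
  -- The meeting event itself need not be measurable under the product law. The approach event that
  -- contains it is, as the case of two labels of `measurableSet_approach`.
  have hA : MeasurableSet A := by
    have hm : Measurable fun (ω : CadlagPath E × CadlagPath E) (k : Bool) => bif k then ω.1 else ω.2 :=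
      measurable_pi_lambda _ fun k => by
        cases k
        exacts [measurable_snd, measurable_fst]
    exact hm (pastOutside_le _ _ _ (measurableSet_approach true false c))
  have hmap : (X.indepLaw x).map (fun ξ => (ξ i, ξ j)) = (X.law (x i)).prod (X.law (x j)) :=
    Measure.infinitePi_map_eval_prod hij
  calc _ ≤ ((X.law (x i)).prod (X.law (x j))) A := measure_mono fun ω hω =>
        approach_of_meet ω.1.2.rightContinuous ω.2.2.rightContinuous hω
    _ = X.indepLaw x {ξ | Approach (ξ i).1 (ξ j).1 c} := by
        rw [← hmap, Measure.map_apply (by fun_prop) hA]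
        rfl
    _ ≤ _ := by
        refine measure_mono_ae ?_
        filter_upwards [X.ae_meet_of_approach x i j c] with ξ hξ using hξ

theorem FellerProcess.ImmediateHit.exists_measure_compl_meet_le [Countable ι]
    {X : FellerProcess E} (hX : X.ImmediateHit) (x : ι → E) {t₀ : ℝ≥0} (ht₀ : 0 < t₀) {ε : ℝ≥0∞}
    (hε : ε ≠ 0) (y : ι) {S : Set ι} (hy : y ∉ S) (hyS : x y ∈ closure (x '' S)) :
    ∃ i ∈ S, X.indepLaw x {ξ | ∃ s ≤ t₀, (ξ y).1 s = (ξ i).1 s}ᶜ ≤ ε := by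
  have h1 : ∀ᶠ z in 𝓝[≠] x y, 1 - ε ≤ ((X.law (x y)).prod (X.law z))
      {ω | ∃ t : ℝ≥0, t ≤ t₀ ∧ ω.1.1 t = ω.2.1 t} :=
    ((hX t₀ ht₀ (x y)).eventually (lt_mem_nhds
      (ENNReal.sub_lt_self ENNReal.one_ne_top one_ne_zero hε))).mono fun _ => le_of_lt
  rw [eventually_nhdsWithin_iff] at h1
  obtain ⟨_, hz, ⟨i, hi, rfl⟩⟩ := mem_closure_iff_nhds.1 hyS _ h1
  refine ⟨i, hi, ?_⟩
  -- The collision assumption concerns starting points other than x y; from equal starting points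
  -- the paths meet at time 0.
  by_cases hxi : x i = x y
  · refine (measure_mono_null (fun ξ hξ => ?_) (ae_iff.1 (X.ae_start x))).trans_le zero_le
    exact fun h => hξ ⟨0, zero_le, by rw [h, h, hxi]⟩
  · have hyi : y ≠ i := fun h => hy (h ▸ hi)
    rw [prob_compl_eq_one_sub₀ (X.nullMeasurableSet_of_regularPast x (measurableSet_meet y i t₀))]
    refine tsub_le_iff_tsub_le.1 ((hz hxi).trans ?_)
    exact X.prod_law_meet_le x hyi t₀

end

/-- Finite prefixes of both systems are compared on the disjoint union of the label sets. Times in K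
are positive because collisions need some time t₀ > 0. -/
theorem FellerProcess.ImmediateHit.measure_forall_avoiding_le {X : FellerProcess E}
    (hX : X.ImmediateHit) {N' N'' : ℕ∞} (x' : IndexSet N' → E) (x'' : IndexSet N'' → E)
    (h : Set.range x'' ⊆ closure (Set.range x')) {K : Finset ℝ≥0} (hK : ∀ t ∈ K, 0 < t)
    {U : ℝ≥0 → Set E} (hU : ∀ t, IsOpen (U t)) :
    X.indepLaw x' (⋂ n, avoiding K U (prefixList N' n)) ≤
      X.indepLaw x'' (⋂ n, avoiding K U (prefixList N'' n)) := by
  obtain ⟨t₀, ht₀, ht₀K⟩ : ∃ t₀ : ℝ≥0, 0 < t₀ ∧ ∀ t ∈ K, t₀ ≤ t := by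
    rcases K.eq_empty_or_nonempty with rfl | hne
    · exact ⟨1, one_pos, by simp⟩
    · exact ⟨K.min' hne, hK _ (K.min'_mem hne), fun t ht => K.min'_le t ht⟩
  have hanti : Antitone fun n => avoiding (ι := IndexSet N'') (E := E) K U (prefixList N'' n) :=
    fun m n hmn ξ hξ t ht => (hξ t ht).mono_left (occupied_prefixList_mono _ t hmn)
  rw [hanti.measure_iInter (fun n => X.nullMeasurableSet_avoiding x'' K hU _)
    ⟨0, measure_ne_top _ _⟩]
  refine le_iInf fun k => ?_
  let x : IndexSet N' ⊕ IndexSet N'' → E := Sum.elim x' x''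
  have hleft (n : ℕ) : X.indepLaw x (avoiding K U ((prefixList N' n).map Sum.inl)) =
      X.indepLaw x' (avoiding K U (prefixList N' n)) :=
    X.measure_avoiding_map x Sum.inl_injective K hU _
  have hright (n : ℕ) : X.indepLaw x (avoiding K U ((prefixList N'' n).map Sum.inr)) =
      X.indepLaw x'' (avoiding K U (prefixList N'' n)) :=
    X.measure_avoiding_map x Sum.inr_injective K hU _
  have hlen : ((prefixList N'' k).map (Sum.inr : _ → IndexSet N' ⊕ IndexSet N'')).length =
    (prefixList N'' k).length := List.length_map _
  -- The summand 1 keeps m nonzero when the prefix is empty.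
  set m : ℝ≥0∞ := ((prefixList N'' k).length : ℝ≥0∞) + 1
  refine ENNReal.le_of_forall_pos_le_add fun δ hδ _ => ?_
  set ε : ℝ≥0∞ := δ / m
  have hε : ε ≠ 0 := (ENNReal.div_pos (by simpa using hδ.ne') (by simp [m])).ne'
  have hfind (y : IndexSet N'') : ∃ i : IndexSet N',
      X.indepLaw x {ξ | ∃ s ≤ t₀, (ξ (Sum.inr y)).1 s = (ξ (Sum.inl i)).1 s}ᶜ ≤ ε := by
    obtain ⟨_, ⟨i, rfl⟩, hi⟩ := hX.exists_measure_compl_meet_le x ht₀ hε (Sum.inr y)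
      (S := Set.range Sum.inl) (by simp) (by
        rw [← Set.range_comp]
        exact h ⟨y, rfl⟩)
    exact ⟨i, hi⟩
  choose i hi using hfind
  -- A prefix of the first system long enough to contain the chosen partner of every particle of the
  -- second.
  obtain ⟨n, hn⟩ : ∃ n, ∀ y ∈ prefixList N'' k, (i y).1 ≤ n := by
    classical
    exact ⟨(prefixList N'' k).toFinset.sup fun y => (i y).1, fun y hy =>
      Finset.le_sup (f := fun y => (i y).1) (List.mem_toFinset.2 hy)⟩
  calc _ ≤ X.indepLaw x' (avoiding K U (prefixList N' n)) := measure_mono (Set.iInter_subset _ n)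
    _ = X.indepLaw x (avoiding K U ((prefixList N' n).map Sum.inl)) := (hleft n).symm
    _ ≤ X.indepLaw x (avoiding K U ((prefixList N'' k).map Sum.inr)) +
        ((prefixList N'' k).map (Sum.inr : _ → IndexSet N' ⊕ IndexSet N'')).length * ε := by
        refine X.measure_avoiding_le x K hU ht₀K ?_ fun y hy => ?_
        · refine List.Nodup.append ((nodup_prefixList k).map Sum.inr_injective)
            ((nodup_prefixList n).map Sum.inl_injective) ?_
          intro z hz hz'
          simp only [List.mem_map] at hz hz'
          obtain ⟨_, -, rfl⟩ := hz
          obtain ⟨_, -, h⟩ := hz'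
          cases h
        · obtain ⟨z, hz, rfl⟩ := List.mem_map.1 hy
          exact ⟨_, List.mem_map_of_mem (mem_prefixList.2 (hn z hz)), hi z⟩
    _ ≤ _ := by
        rw [hright, hlen]
        gcongr
        calc _ ≤ m * ε := by gcongr; exact le_self_add
          _ = δ := ENNReal.mul_div_cancel (by simp [m]) (by simp [m])

end Comparison

/-! ### The set-valued process and its law -/

section SetProcess

variable {E : Type*} [TopologicalSpace E]

theorem pointClosure_eq_of_closure_range_eq {N' N'' : ℕ∞} [NeZero N'] [NeZero N'']
    {x' : IndexSet N' → E} {x'' : IndexSet N'' → E}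
    (h : closure (Set.range x') = closure (Set.range x'')) :
    pointClosure x' = pointClosure x'' := by
  simp only [pointClosure, h]

theorem closure_range_eq_of_pointClosure_eq {N' N'' : ℕ∞} [NeZero N'] [NeZero N'']
    {x' : IndexSet N' → E} {x'' : IndexSet N'' → E} (h : pointClosure x' = pointClosure x'') :
    closure (Set.range x') = closure (Set.range x'') :=
  congrArg (fun F : NonemptyClosed E => F.carrier) h

theorem pointClosure_mem_avoid_iff {N : ℕ∞} [NeZero N] (x : IndexSet N → E) {U : Set E}
    (hU : IsOpen U) : pointClosure x ∈ NonemptyClosed.avoid U ↔ Disjoint (Set.range x) U :=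
  ⟨fun h => h.mono_left subset_closure, fun h => h.closure_left hU⟩

variable [T2Space E] {N : ℕ∞}

theorem range_collisionRule (ξ : IndexSet N → CadlagPath E) (t : ℝ≥0) :
    Set.range (fun i => collisionRule (fun j => (ξ j).1) i t) =
      ⋃ n, occupied (fun j => (ξ j).1) (prefixList N n) t := by
  ext z
  simp only [← setOf_collisionRule_eq_occupied fun i => (ξ i).2.rightContinuous,
    Set.mem_iUnion, Set.mem_ofPred_eq, Set.mem_range]
  exact ⟨fun ⟨i, hi⟩ => ⟨i.1, i, le_rfl, hi.symm⟩, fun ⟨_, i, _, hi⟩ => ⟨i, hi.symm⟩⟩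

variable [NeZero N]

theorem setProcess_mem_avoid_iff (ξ : IndexSet N → CadlagPath E) (t : ℝ≥0) {U : Set E}
    (hU : IsOpen U) : setProcess ξ t ∈ NonemptyClosed.avoid U ↔
      ∀ n, Disjoint (occupied (fun j => (ξ j).1) (prefixList N n) t) U := by
  rw [setProcess, pointClosure_mem_avoid_iff _ hU, range_collisionRule, Set.disjoint_iUnion_left]

theorem setProcess_zero (ξ : IndexSet N → CadlagPath E) :
    setProcess ξ 0 = pointClosure fun i => (ξ i).1 0 := by
  refine pointClosure_eq_of_closure_range_eq (congrArg closure ?_)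
  rw [range_collisionRule]
  ext z
  simp only [occupied_zero, Set.mem_iUnion, Set.mem_ofPred_eq, Set.mem_range, mem_prefixList]
  exact ⟨fun ⟨_, i, _, hi⟩ => ⟨i, hi.symm⟩, fun ⟨i, hi⟩ => ⟨i.1, i, le_rfl, hi.symm⟩⟩

theorem preimage_setProcess_eq_iInter (K : Finset ℝ≥0) {U : ℝ≥0 → Set E}
    (hU : ∀ t, IsOpen (U t)) :
    {ξ : IndexSet N → CadlagPath E | ∀ t ∈ K, setProcess ξ t ∈ NonemptyClosed.avoid (U t)} =
      ⋂ n, avoiding K U (prefixList N n) := by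
  ext ξ
  simp only [setProcess_mem_avoid_iff ξ _ (hU _), Set.mem_iInter, avoiding, Set.mem_ofPred_eq]
  exact ⟨fun h n t ht => h t ht n, fun h t ht n => h n t ht⟩

end SetProcess

section Law

variable {E : Type*} [TopologicalSpace E] [LocallyCompactSpace E] [SecondCountableTopology E]
  [T2Space E]

open Classical in
/-- The σ-algebra on the paths of closed sets is generated by the events that finitely many open
sets are avoided at finitely many times. -/
theorem NonemptyClosed.measure_pi_ext {μ ν : Measure (ℝ≥0 → NonemptyClosed E)}
    [IsProbabilityMeasure μ] [IsProbabilityMeasure ν]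
    (h : ∀ (K : Finset ℝ≥0) (U : ℝ≥0 → Set E), (∀ t, IsOpen (U t)) →
      MeasurableSet {F : ℝ≥0 → NonemptyClosed E | ∀ t ∈ K, F t ∈ avoid (U t)} →
      μ {F | ∀ t ∈ K, F t ∈ avoid (U t)} = ν {F | ∀ t ∈ K, F t ∈ avoid (U t)}) :
    μ = ν := by
  let C : Set (Set (ℝ≥0 → NonemptyClosed E)) := {A | ∃ (K : Finset ℝ≥0) (U : ℝ≥0 → Set E),
    (∀ t, IsOpen (U t)) ∧ A = {F | ∀ t ∈ K, F t ∈ avoid (U t)}}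
  have hav {U : Set E} (hU : IsOpen U) : MeasurableSet (avoid U) := by
    rw [NonemptyClosed.measurableSpace_eq_generateFrom]
    exact MeasurableSpace.measurableSet_generateFrom ⟨U, hU, rfl⟩
  have hCm : ∀ A ∈ C, MeasurableSet A := by
    rintro A ⟨K, U, hU, rfl⟩
    simp only [Set.ofPred_forall]
    exact Finset.measurableSet_biInter _ fun t _ => measurable_pi_apply t (hav (hU t))
  refine ext_of_generate_finite C ?_ ?_ ?_ (by simp)
  · refine le_antisymm ?_ (MeasurableSpace.generateFrom_le hCm)
    refine iSup_le fun t => ?_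
    rw [NonemptyClosed.measurableSpace_eq_generateFrom, MeasurableSpace.comap_generateFrom]
    refine MeasurableSpace.generateFrom_mono ?_
    rintro _ ⟨_, ⟨U, hU, rfl⟩, rfl⟩
    exact ⟨{t}, fun _ => U, fun _ => hU, by ext F; simp⟩
  · rintro _ ⟨K, U, hU, rfl⟩ _ ⟨K', U', hU', rfl⟩ -
    -- Avoiding two sets is avoiding their union; the empty set imposes no condition at times
    -- outside K or K'.
    refine ⟨K ∪ K', fun t => (if t ∈ K then U t else ∅) ∪ (if t ∈ K' then U' t else ∅),
      fun t => IsOpen.union ?_ ?_, ?_⟩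
    · split_ifs
      exacts [hU t, isOpen_empty]
    · split_ifs
      exacts [hU' t, isOpen_empty]
    · have hempty : (avoid ∅ : Set (NonemptyClosed E)) = Set.univ :=
        Set.eq_univ_of_forall fun F => Set.disjoint_empty F.carrier
      ext F
      simp only [avoid_union, Set.mem_inter_iff, Set.mem_ofPred_eq, Finset.mem_union]
      constructor
      · rintro ⟨h1, h2⟩ t -
        refine ⟨?_, ?_⟩
        · split_ifs with ht
          exacts [h1 t ht, hempty ▸ trivial]
        · split_ifs with ht
          exacts [h2 t ht, hempty ▸ trivial]
      · intro h0
        exact ⟨fun t ht => by simpa [ht] using (h0 t (Or.inl ht)).1,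
          fun t ht => by simpa [ht] using (h0 t (Or.inr ht)).2⟩
  · rintro A ⟨K, U, hU, rfl⟩
    exact h K U hU (hCm _ ⟨K, U, hU, rfl⟩)

variable [MeasurableSpace E] [BorelSpace E] (X : FellerProcess E)

-- One measurable set of full measure inside the regular vectors serves all times at once; off it
-- the process is replaced by a constant.
open Classical in
theorem FellerProcess.setProcess_aemeasurable {N : ℕ∞} [NeZero N] (x : IndexSet N → E) :
    AEMeasurable (setProcess (E := E) (N := N)) (X.indepLaw x) := by
  obtain ⟨G, hG, hGm, hGr⟩ :=
    IsMeasurablyGenerated.exists_measurable_subset (X.regularVectors_mem_ae x)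
  refine ⟨G.piecewise setProcess fun _ _ => pointClosure x, ?_, ?_⟩
  · refine measurable_pi_iff.2 fun t => ?_
    rw [NonemptyClosed.measurableSpace_eq_generateFrom]
    refine measurable_generateFrom ?_
    rintro _ ⟨U, hU, rfl⟩
    have hA : MeasurableSet[regularPast E (IndexSet N) t] {ξ : IndexSet N → CadlagPath E |
        setProcess ξ t ∈ NonemptyClosed.avoid U} := by
      simp only [setProcess_mem_avoid_iff _ t hU, Set.ofPred_forall]
      exact MeasurableSet.iInter fun n => measurableSet_disjoint_occupied _ t hU.measurableSet
    obtain ⟨B, hB, hAB⟩ := hA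
    have : (fun ξ => G.piecewise setProcess (fun _ _ => pointClosure x) ξ t) ⁻¹'
        NonemptyClosed.avoid U = G.ite B {_ξ | pointClosure x ∈ NonemptyClosed.avoid U} := by
      ext ξ
      by_cases hξ : ξ ∈ G
      · have h1 := eventually_principal.1 hAB ξ (hGr hξ)
        simp only [Set.mem_preimage, Set.piecewise_eq_of_mem _ _ _ hξ, Set.ite, Set.mem_union,
          Set.mem_inter_iff, hξ, and_true, Set.mem_sdiff, not_true, and_false, or_false]
        exact iff_of_eq h1
      · simp [Set.ite, hξ]
    rw [this]
    exact hGm.ite (pastOutside_le _ _ _ hB) (MeasurableSet.const _)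
  · filter_upwards [hG] with ξ hξ
    exact (Set.piecewise_eq_of_mem _ _ _ hξ).symm

omit [LocallyCompactSpace E] [SecondCountableTopology E] [BorelSpace E] in
theorem FellerProcess.ae_setProcess_zero {N : ℕ∞} [NeZero N] (x : IndexSet N → E) :
    ∀ᵐ ξ ∂(X.indepLaw x), setProcess ξ 0 = pointClosure x := by
  filter_upwards [X.ae_start x] with ξ hξ
  rw [setProcess_zero]
  exact congrArg pointClosure (funext hξ)

variable {X}

theorem FellerProcess.ImmediateHit.measure_setProcess_le (hX : X.ImmediateHit) {N' N'' : ℕ∞}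
    [NeZero N'] [NeZero N''] {x' : IndexSet N' → E} {x'' : IndexSet N'' → E}
    (h : pointClosure x' = pointClosure x'') (K : Finset ℝ≥0) {U : ℝ≥0 → Set E}
    (hU : ∀ t, IsOpen (U t)) :
    X.indepLaw x' {ξ | ∀ t ∈ K, setProcess ξ t ∈ NonemptyClosed.avoid (U t)} ≤
      X.indepLaw x'' {ξ | ∀ t ∈ K, setProcess ξ t ∈ NonemptyClosed.avoid (U t)} := by
  -- Time 0 is a deterministic condition on the common starting set: if it holds, 0 may be dropped
  -- from K, and if it fails, the left side is 0.
  by_cases h0 : 0 ∈ K → pointClosure x' ∈ NonemptyClosed.avoid (U 0)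
  · calc _ ≤ X.indepLaw x'
          {ξ | ∀ t ∈ K.erase 0, setProcess ξ t ∈ NonemptyClosed.avoid (U t)} :=
          measure_mono fun ξ (hξ : ∀ t ∈ K, _) t ht => hξ t (Finset.mem_of_mem_erase ht)
      _ ≤ X.indepLaw x''
          {ξ | ∀ t ∈ K.erase 0, setProcess ξ t ∈ NonemptyClosed.avoid (U t)} := by
          rw [preimage_setProcess_eq_iInter _ hU, preimage_setProcess_eq_iInter _ hU]
          refine hX.measure_forall_avoiding_le x' x'' ?_
            (fun t ht => pos_iff_ne_zero.2 (Finset.ne_of_mem_erase ht)) hU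
          rw [closure_range_eq_of_pointClosure_eq h]
          exact subset_closure
      _ ≤ _ := by
          refine measure_mono_ae ?_
          filter_upwards [X.ae_setProcess_zero x''] with ξ hξ hK t ht
          by_cases h1 : t = 0
          · subst h1
            rw [hξ, ← h]
            exact h0 ht
          · exact hK t (Finset.mem_erase.2 ⟨h1, ht⟩)
  · push Not at h0
    refine (measure_mono_null (fun ξ hξ => ?_) (ae_iff.1 (X.ae_setProcess_zero x'))).trans_le
      zero_le
    intro h2
    exact h0.2 (h2 ▸ hξ 0 h0.1)

theorem FellerProcess.ImmediateHit.map_setProcess_eq (hX : X.ImmediateHit) {N' N'' : ℕ∞}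
    [NeZero N'] [NeZero N''] {x' : IndexSet N' → E} {x'' : IndexSet N'' → E}
    (h : pointClosure x' = pointClosure x'') :
    (X.indepLaw x').map setProcess = (X.indepLaw x'').map setProcess := by
  have := Measure.isProbabilityMeasure_map (X.setProcess_aemeasurable x')
  have := Measure.isProbabilityMeasure_map (X.setProcess_aemeasurable x'')
  refine NonemptyClosed.measure_pi_ext fun K U hU hm => ?_
  rw [Measure.map_apply_of_aemeasurable (X.setProcess_aemeasurable x') hm,
    Measure.map_apply_of_aemeasurable (X.setProcess_aemeasurable x'') hm]
  exact (hX.measure_setProcess_le h K hU).antisymm (hX.measure_setProcess_le h.symm K hU)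

end Law

theorem propositionp {E : Type*} [TopologicalSpace E] [LocallyCompactSpace E]
    [SecondCountableTopology E] [T2Space E] [MeasurableSpace E] [BorelSpace E]
    (X : FellerProcess E) (hX : X.ImmediateHit) :
    (∀ (N : ℕ∞) [NeZero N] (x' x'' : IndexSet N → E),
      closure (Set.range x') = closure (Set.range x'') →
        IdentDistrib (setProcess (E := E) (N := N)) (setProcess (E := E) (N := N))
          (X.vectorLaw x') (X.vectorLaw x'')) ∧
    (∃ Q : NonemptyClosed E → Measure (ℝ≥0 → NonemptyClosed E),
      ∀ (N : ℕ∞) [NeZero N] (x : IndexSet N → E),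
        (∀ᵐ ξ ∂(X.vectorLaw x), setProcess ξ 0 = pointClosure x) ∧
        Measure.map (setProcess (E := E) (N := N)) (X.vectorLaw x) = Q (pointClosure x)) := by
  refine ⟨fun N _ x' x'' h => ⟨X.setProcess_aemeasurable x', X.setProcess_aemeasurable x'',
    hX.map_setProcess_eq (pointClosure_eq_of_closure_range_eq h)⟩, ?_⟩
  have key (F : NonemptyClosed E) : ∃ ν : Measure (ℝ≥0 → NonemptyClosed E),
      ∀ (N : ℕ∞) [NeZero N] (x : IndexSet N → E), pointClosure x = F →
        (X.vectorLaw x).map setProcess = ν := by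
    by_cases h : ∃ (N : ℕ∞) (_ : NeZero N) (x : IndexSet N → E), pointClosure x = F
    · obtain ⟨N, _, x, hx⟩ := h
      exact ⟨(X.vectorLaw x).map setProcess, fun N' _ x' hx' =>
        hX.map_setProcess_eq (hx'.trans hx.symm)⟩
    -- The value 0 is a default for sets that no vector represents, so it need not be shown that
    -- every closed set is the closure of a vector.
    · exact ⟨0, fun N _ x hx => absurd ⟨N, _, x, hx⟩ h⟩
  choose Q hQ using key
  exact ⟨Q, fun N _ x => ⟨X.ae_setProcess_zero x, hQ _ N x rfl⟩⟩
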